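/- Let $c\ge 1$ be an integer and equip $M=\mathbb S^2\times\mathbb S^1$ with the Lorentzian metric $g_c=g_\circ-\frac1{c^2}\,dt^2$, where $g_\circ$ is the round metric of the unit sphere $\mathbb S^2\subset\mathbb R^3$ and $t$ is the angle coordinate of $\mathbb S^1$, and with the time orientation given by $\partial_t$. Let $C^+\subset TM$ be the bundle of nonzero future-pointing null vectors and let $\mathcal N_c$ be the set of images of the maximal geodesics $\gamma$ of $(M,g_c)$ with $\dot\gamma\subset C^+$. Then $\mathcal N_c$ carries a smooth (Hausdorff, second countable) $3$-manifold structure for which the projection $C^+\to\mathcal N_c$, sending a vector to the null geodesic tangent to it, is a submersion; equip $\mathcal N_c$ with this structure. For $m\in M$ let $\mathfrak S_m=\{\gamma\in\mathcal N_c: m\in\gamma\}$ be the sky of $m$. The canonical contact structure $\mathcal H$ of $\mathcal N_c$ is the codimension-one distribution given by $\mathcal H_\gamma=T_\gamma\mathfrak S_m\oplus T_\gamma\mathfrak S_{m'}$ for any $m,m'\in\gamma$ that cannot be joined by a one-parameter family of null geodesics containing $\gamma$ (such $m,m'$ exist for every $\gamma$, and the result does not depend on them). Let $ST\mathbb S^2=\{(x,u)\in\mathbb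 S^2\times\mathbb S^2:\langle x,u\rangle=0\}$ be the unit tangent bundle, $\pi(x,u)=x$ its projection, and $\chi_{(x,u)}=(T_{(x,u)}\pi)^{-1}(\langle u\rangle^\perp)$ its canonical contact structure. Let $L(2c,1)=\mathbb S^3/\mathbb Z_{2c}$, where $\mathbb S^3\subset\mathbb C^2$ and the generator of $\mathbb Z_{2c}$ acts by multiplication by $e^{\pi i/c}$. Identify $\mathbb C^2$ with the quaternions by $(z_0,z_1)\mapsto z_0+z_1j$, let $\Phi:\mathbb S^3\to ST\mathbb S^2$, $\Phi(q)=(q^{-1}kq,\,q^{-1}jq)$, which induces a diffeomorphism $L(2,1)=\mathbb S^3/\{\pm1\}\cong ST\mathbb S^2$, and let $r:ST\mathbb S^2\to L(2c,1)$ be the projection determined by $r(\Phi(q))=[q]$. For $(x,u)\in ST\mathbb S^2$ let $\gamma_{(x,u)}=\{(x\cos s+u\sin s,\ cs \bmod 2\pi): s\in\mathbb R\}\subset M$. 1. If $c=1$, then $(x,u)\mapsto\gamma_{(x,u)}$ is a diffeomorphism $ST\mathbb S^2\to\mathcal N_1$, and it maps $\chi$ to $\mathcal H$. 2. If $c>1$,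 then $r$ is a local diffeomorphism, $r(x,u)\mapsto\gamma_{(x,u)}$ is a well-defined diffeomorphism $L(2c,1)\to\mathcal N_c$, the pushforward distribution $r_*\chi$ on $L(2c,1)$, $(r_*\chi)_{r(p)}=T_pr(\chi_p)$, is well defined, and the diffeomorphism maps $r_*\chi$ to $\mathcal H$. -/

import Mathlib

open Metric Set
open scoped Manifold ContDiff Quaternion

noncomputable section

namespace NullGeodesics

/-- The unit sphere `S² ⊂ ℝ³`. -/
abbrev S2 := sphere (0 : EuclideanSpace ℝ (Fin 3)) 1

/-- The unit sphere `S³ ⊂ ℂ²`. -/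
abbrev S3 := sphere (0 : EuclideanSpace ℂ (Fin 2)) 1

instance finrank_C2 : Fact (Module.finrank ℝ (EuclideanSpace ℂ (Fin 2)) = 3 + 1) := ⟨by
  rw [(WithLp.linearEquiv 2 ℝ (Fin 2 → ℂ)).finrank_eq]
  simp [Module.finrank_pi_fintype]⟩

/-! ### Lens spaces -/

/-- `S¹` acts on `S³ ⊂ ℂ²` by `ζ • (z₀, z₁) = (ζ z₀, ζ z₁)`. -/
instance circleActionS3 : MulAction Circle S3 where
  smul ζ z := ⟨(ζ : ℂ) • (z : EuclideanSpace ℂ (Fin 2)), by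
    rw [mem_sphere_zero_iff_norm, norm_smul, Circle.norm_coe, norm_eq_of_mem_sphere, one_mul]⟩
  one_smul z := Subtype.ext (by
    change ((1 : Circle) : ℂ) • (z : EuclideanSpace ℂ (Fin 2)) = z
    simp)
  mul_smul a b z := Subtype.ext (by
    change ((a * b : Circle) : ℂ) • (z : EuclideanSpace ℂ (Fin 2)) =
      (a : ℂ) • (b : ℂ) • (z : EuclideanSpace ℂ (Fin 2))
    rw [Circle.coe_mul, mul_smul])

theorem coe_circle_smul (ζ : Circle) (z : S3) :
    ((ζ • z : S3) : EuclideanSpace ℂ (Fin 2)) = (ζ : ℂ) • (z : EuclideanSpace ℂ (Fin 2)) := rfl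

/-- The cyclic group of order `p` generated by `e^{2πi/p}`. -/
abbrev rootGroup (p : ℕ) : Subgroup Circle := Subgroup.zpowers (Circle.exp (2 * Real.pi / p))

theorem circle_exp_pow (x : ℝ) (n : ℕ) : Circle.exp x ^ n = Circle.exp (n * x) := by
  induction n with
  | zero => simp
  | succ n ih => rw [pow_succ, ih, ← Circle.exp_add]; congr 1; push_cast; ring

instance finite_rootGroup (p : ℕ) : Finite (rootGroup p) := by
  rw [← SetLike.coe_sort_coe, Set.finite_coe_iff, finite_zpowers, isOfFinOrder_iff_pow_eq_one]
  rcases Nat.eq_zero_or_pos p with rfl | hp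
  · exact ⟨1, one_pos, by simp⟩
  · refine ⟨p, hp, ?_⟩
    have : (p : ℝ) ≠ 0 := by positivity
    rw [circle_exp_pow, mul_div_cancel₀ _ this, Circle.exp_two_pi]

instance continuousConstSMul_S3 (p : ℕ) : ContinuousConstSMul (rootGroup p) S3 where
  continuous_const_smul ζ := by
    refine Continuous.subtype_mk (f := fun z : S3 ↦
      (((ζ : Circle) : ℂ)) • (z : EuclideanSpace ℂ (Fin 2))) ?_ _
    fun_prop

instance isCancelSMul_S3 (p : ℕ) : IsCancelSMul (rootGroup p) S3 where
  right_cancel' a b z h := by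
    have h' : ((a : Circle) : ℂ) • (z : EuclideanSpace ℂ (Fin 2)) =
      ((b : Circle) : ℂ) • (z : EuclideanSpace ℂ (Fin 2)) := congrArg Subtype.val h
    exact Subtype.ext (Circle.ext (smul_left_injective ℂ (ne_zero_of_mem_unit_sphere z) h'))

/-- The lens space `L(p,1) = S³ / ℤ_p`, with the quotient topology and the smooth atlas for which
the projection from `S³` is a local diffeomorphism (the quotient atlas of Mathlib). -/
abbrev LensSpace (p : ℕ) : Type := MulAction.orbitRel.Quotient (rootGroup p) S3

/-- The projection `S³ → L(p,1)`. -/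
def lensMk (p : ℕ) : S3 → LensSpace p := Quotient.mk (MulAction.orbitRel (rootGroup p) S3)

/-! ### The unit tangent bundle of `S²` -/

/-- `ST S² = {(x, u) ∈ S² × S² | ⟨x, u⟩ = 0}`, with the subspace topology. -/
abbrev STS2 : Type := {p : S2 × S2 //
  inner ℝ (p.1 : EuclideanSpace ℝ (Fin 3)) (p.2 : EuclideanSpace ℝ (Fin 3)) = 0}

/-- The bundle projection `π : ST S² → S²`. -/
def STS2.base (p : STS2) : S2 := p.1.1

/-- The identification `ℂ² ≅ ℍ`, `(z₀, z₁) ↦ z₀ + z₁ j`. -/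
def toQuat (z : EuclideanSpace ℂ (Fin 2)) : ℍ[ℝ] := ⟨(z 0).re, (z 0).im, (z 1).re, (z 1).im⟩

/-- The vector part of a quaternion. -/
def vecPart (q : ℍ[ℝ]) : EuclideanSpace ℝ (Fin 3) := !₂[q.imI, q.imJ, q.imK]

/-- The quaternion `j`. -/
def quatJ : ℍ[ℝ] := ⟨0, 0, 1, 0⟩

/-- The quaternion `k`. -/
def quatK : ℍ[ℝ] := ⟨0, 0, 0, 1⟩

theorem quatJ_comp : quatJ.re = 0 ∧ quatJ.imI = 0 ∧ quatJ.imJ = 1 ∧ quatJ.imK = 0 :=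
  ⟨rfl, rfl, rfl, rfl⟩

theorem quatK_comp : quatK.re = 0 ∧ quatK.imI = 0 ∧ quatK.imJ = 0 ∧ quatK.imK = 1 :=
  ⟨rfl, rfl, rfl, rfl⟩

theorem normSq_toQuat (z : S3) : Quaternion.normSq (toQuat z) = 1 := by
  have h := norm_eq_of_mem_sphere z
  rw [EuclideanSpace.norm_eq, Real.sqrt_eq_one] at h
  simp only [Fin.sum_univ_two, Complex.sq_norm, Complex.normSq_apply] at h
  rw [Quaternion.normSq_def']
  simp only [toQuat]
  linarith

theorem inv_toQuat (z : S3) : (toQuat z)⁻¹ = star (toQuat z) := by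
  rw [Quaternion.inv_def, normSq_toQuat, inv_one, one_smul]

theorem inner_conj (z : S3) (v w : ℍ[ℝ]) (hv : v.re = 0) (hw : w.re = 0) :
    inner ℝ (vecPart ((toQuat z)⁻¹ * v * toQuat z)) (vecPart ((toQuat z)⁻¹ * w * toQuat z)) =
      v.imI * w.imI + v.imJ * w.imJ + v.imK * w.imK := by
  have h := normSq_toQuat z
  rw [inv_toQuat, PiLp.inner_apply]
  rw [Quaternion.normSq_def'] at h
  generalize toQuat z = q at *
  simp [Fin.sum_univ_three, vecPart, hv, hw]
  have h2 : (q.re^2 + q.imI^2 + q.imJ^2 + q.imK^2)^2 = 1 := by rw [h]; ring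
  linear_combination (v.imI * w.imI + v.imJ * w.imJ + v.imK * w.imK) * h2

theorem vecPart_conj_mem (z : S3) (v : ℍ[ℝ]) (hv : v.re = 0)
    (h1 : v.imI * v.imI + v.imJ * v.imJ + v.imK * v.imK = 1) :
    vecPart ((toQuat z)⁻¹ * v * toQuat z) ∈ S2 := by
  rw [mem_sphere_zero_iff_norm, ← sq_eq_sq₀ (norm_nonneg _) zero_le_one, ← real_inner_self_eq_norm_sq,
    inner_conj z v v hv hv, h1, one_pow]

/-- The map `Φ : S³ → ST S²`, `q ↦ (q⁻¹ k q, q⁻¹ j q)`. -/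
def Phi (z : S3) : STS2 :=
  ⟨(⟨vecPart ((toQuat z)⁻¹ * quatK * toQuat z), vecPart_conj_mem z _ rfl (by simp [quatK])⟩,
    ⟨vecPart ((toQuat z)⁻¹ * quatJ * toQuat z), vecPart_conj_mem z _ rfl (by simp [quatJ])⟩),
    (inner_conj z quatK quatJ rfl rfl).trans (by simp [quatJ, quatK])⟩

theorem continuous_toQuat : Continuous toQuat := by
  have h : Continuous fun z : EuclideanSpace ℂ (Fin 2) ↦ Quaternion.linearIsometryEquivTuple.symm
      !₂[(z 0).re, (z 0).im, (z 1).re, (z 1).im] :=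
    Quaternion.linearIsometryEquivTuple.symm.continuous.comp (by fun_prop)
  exact h

theorem continuous_vecPart : Continuous vecPart := by
  unfold vecPart
  have := Quaternion.continuous_imI
  have := Quaternion.continuous_imJ
  have := Quaternion.continuous_imK
  fun_prop

theorem continuous_Phi : Continuous Phi := by
  have hq : Continuous fun z : S3 ↦ toQuat z := continuous_toQuat.comp continuous_subtype_val
  have h (v : ℍ[ℝ]) : Continuous fun z : S3 ↦ vecPart ((toQuat z)⁻¹ * v * toQuat z) := by
    simp only [inv_toQuat]
    exact continuous_vecPart.comp ((hq.star.mul continuous_const).mul hq)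
  exact (((h quatK).subtype_mk _).prodMk ((h quatJ).subtype_mk _)).subtype_mk _

/-- The pure quaternion with a given vector part. -/
def pureQuat (x : EuclideanSpace ℝ (Fin 3)) : ℍ[ℝ] := ⟨0, x 0, x 1, x 2⟩

theorem pureQuat_comp (x : EuclideanSpace ℝ (Fin 3)) : (pureQuat x).re = 0 ∧
    (pureQuat x).imI = x 0 ∧ (pureQuat x).imJ = x 1 ∧ (pureQuat x).imK = x 2 :=
  ⟨rfl, rfl, rfl, rfl⟩

theorem vecPart_pureQuat (x : EuclideanSpace ℝ (Fin 3)) : vecPart (pureQuat x) = x := by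
  ext i; fin_cases i <;> rfl

theorem pureQuat_vecPart (q : ℍ[ℝ]) (hq : q.re = 0) : pureQuat (vecPart q) = q := by
  ext <;> simp [pureQuat, vecPart, hq]

theorem conj_re (z : S3) (v : ℍ[ℝ]) (hv : v.re = 0) :
    ((toQuat z)⁻¹ * v * toQuat z).re = 0 := by
  rw [inv_toQuat]
  simp [hv]
  ring

theorem exists_intertwiner (p : STS2) :
    ∃ q : ℍ[ℝ], q ≠ 0 ∧ quatK * q = q * pureQuat p.1.1 ∧ quatJ * q = q * pureQuat p.1.2 := by
  obtain ⟨⟨⟨x, hx⟩, ⟨u, hu⟩⟩, hxu⟩ := p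
  have hx' : x 0 ^ 2 + x 1 ^ 2 + x 2 ^ 2 = 1 := by
    have := norm_eq_of_mem_sphere (⟨x, hx⟩ : S2)
    rw [EuclideanSpace.norm_eq, Real.sqrt_eq_one] at this
    simpa [Fin.sum_univ_three] using this
  have hu' : u 0 ^ 2 + u 1 ^ 2 + u 2 ^ 2 = 1 := by
    have := norm_eq_of_mem_sphere (⟨u, hu⟩ : S2)
    rw [EuclideanSpace.norm_eq, Real.sqrt_eq_one] at this
    simpa [Fin.sum_univ_three] using this
  have hxu' : x 0 * u 0 + x 1 * u 1 + x 2 * u 2 = 0 := by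
    simp only [PiLp.inner_apply, Fin.sum_univ_three] at hxu
    simp at hxu
    linarith
  set X := pureQuat x with hX
  set U := pureQuat u with hU
  have hXX : X * X = -1 := by
    ext <;> simp [hX, pureQuat_comp] <;> linarith
  have hUU : U * U = -1 := by
    ext <;> simp [hU, pureQuat_comp] <;> linarith
  have hUX : U * X = -(X * U) := by
    ext <;> simp [hU, hX, pureQuat_comp] <;> linarith
  have hKK : quatK * quatK = -1 := by ext <;> simp [quatK_comp]
  have hJJ : quatJ * quatJ = -1 := by ext <;> simp [quatJ_comp]
  have hJK : quatJ * quatK = -(quatK * quatJ) := by ext <;> simp [quatJ_comp, quatK_comp]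
  let Q : ℍ[ℝ] → ℍ[ℝ] := fun a ↦
    a - quatK * a * X - quatJ * a * U - quatK * quatJ * a * (X * U)
  have h1 (a : ℍ[ℝ]) : quatK * Q a = Q a * X := by
    have e1 : quatK * Q a = quatK * a - (quatK * quatK) * a * X - quatK * quatJ * a * U
      - (quatK * quatK) * quatJ * a * (X * U) := by simp only [Q]; noncomm_ring
    have e2 : Q a * X = a * X - quatK * a * (X * X) - quatJ * a * (U * X)
      - quatK * quatJ * a * (X * (U * X)) := by simp only [Q]; noncomm_ring
    have e3 : X * (U * X) = U := by
      rw [hUX, mul_neg, ← mul_assoc, hXX]; noncomm_ring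
    rw [e1, e2, e3, hKK, hXX, hUX]; noncomm_ring
  have h2 (a : ℍ[ℝ]) : quatJ * Q a = Q a * U := by
    have e1 : quatJ * Q a = quatJ * a - (quatJ * quatK) * a * X - (quatJ * quatJ) * a * U
      - (quatJ * quatK * quatJ) * a * (X * U) := by simp only [Q]; noncomm_ring
    have e2 : Q a * U = a * U - quatK * a * (X * U) - quatJ * a * (U * U)
      - quatK * quatJ * a * (X * (U * U)) := by simp only [Q]; noncomm_ring
    have e3 : quatJ * quatK * quatJ = quatK := by
      rw [hJK, neg_mul, mul_assoc, hJJ]; noncomm_ring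
    rw [e1, e2, e3, hJK, hJJ, hUU]; noncomm_ring
  by_contra! hcon
  have hz (a : ℍ[ℝ]) : Q a = 0 := by
    by_contra hne
    exact hcon (Q a) hne (h1 a) (h2 a)
  have t1 := congrArg QuaternionAlgebra.re (hz 1)
  have t2 := congrArg QuaternionAlgebra.imI (hz (quatJ * quatK))
  have t3 := congrArg QuaternionAlgebra.imJ (hz quatJ)
  have t4 := congrArg QuaternionAlgebra.imK (hz quatK)
  simp [Q, quatK_comp, quatJ_comp, hX, hU, pureQuat_comp] at t1 t2 t3 t4
  linarith

theorem exists_toQuat (q : ℍ[ℝ]) (hq : Quaternion.normSq q = 1) : ∃ z : S3, toQuat z = q := by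
  refine ⟨⟨!₂[⟨q.re, q.imI⟩, ⟨q.imJ, q.imK⟩], ?_⟩, by ext <;> simp [toQuat]⟩
  rw [mem_sphere_zero_iff_norm, EuclideanSpace.norm_eq, Real.sqrt_eq_one]
  rw [Quaternion.normSq_def'] at hq
  simp [Fin.sum_univ_two, Complex.sq_norm, Complex.normSq_apply]
  linarith

theorem toQuat_neg (z : EuclideanSpace ℂ (Fin 2)) : toQuat (-z) = -toQuat z := by
  ext <;> rfl

theorem toQuat_ne_zero (z : S3) : toQuat z ≠ 0 := by
  intro h
  have := normSq_toQuat z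
  rw [h] at this
  simp at this

theorem toQuat_injective : Function.Injective toQuat := by
  intro z w h
  have h1 := congrArg QuaternionAlgebra.re h
  have h2 := congrArg QuaternionAlgebra.imI h
  have h3 := congrArg QuaternionAlgebra.imJ h
  have h4 := congrArg QuaternionAlgebra.imK h
  ext i
  fin_cases i
  · exact Complex.ext h1 h2
  · exact Complex.ext h3 h4

theorem Phi_surjective : Function.Surjective Phi := by
  intro p
  obtain ⟨q, hq, hk, hj⟩ := exists_intertwiner p
  have hn : ‖q‖ ≠ 0 := norm_ne_zero_iff.2 hq
  obtain ⟨z, hz⟩ := exists_toQuat (‖q‖⁻¹ • q) (by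
    rw [Quaternion.normSq_eq_norm_mul_self, norm_smul, norm_inv, norm_norm, inv_mul_cancel₀ hn,
      one_mul])
  have key (v : ℍ[ℝ]) (x : EuclideanSpace ℝ (Fin 3)) (h : v * q = q * pureQuat x) :
      vecPart ((toQuat z)⁻¹ * v * toQuat z) = x := by
    have h' : v * toQuat z = toQuat z * pureQuat x := by
      rw [hz, mul_smul_comm, h, smul_mul_assoc]
    rw [mul_assoc, h', inv_mul_cancel_left₀ (toQuat_ne_zero z), vecPart_pureQuat]
  refine ⟨z, Subtype.ext (Prod.ext (Subtype.ext ?_) (Subtype.ext ?_))⟩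
  · exact key _ _ hk
  · exact key _ _ hj

theorem Phi_eq_iff (z w : S3) : Phi z = Phi w ↔ w = z ∨ w = -z := by
  constructor
  · intro h
    have key (v : ℍ[ℝ]) (hv : v.re = 0)
        (h : vecPart ((toQuat z)⁻¹ * v * toQuat z) = vecPart ((toQuat w)⁻¹ * v * toQuat w)) :
        v * (toQuat w * (toQuat z)⁻¹) = (toQuat w * (toQuat z)⁻¹) * v := by
      have h1 := congrArg pureQuat h
      rw [pureQuat_vecPart _ (conj_re z v hv), pureQuat_vecPart _ (conj_re w v hv)] at h1
      have hw := toQuat_ne_zero w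
      have hz := toQuat_ne_zero z
      calc v * (toQuat w * (toQuat z)⁻¹)
          = toQuat w * ((toQuat w)⁻¹ * v * toQuat w) * (toQuat z)⁻¹ := by
            simp only [mul_assoc, mul_inv_cancel_left₀ hw]
        _ = (toQuat w * (toQuat z)⁻¹) * v := by
            rw [← h1]; simp only [mul_assoc, mul_inv_cancel₀ hz, mul_one]
    have hk := key quatK rfl (congrArg (fun p : STS2 ↦ (p.1.1 : EuclideanSpace ℝ (Fin 3))) h)
    have hj := key quatJ rfl (congrArg (fun p : STS2 ↦ (p.1.2 : EuclideanSpace ℝ (Fin 3))) h)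
    have ha : Quaternion.normSq (toQuat w * (toQuat z)⁻¹) = 1 := by
      rw [map_mul, map_inv₀, normSq_toQuat, normSq_toQuat]; simp
    have hwz : toQuat w = toQuat w * (toQuat z)⁻¹ * toQuat z := by
      rw [mul_assoc, inv_mul_cancel₀ (toQuat_ne_zero z), mul_one]
    generalize toQuat w * (toQuat z)⁻¹ = a at *
    have k1 := congrArg QuaternionAlgebra.imI hk
    have k2 := congrArg QuaternionAlgebra.imJ hk
    have j1 := congrArg QuaternionAlgebra.imI hj
    simp [quatK_comp, quatJ_comp] at k1 k2 j1
    have a1 : a.imI = 0 := by linarith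
    have a2 : a.imJ = 0 := by linarith
    have a3 : a.imK = 0 := by linarith
    rw [Quaternion.normSq_def', a1, a2, a3] at ha
    have hr : a.re = 1 ∨ a.re = -1 := sq_eq_one_iff.1 (by linarith)
    rcases hr with hr | hr
    · left
      have ha1 : a = 1 := by ext <;> simp [hr, a1, a2, a3]
      rw [ha1, one_mul] at hwz
      exact Subtype.ext (toQuat_injective hwz)
    · right
      have ha1 : a = -1 := by ext <;> simp [hr, a1, a2, a3]
      rw [ha1, neg_one_mul, ← toQuat_neg] at hwz
      exact Subtype.ext (toQuat_injective hwz)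
  · rintro (rfl | rfl)
    · rfl
    · refine Subtype.ext (Prod.ext (Subtype.ext ?_) (Subtype.ext ?_)) <;>
      simp [Phi, toQuat_neg, inv_neg]

theorem coe_exp_pi : ((Circle.exp Real.pi : Circle) : ℂ) = -1 := by
  rw [Circle.coe_exp, Complex.exp_pi_mul_I]

theorem lensMk_neg (c : ℕ) (hc : 1 ≤ c) (z : S3) : lensMk (2 * c) (-z) = lensMk (2 * c) z := by
  refine Quotient.sound ⟨⟨Circle.exp (2 * Real.pi / (2 * c : ℕ)) ^ c,
    Subgroup.npow_mem_zpowers _ _⟩, Subtype.ext ?_⟩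
  change ((Circle.exp (2 * Real.pi / (2 * c : ℕ)) ^ c : Circle) : ℂ) •
    (z : EuclideanSpace ℂ (Fin 2)) = -z
  have : (c : ℝ) ≠ 0 := by positivity
  rw [circle_exp_pow, show (c : ℝ) * (2 * Real.pi / (2 * c : ℕ)) = Real.pi by
    push_cast; field_simp, coe_exp_pi, neg_one_smul]

theorem lensMk_two_eq_iff (z w : S3) : lensMk 2 z = lensMk 2 w ↔ Phi z = Phi w := by
  rw [Phi_eq_iff]
  constructor
  · intro h
    obtain ⟨⟨g, hg⟩, h⟩ := Quotient.exact h
    obtain ⟨n, rfl⟩ := hg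
    have h' := congrArg Subtype.val h
    change ((Circle.exp (2 * Real.pi / (2 : ℕ)) ^ n : Circle) : ℂ) •
      (w : EuclideanSpace ℂ (Fin 2)) = z at h'
    rw [show 2 * Real.pi / (2 : ℕ) = Real.pi by push_cast; ring, Circle.coe_zpow, coe_exp_pi] at h'
    rcases Int.even_or_odd n with hn | hn
    · left
      rw [hn.neg_one_zpow, one_smul] at h'
      exact Subtype.ext h'
    · right
      rw [hn.neg_one_zpow, neg_one_smul] at h'
      exact Subtype.ext (by rw [coe_neg_sphere, ← h', neg_neg])
  · rintro (rfl | rfl)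
    · rfl
    · exact (lensMk_neg 1 le_rfl z).symm

theorem isLocalHomeomorph_lensMk (p : ℕ) : IsLocalHomeomorph (lensMk p) :=
  (isQuotientCoveringMap_quotientMk_of_properlyDiscontinuousSMul
    (G := rootGroup p) (E := S3)).isCoveringMap.isLocalHomeomorph

theorem isLocalHomeomorph_Phi : IsLocalHomeomorph Phi := by
  let F : LensSpace 2 → STS2 := Quotient.lift Phi fun z w h ↦
    (lensMk_two_eq_iff z w).1 (Quotient.sound h)
  have hF : Continuous F := continuous_Phi.quotient_lift _
  have hb : Function.Bijective F := by
    constructor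
    · rintro ⟨z⟩ ⟨w⟩ h
      exact (lensMk_two_eq_iff z w).2 h
    · intro p
      obtain ⟨z, rfl⟩ := Phi_surjective p
      exact ⟨lensMk 2 z, rfl⟩
  have h := (hF.homeoOfEquivCompactToT2 (f := Equiv.ofBijective F hb)).isLocalHomeomorph.comp
    (isLocalHomeomorph_lensMk 2)
  exact h

/-- The smooth structure of `ST S²`: the one for which `Φ : S³ → ST S²`, a two-to-one local
homeomorphism, is a local diffeomorphism. By `STS2.incl_smooth_immersion` below the inclusion
`ST S² ⊂ ℝ³ × ℝ³` is a smooth immersion (and a topological embedding), so this is the structure of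
`ST S²` as a submanifold of `ℝ³ × ℝ³`. -/
instance : ChartedSpace (EuclideanSpace ℝ (Fin 3)) STS2 :=
  isLocalHomeomorph_Phi.chartedSpace Phi_surjective

open IsLocalHomeomorph in
/-- The quotient atlas is smooth if the deck transformations are. -/
theorem isManifold_of_deck {M M' : Type*} [TopologicalSpace M] [TopologicalSpace M']
    [ChartedSpace (EuclideanSpace ℝ (Fin 3)) M] [IsManifold (𝓡 3) ∞ M]
    {f : M → M'} (hf : IsLocalHomeomorph f) (hs : Function.Surjective f)
    (hd : ∀ x y, f x = f y → ∃ g : M → M, ContMDiff (𝓡 3) (𝓡 3) ∞ g ∧ (∀ z, f (g z) = f z) ∧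
      g x = y) :
    @IsManifold ℝ _ _ _ _ _ _ (𝓡 3) ∞ M' _ (hf.chartedSpace hs) := by
  let _ := hf.chartedSpace (H := EuclideanSpace ℝ (Fin 3)) hs
  apply isManifold_of_contDiffOn
  rintro _ _ ⟨q, rfl⟩ ⟨q', rfl⟩
  generalize hs.hasRightInverse.choose q = a
  generalize hs.hasRightInverse.choose q' = b
  intro y hy
  simp only [mfld_simps, localInverseAt_symm] at hy
  obtain ⟨⟨hy1, hy2⟩, hy3, hy4⟩ := hy
  apply ContDiffAt.contDiffWithinAt
  rw [← contMDiffAt_iff_contDiffAt]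
  set m := (chartAt (EuclideanSpace ℝ (Fin 3)) a).symm y with hm
  obtain ⟨g, hg, hfg, hgm⟩ := hd m (hf.localInverseAt b (f m))
    (hf.apply_localInverseAt_of_mem hy3).symm
  have hca : ContMDiffAt (𝓡 3) (𝓡 3) ∞ (chartAt (EuclideanSpace ℝ (Fin 3)) a).symm y :=
    (contMDiffOn_chart_symm (I := 𝓡 3) (x := a)).contMDiffAt
      ((chartAt (EuclideanSpace ℝ (Fin 3)) a).open_target.mem_nhds hy1)
  have hcb : ContMDiffAt (𝓡 3) (𝓡 3) ∞ (chartAt (EuclideanSpace ℝ (Fin 3)) b) (g m) :=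
    (contMDiffOn_chart (I := 𝓡 3) (x := b)).contMDiffAt
      ((chartAt (EuclideanSpace ℝ (Fin 3)) b).open_source.mem_nhds (by rw [hgm]; exact hy4))
  have hcomp := ContMDiffAt.comp y (hcb.comp m (hg m)) hca
  refine hcomp.congr_of_eventuallyEq ?_
  have hgt : ∀ᶠ z in nhds m, g z ∈ (hf.localInverseAt b).target := by
    refine hg.continuous.continuousAt.eventually_mem
      ((hf.localInverseAt b).open_target.mem_nhds ?_)
    rw [hgm]
    exact (hf.localInverseAt b).map_source hy3
  filter_upwards [hca.continuousAt.eventually hgt] with z hz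
  have h1 := (hf.localInverseAt b).right_inv hz
  rw [localInverseAt_symm, hfg] at h1
  simp [localInverseAt_symm, h1]

theorem contMDiff_const_smul_S3 (ζ : Circle) : ContMDiff (𝓡 3) (𝓡 3) ∞ fun z : S3 ↦ ζ • z := by
  refine ContMDiff.codRestrict_sphere (f := fun z : S3 ↦
    (ζ : ℂ) • (z : EuclideanSpace ℂ (Fin 2))) ?_ _
  have h : ContDiff ℝ ∞ fun z : EuclideanSpace ℂ (Fin 2) ↦ (ζ : ℂ) • z := by fun_prop
  exact h.contMDiff.comp contMDiff_coe_sphere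

instance (p : ℕ) : IsManifold (𝓡 3) ∞ (LensSpace p) := by
  refine isManifold_of_deck (isLocalHomeomorph_lensMk p) Quotient.mk_surjective ?_
  intro x y h
  obtain ⟨g, hg⟩ := Quotient.exact h.symm
  exact ⟨fun z ↦ (g : Circle) • z, contMDiff_const_smul_S3 g,
    fun z ↦ Quotient.sound ⟨g, rfl⟩, hg⟩

instance : IsManifold (𝓡 3) ∞ STS2 := by
  refine isManifold_of_deck isLocalHomeomorph_Phi Phi_surjective ?_
  intro x y h
  rcases (Phi_eq_iff x y).1 h with rfl | rfl
  · exact ⟨id, contMDiff_id, fun _ ↦ rfl, rfl⟩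
  · exact ⟨fun z ↦ -z, contMDiff_neg_sphere, fun z ↦ ((Phi_eq_iff z (-z)).2 (.inr rfl)).symm, rfl⟩

/-- The inclusion of `ST S²` in `ℝ³ × ℝ³`. -/
def STS2.incl (p : STS2) : EuclideanSpace ℝ (Fin 3) × EuclideanSpace ℝ (Fin 3) := (p.1.1, p.1.2)

/-- `toQuat` as a continuous linear map. -/
def toQuatL : EuclideanSpace ℂ (Fin 2) →L[ℝ] ℍ[ℝ] :=
  LinearMap.toContinuousLinearMap
    { toFun := toQuat
      map_add' := fun z w ↦ by ext <;> rfl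
      map_smul' := fun t z ↦ by
        ext
        · exact Complex.smul_re t (z 0)
        · exact Complex.smul_im t (z 0)
        · exact Complex.smul_re t (z 1)
        · exact Complex.smul_im t (z 1) }

/-- `vecPart` as a continuous linear map. -/
def vecPartL : ℍ[ℝ] →L[ℝ] EuclideanSpace ℝ (Fin 3) :=
  LinearMap.toContinuousLinearMap
    { toFun := vecPart
      map_add' := fun z w ↦ by ext i; fin_cases i <;> rfl
      map_smul' := fun t z ↦ by ext i; fin_cases i <;> rfl }

/-- Quaternion conjugation as a continuous linear map. -/
def starL : ℍ[ℝ] →L[ℝ] ℍ[ℝ] :=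
  LinearMap.toContinuousLinearMap
    { toFun := star
      map_add' := star_add
      map_smul' := fun t z ↦ by ext <;> simp }

theorem hasFDerivAt_conj (v : ℍ[ℝ]) (z : EuclideanSpace ℂ (Fin 2)) :
    ∃ D : EuclideanSpace ℂ (Fin 2) →L[ℝ] EuclideanSpace ℝ (Fin 3),
      HasFDerivAt (fun z ↦ vecPart (star (toQuat z) * v * toQuat z)) D z ∧
      ∀ w, D w = vecPart (star (toQuat w) * v * toQuat z + star (toQuat z) * v * toQuat w) := by
  have h1 : HasFDerivAt (fun z ↦ star (toQuat z)) (starL.comp toQuatL) z :=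
    (starL.comp toQuatL).hasFDerivAt
  have h2 : HasFDerivAt toQuat toQuatL z := toQuatL.hasFDerivAt
  have h3 := vecPartL.hasFDerivAt.comp z ((h1.mul_const' v).mul' h2)
  refine ⟨_, h3, fun w ↦ ?_⟩
  change vecPart (_ + _) = _
  rw [add_comm]
  rfl

theorem eq_zero_of_conj_deriv (q w : ℍ[ℝ]) (hq : Quaternion.normSq q = 1)
    (hqw : q.re * w.re + q.imI * w.imI + q.imJ * w.imJ + q.imK * w.imK = 0)
    (hk : vecPart (star w * quatK * q + star q * quatK * w) = 0)
    (hj : vecPart (star w * quatJ * q + star q * quatJ * w) = 0) : w = 0 := by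
  have hqq : q * star q = 1 := by rw [Quaternion.self_mul_star, hq]; simp
  have hqq' : star q * q = 1 := by rw [Quaternion.star_mul_self, hq]; simp
  obtain ⟨b, hb⟩ : ∃ b, b = w * star q := ⟨_, rfl⟩
  have hw : w = b * q := by rw [hb, mul_assoc, hqq', mul_one]
  have hbre : b.re = 0 := by rw [hb]; simp; linarith
  have key (v : ℍ[ℝ]) (hv : v.re = 0)
      (h : vecPart (star w * v * q + star q * v * w) = 0) : v * b = b * v := by
    have hsb : star b = -b := by ext <;> simp [hbre]
    have e : star w * v * q + star q * v * w = star q * (v * b - b * v) * q := by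
      rw [hw, star_mul, hsb]; noncomm_ring
    have hre : (star w * v * q + star q * v * w).re = 0 := by
      simp [hv]; ring
    have h0 : star w * v * q + star q * v * w = 0 := by
      rw [← pureQuat_vecPart _ hre, h]; ext <;> rfl
    have h1 : v * b - b * v = q * (star q * (v * b - b * v) * q) * star q := by
      rw [show q * (star q * (v * b - b * v) * q) * star q
        = (q * star q) * (v * b - b * v) * (q * star q) by noncomm_ring, hqq]; noncomm_ring
    rw [← e, h0] at h1
    exact sub_eq_zero.1 (by rw [h1]; simp)
  have hk := key quatK rfl hk
  have hj := key quatJ rfl hj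
  have k1 := congrArg QuaternionAlgebra.imI hk
  have k2 := congrArg QuaternionAlgebra.imJ hk
  have j1 := congrArg QuaternionAlgebra.imI hj
  simp [quatK_comp, quatJ_comp] at k1 k2 j1
  have : b = 0 := by ext <;> simp <;> linarith
  rw [hw, this, zero_mul]

theorem contDiff_conj (v : ℍ[ℝ]) :
    ContDiff ℝ ∞ fun z ↦ vecPart (star (toQuat z) * v * toQuat z) := by
  have h1 : ContDiff ℝ ∞ (fun z ↦ star (toQuat z)) := (starL.comp toQuatL).contDiff
  have h2 : ContDiff ℝ ∞ toQuat := toQuatL.contDiff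
  exact vecPartL.contDiff.comp ((h1.mul contDiff_const).mul h2)

theorem incl_Phi (z : S3) : STS2.incl (Phi z) =
    (vecPart (star (toQuat z) * quatK * toQuat z),
      vecPart (star (toQuat z) * quatJ * toQuat z)) := by
  rw [← inv_toQuat]; rfl

theorem contMDiff_incl_Phi : ContMDiff (𝓡 3)
    𝓘(ℝ, EuclideanSpace ℝ (Fin 3) × EuclideanSpace ℝ (Fin 3)) ∞ (fun z ↦ STS2.incl (Phi z)) := by
  simp only [incl_Phi]
  exact ((contDiff_conj quatK).prodMk (contDiff_conj quatJ)).contMDiff.comp contMDiff_coe_sphere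

theorem mfderiv_incl_Phi_injective (z : S3) : Function.Injective
    (mfderiv (𝓡 3) 𝓘(ℝ, EuclideanSpace ℝ (Fin 3) × EuclideanSpace ℝ (Fin 3))
      (fun z ↦ STS2.incl (Phi z)) z) := by
  obtain ⟨D₁, h₁, hD₁⟩ := hasFDerivAt_conj quatK z
  obtain ⟨D₂, h₂, hD₂⟩ := hasFDerivAt_conj quatJ z
  have hι : MDifferentiableAt (𝓡 3) 𝓘(ℝ, EuclideanSpace ℂ (Fin 2))
      ((↑) : S3 → EuclideanSpace ℂ (Fin 2)) z :=
    (contMDiff_coe_sphere (m := 1) z).mdifferentiableAt one_ne_zero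
  have hcomp := (h₁.prodMk h₂).hasMFDerivAt.comp z hι.hasMFDerivAt
  have hfun : (fun z ↦ STS2.incl (Phi z)) =
      (fun z ↦ (vecPart (star (toQuat z) * quatK * toQuat z),
        vecPart (star (toQuat z) * quatJ * toQuat z))) ∘
        ((↑) : S3 → EuclideanSpace ℂ (Fin 2)) := funext incl_Phi
  rw [injective_iff_map_eq_zero]
  intro v hv
  rw [hfun, hcomp.mfderiv] at hv
  have hw : inner ℝ (z : EuclideanSpace ℂ (Fin 2)) (mvfderiv (𝓡 3)
      ((↑) : S3 → EuclideanSpace ℂ (Fin 2)) z v) = 0 := by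
    have : mvfderiv (𝓡 3) ((↑) : S3 → EuclideanSpace ℂ (Fin 2)) z v ∈
        (mvfderiv (𝓡 3) ((↑) : S3 → EuclideanSpace ℂ (Fin 2)) z).range := ⟨v, rfl⟩
    rw [range_mvfderiv_subtypeVal] at this
    exact Submodule.mem_orthogonal_singleton_iff_inner_right.1 this
  apply injective_mvfderiv_subtypeVal_sphere z
  rw [map_zero]
  have e1 : D₁ (mvfderiv (𝓡 3) ((↑) : S3 → EuclideanSpace ℂ (Fin 2)) z v) = 0 :=
    congrArg Prod.fst hv
  have e2 : D₂ (mvfderiv (𝓡 3) ((↑) : S3 → EuclideanSpace ℂ (Fin 2)) z v) = 0 :=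
    congrArg Prod.snd hv
  generalize mvfderiv (𝓡 3) ((↑) : S3 → EuclideanSpace ℂ (Fin 2)) z v = w at *
  apply toQuat_injective
  rw [hD₁] at e1
  rw [hD₂] at e2
  rw [eq_zero_of_conj_deriv (toQuat z) (toQuat w) (normSq_toQuat z) ?_ e1 e2]
  · ext <;> rfl
  · simp only [PiLp.inner_apply, Fin.sum_univ_two] at hw
    simp [Complex.inner] at hw
    simp only [toQuat]
    linarith

/-- The inclusion `ST S² → ℝ³ × ℝ³` is a smooth immersion. -/
theorem STS2.incl_smooth_immersion (p : STS2) :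
    ContMDiffAt (𝓡 3) 𝓘(ℝ, EuclideanSpace ℝ (Fin 3) × EuclideanSpace ℝ (Fin 3)) ∞ STS2.incl p ∧
    Function.Injective (mfderiv (𝓡 3)
      𝓘(ℝ, EuclideanSpace ℝ (Fin 3) × EuclideanSpace ℝ (Fin 3)) STS2.incl p) := by
  set a := Phi_surjective.hasRightInverse.choose p with ha
  have hap : Phi a = p := Phi_surjective.hasRightInverse.choose_spec p
  set L := isLocalHomeomorph_Phi.localInverseAt a with hL
  set C := chartAt (EuclideanSpace ℝ (Fin 3)) a with hC
  have hchart : chartAt (EuclideanSpace ℝ (Fin 3)) p = L.trans C := rfl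
  have hpL : p ∈ L.source := by
    rw [← hap]; exact isLocalHomeomorph_Phi.apply_self_mem_localInverseAt_source
  have hLp : L p = a := by
    rw [← hap]; exact isLocalHomeomorph_Phi.localInverseAt_apply_self
  have haC : a ∈ C.source := mem_chart_source _ a
  have hLsymm : ∀ z, L.symm z = Phi z := fun z ↦
    congrFun (isLocalHomeomorph_Phi.localInverseAt_symm a) z
  have hLs : ContMDiffAt (𝓡 3) (𝓡 3) ∞ L p := by
    have h1 : ContMDiffAt (𝓡 3) (𝓡 3) ∞ (L.trans C) p :=
      (contMDiffOn_chart (I := 𝓡 3) (x := p)).contMDiffAt (chart_source_mem_nhds _ p)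
    have h2 : ContMDiffAt (𝓡 3) (𝓡 3) ∞ C.symm ((L.trans C) p) :=
      (contMDiffOn_chart_symm (I := 𝓡 3) (x := a)).contMDiffAt
        (C.open_target.mem_nhds (by simpa [hLp] using C.map_source haC))
    refine (h2.comp p h1).congr_of_eventuallyEq ?_
    filter_upwards [chart_source_mem_nhds (EuclideanSpace ℝ (Fin 3)) p] with y hy
    rw [hchart, OpenPartialHomeomorph.trans_source] at hy
    exact (C.left_inv hy.2).symm
  have hPs : ContMDiffAt (𝓡 3) (𝓡 3) ∞ Phi a := by
    have h1 : ContMDiffAt (𝓡 3) (𝓡 3) ∞ C a :=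
      (contMDiffOn_chart (I := 𝓡 3) (x := a)).contMDiffAt (chart_source_mem_nhds _ a)
    have h2 : ContMDiffAt (𝓡 3) (𝓡 3) ∞ (L.trans C).symm (C a) := by
      refine (contMDiffOn_chart_symm (I := 𝓡 3) (x := p)).contMDiffAt
        ((chartAt (EuclideanSpace ℝ (Fin 3)) p).open_target.mem_nhds ?_)
      have := mem_chart_target (EuclideanSpace ℝ (Fin 3)) p
      rwa [show chartAt (EuclideanSpace ℝ (Fin 3)) p p = C a by
        rw [hchart, OpenPartialHomeomorph.trans_apply, hLp]] at this
    refine (h2.comp a h1).congr_of_eventuallyEq ?_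
    filter_upwards [chart_source_mem_nhds (EuclideanSpace ℝ (Fin 3)) a] with y hy
    change Phi y = L.symm (C.symm (C y))
    rw [C.left_inv hy, hLsymm]
  have hi : ContMDiffAt (𝓡 3) 𝓘(ℝ, EuclideanSpace ℝ (Fin 3) × EuclideanSpace ℝ (Fin 3)) ∞
      STS2.incl p := by
    refine ((contMDiff_incl_Phi (L p)).comp p hLs).congr_of_eventuallyEq ?_
    filter_upwards [L.open_source.mem_nhds hpL] with y hy
    change STS2.incl y = STS2.incl (Phi (L y))
    rw [← hLsymm, L.left_inv hy]
  refine ⟨hi, ?_⟩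
  rw [injective_iff_map_eq_zero]
  intro v hv
  have hΦ : MDifferentiableAt (𝓡 3) (𝓡 3) Phi (L p) := by
    rw [hLp]; exact hPs.mdifferentiableAt (by simp)
  have hL' : MDifferentiableAt (𝓡 3) (𝓡 3) L p := hLs.mdifferentiableAt (by simp)
  have hev : (Phi ∘ L) =ᶠ[nhds p] id := by
    filter_upwards [L.open_source.mem_nhds hpL] with y hy
    change Phi (L y) = y
    rw [← hLsymm, L.left_inv hy]
  have hv0 : mfderiv (𝓡 3) (𝓡 3) L p v = 0 := by
    apply mfderiv_incl_Phi_injective (L p)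
    rw [map_zero]
    have hev' : STS2.incl =ᶠ[nhds p] (fun z ↦ STS2.incl (Phi z)) ∘ L := by
      filter_upwards [hev] with y hy
      exact (congrArg STS2.incl hy).symm
    have hh := (contMDiff_incl_Phi (L p)).mdifferentiableAt (by simp)
    have e := (hh.hasMFDerivAt.comp p hL'.hasMFDerivAt).congr_of_eventuallyEq hev'
    rw [e.mfderiv] at hv
    exact hv
  have c := (hΦ.hasMFDerivAt.comp p hL'.hasMFDerivAt).congr_of_eventuallyEq hev.symm
  have c1 := DFunLike.congr_fun (hasMFDerivAt_unique c (hasMFDerivAt_id p)) v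
  refine c1.symm.trans ?_
  change mfderiv (𝓡 3) (𝓡 3) Phi (L p) (mfderiv (𝓡 3) (𝓡 3) L p v) = 0
  rw [hv0]
  exact map_zero _

/-! ### Null geodesics, skies and the canonical distribution of a Lorentzian manifold -/

section General

variable {E : Type*} [NormedAddCommGroup E] [NormedSpace ℝ E] {H : Type*} [TopologicalSpace H]
  {I : ModelWithCorners ℝ E H} {M : Type*} [TopologicalSpace M] [ChartedSpace H M]

/-- The coefficient functions `y ↦ g_y(v, w)` of the metric `g` in the preferred chart
around `x₀`. -/
def metricInChart (g : ∀ x : M, LinearMap.BilinForm ℝ (TangentSpace I x)) (x₀ : M)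
    (y v w : E) : ℝ :=
  g ((extChartAt I x₀).symm y)
    (mfderivWithin 𝓘(ℝ, E) I (extChartAt I x₀).symm (range I) y v)
    (mfderivWithin 𝓘(ℝ, E) I (extChartAt I x₀).symm (range I) y w)

/-- The Christoffel symbols of the first kind of `g` in the preferred chart around `x₀`:
`Γ(u, v, w) = (D_u g(v, w) + D_v g(u, w) - D_w g(u, v)) / 2`. -/
def christoffel (g : ∀ x : M, LinearMap.BilinForm ℝ (TangentSpace I x)) (x₀ : M)
    (y u v w : E) : ℝ :=
  (fderivWithin ℝ (fun y ↦ metricInChart g x₀ y v w) (range I) y u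
    + fderivWithin ℝ (fun y ↦ metricInChart g x₀ y u w) (range I) y v
    - fderivWithin ℝ (fun y ↦ metricInChart g x₀ y u v) (range I) y w) / 2

/-- `γ` is a geodesic of `g` on the open interval `J`: it is smooth there, and for every `s ∈ J`,
writing `x` for `γ` in the preferred chart around `γ s`, the geodesic equation
`g(x'', w) + Γ(x', x', w) = 0` (for all `w`) holds at `s`. -/
def IsGeodesicOn (g : ∀ x : M, LinearMap.BilinForm ℝ (TangentSpace I x)) (γ : ℝ → M)
    (J : Set ℝ) : Prop :=
  IsOpen J ∧ J.OrdConnected ∧ J.Nonempty ∧ ContMDiffOn 𝓘(ℝ, ℝ) I ∞ γ J ∧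
    ∀ s ∈ J, ∀ w : E,
      metricInChart g (γ s) (extChartAt I (γ s) (γ s))
          (deriv (deriv fun r ↦ extChartAt I (γ s) (γ r)) s) w
        + christoffel g (γ s) (extChartAt I (γ s) (γ s))
          (deriv (fun r ↦ extChartAt I (γ s) (γ r)) s)
          (deriv (fun r ↦ extChartAt I (γ s) (γ r)) s) w = 0

/-- The bundle `C⁺` of future null vectors, for the time orientation given by the timelike vector
field `X`. -/
def futureNullCone (g : ∀ x : M, LinearMap.BilinForm ℝ (TangentSpace I x))
    (X : ∀ x : M, TangentSpace I x) : Set (TangentBundle I M) :=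
  {v | v.2 ≠ 0 ∧ g v.1 v.2 v.2 = 0 ∧ g v.1 v.2 (X v.1) < 0}

/-- The velocity vector of a curve. -/
def velocity (I : ModelWithCorners ℝ E H) (γ : ℝ → M) (s : ℝ) : TangentBundle I M :=
  ⟨γ s, mfderiv 𝓘(ℝ, ℝ) I γ s (1 : ℝ)⟩

/-- `γ : J → M` is a maximal geodesic with `γ' ⊂ C⁺`. -/
structure IsMaximalNullGeodesic (g : ∀ x : M, LinearMap.BilinForm ℝ (TangentSpace I x))
    (X : ∀ x : M, TangentSpace I x) (γ : ℝ → M) (J : Set ℝ) : Prop where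
  geodesic : IsGeodesicOn g γ J
  future_null : ∀ s ∈ J, velocity I γ s ∈ futureNullCone g X
  maximal : ∀ (γ' : ℝ → M) (J' : Set ℝ), IsGeodesicOn g γ' J' → J ⊆ J' → EqOn γ γ' J → J' = J

/-- The space `𝒩` of null geodesics: the images `γ(J)` of the maximal geodesics `γ : J → M` with
`γ' ⊂ C⁺`. -/
def NullGeodesicSpace (g : ∀ x : M, LinearMap.BilinForm ℝ (TangentSpace I x))
    (X : ∀ x : M, TangentSpace I x) : Type _ :=
  {S : Set M // ∃ γ J, IsMaximalNullGeodesic g X γ J ∧ S = γ '' J}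

/-- `v` is a velocity vector of (some parametrization of) the null geodesic `n`. -/
def IsTangentTo {g : ∀ x : M, LinearMap.BilinForm ℝ (TangentSpace I x)}
    {X : ∀ x : M, TangentSpace I x} (v : TangentBundle I M) (n : NullGeodesicSpace g X) : Prop :=
  ∃ γ J, IsMaximalNullGeodesic g X γ J ∧ n.1 = γ '' J ∧ ∃ s ∈ J, velocity I γ s = v

/-- The sky of `x`: all null geodesics through `x`. -/
def sky (g : ∀ x : M, LinearMap.BilinForm ℝ (TangentSpace I x))
    (X : ∀ x : M, TangentSpace I x) (x : M) : Set (NullGeodesicSpace g X) :=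
  {n | x ∈ n.1}

section Smooth

variable {g : ∀ x : M, LinearMap.BilinForm ℝ (TangentSpace I x)} {X : ∀ x : M, TangentSpace I x}
  {F : Type*} [NormedAddCommGroup F] [NormedSpace ℝ F]
  [TopologicalSpace (NullGeodesicSpace g X)] [ChartedSpace F (NullGeodesicSpace g X)]

/-- The given topology and atlas make `𝒩` the quotient manifold of `C⁺`, that is, a smooth manifold
such that the projection `p : C⁺ → 𝒩`, which sends a future null vector to the null geodesic tangent
to it, is a (surjective) submersion: `p` is smooth, and through every `v ∈ C⁺` there is a smooth
local section of `p`. (There is at most one such smooth structure.) -/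
structure IsNullGeodesicManifold (F : Type*) [NormedAddCommGroup F] [NormedSpace ℝ F]
    [IsManifold I 1 M] (g : ∀ x : M, LinearMap.BilinForm ℝ (TangentSpace I x))
    (X : ∀ x : M, TangentSpace I x)
    [TopologicalSpace (NullGeodesicSpace g X)] [ChartedSpace F (NullGeodesicSpace g X)] :
    Prop where
  isManifold : IsManifold 𝓘(ℝ, F) ∞ (NullGeodesicSpace g X)
  t2 : T2Space (NullGeodesicSpace g X)
  secondCountable : SecondCountableTopology (NullGeodesicSpace g X)
  submersion : ∃ p : TangentBundle I M → NullGeodesicSpace g X,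
    (∀ v ∈ futureNullCone g X, IsTangentTo v (p v)) ∧
    ContMDiffOn I.tangent 𝓘(ℝ, F) ∞ p (futureNullCone g X) ∧
    ∀ v ∈ futureNullCone g X, ∃ σ : NullGeodesicSpace g X → TangentBundle I M,
      ContMDiffAt 𝓘(ℝ, F) I.tangent ∞ σ (p v) ∧ σ (p v) = v ∧
      ∀ᶠ n in nhds (p v), σ n ∈ futureNullCone g X ∧ p (σ n) = n

/-- `T_γ 𝔖_x`: the subspace of `T_γ 𝒩` made of the velocities at `γ` of smooth curves of `𝒩` that
lie in the sky of `x`. -/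
def skyTangent (F : Type*) [NormedAddCommGroup F] [NormedSpace ℝ F]
    {g : ∀ x : M, LinearMap.BilinForm ℝ (TangentSpace I x)} {X : ∀ x : M, TangentSpace I x}
    [TopologicalSpace (NullGeodesicSpace g X)] [ChartedSpace F (NullGeodesicSpace g X)]
    (n : NullGeodesicSpace g X) (x : M) : Submodule ℝ (TangentSpace 𝓘(ℝ, F) n) :=
  Submodule.span ℝ {w | ∃ α : ℝ → NullGeodesicSpace g X, ContMDiff 𝓘(ℝ, ℝ) 𝓘(ℝ, F) ∞ α ∧
    (∀ s, α s ∈ sky g X x) ∧ velocity 𝓘(ℝ, F) α 0 = ⟨n, w⟩}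

/-- The points `x, y` of the null geodesic `n` can be joined by a one-parameter family of null
geodesics: a nonconstant smooth curve of `𝒩` through `n` all of whose members pass through both
`x` and `y`. -/
def JoinedByFamily (F : Type*) [NormedAddCommGroup F] [NormedSpace ℝ F]
    {g : ∀ x : M, LinearMap.BilinForm ℝ (TangentSpace I x)} {X : ∀ x : M, TangentSpace I x}
    [TopologicalSpace (NullGeodesicSpace g X)] [ChartedSpace F (NullGeodesicSpace g X)]
    (n : NullGeodesicSpace g X) (x y : M) : Prop :=
  ∃ α : ℝ → NullGeodesicSpace g X, ContMDiff 𝓘(ℝ, ℝ) 𝓘(ℝ, F) ∞ α ∧ α 0 = n ∧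
    (∀ s, α s ∈ sky g X x ∩ sky g X y) ∧ ∃ s, α s ≠ n

/-- `D` is the canonical contact structure `ℋ` of `𝒩`: the codimension-one distribution with
`ℋ_γ = T_γ 𝔖_x ⊕ T_γ 𝔖_y` for all `x, y ∈ γ` that cannot be joined by a one-parameter family of
null geodesics. Such `x, y` exist on every `γ`, so that there is at most one such `D`. -/
def IsCanonicalContactStructure
    (D : ∀ n : NullGeodesicSpace g X, Submodule ℝ (TangentSpace 𝓘(ℝ, F) n)) : Prop :=
  ∀ n : NullGeodesicSpace g X,
    Module.finrank ℝ (D n) + 1 = Module.finrank ℝ F ∧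
    (∃ x ∈ n.1, ∃ y ∈ n.1, ¬ JoinedByFamily F n x y) ∧
    ∀ x ∈ n.1, ∀ y ∈ n.1, ¬ JoinedByFamily F n x y →
      Disjoint (skyTangent F n x) (skyTangent F n y) ∧
      D n = skyTangent F n x ⊔ skyTangent F n y

end Smooth

end General

/-! ### The spacetime `(S² × S¹, g_c)` -/

/-- `T_x S² → ℝ³`, the differential of the inclusion. -/
def tangentInclS2 (x : S2) : TangentSpace (𝓡 2) x →ₗ[ℝ] EuclideanSpace ℝ (Fin 3) :=
  (mvfderiv (𝓡 2) ((↑) : S2 → EuclideanSpace ℝ (Fin 3)) x).toLinearMap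

/-- The round metric of `S²`. -/
def roundMetric (x : S2) : LinearMap.BilinForm ℝ (TangentSpace (𝓡 2) x) :=
  (innerₗ (EuclideanSpace ℝ (Fin 3))).compl₁₂ (tangentInclS2 x) (tangentInclS2 x)

/-- The one-form `dt` on the unit circle, `t` being the angle: `dt(w) = Im(z̄ w)` for `w ∈ T_z S¹`
(regarded as a complex number). -/
def dt (z : Circle) : TangentSpace (𝓡 1) z →ₗ[ℝ] ℝ :=
  Complex.imLm ∘ₗ LinearMap.mulLeft ℝ (starRingEnd ℂ (z : ℂ)) ∘ₗ
    (mvfderiv (𝓡 1) (fun z : Circle ↦ (z : ℂ)) z).toLinearMap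

/-- The metric `g_c = g_∘ - (1/c²) dt²` on `S² × S¹`. -/
def lorentzMetric (c : ℕ) (m : S2 × Circle) :
    LinearMap.BilinForm ℝ (TangentSpace ((𝓡 2).prod (𝓡 1)) m) :=
  (roundMetric m.1).compl₁₂
      (mfderiv ((𝓡 2).prod (𝓡 1)) (𝓡 2) (Prod.fst : S2 × Circle → S2) m).toLinearMap
      (mfderiv ((𝓡 2).prod (𝓡 1)) (𝓡 2) (Prod.fst : S2 × Circle → S2) m).toLinearMap
    - (1 / (c : ℝ) ^ 2) • (LinearMap.mul ℝ ℝ).compl₁₂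
      (dt m.2 ∘ₗ (mfderiv ((𝓡 2).prod (𝓡 1)) (𝓡 1) (Prod.snd : S2 × Circle → Circle) m).toLinearMap)
      (dt m.2 ∘ₗ (mfderiv ((𝓡 2).prod (𝓡 1)) (𝓡 1) (Prod.snd : S2 × Circle → Circle) m).toLinearMap)

/-- The time orientation `(0, ∂_t)` of `S² × S¹`: the velocity of `θ ↦ (x, z e^{iθ})`. -/
def timeField (m : S2 × Circle) : TangentSpace ((𝓡 2).prod (𝓡 1)) m :=
  mfderiv 𝓘(ℝ, ℝ) ((𝓡 2).prod (𝓡 1)) (fun θ : ℝ ↦ (m.1, m.2 * Circle.exp θ)) 0 (1 : ℝ)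

/-- The space `𝒩_c` of null geodesics of `(S² × S¹, g_c)`. -/
abbrev NullGeod (c : ℕ) : Type := NullGeodesicSpace (lorentzMetric c) timeField

/-- The subset `{(μ(s), cs)}` of `S² × S¹`, with `μ(s) = x cos s + u sin s` the unit-speed great
circle defined by `(x, u) ∈ ST S²`. -/
def greatCircleLift (c : ℕ) (p : STS2) : Set (S2 × Circle) :=
  {m | ∃ s : ℝ, (m.1 : EuclideanSpace ℝ (Fin 3)) =
      Real.cos s • (p.1.1 : EuclideanSpace ℝ (Fin 3)) +
        Real.sin s • (p.1.2 : EuclideanSpace ℝ (Fin 3)) ∧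
    m.2 = Circle.exp (c * s)}

/-! ### The contact structure `χ` on `ST S²` and the projection `r : ST S² → L(2c,1)` -/

/-- The canonical contact structure `χ_{(x,u)} = (T π)⁻¹(⟨u⟩^⊥)` of `ST S²`. -/
def chi (p : STS2) : Submodule ℝ (TangentSpace (𝓡 3) p) :=
  Submodule.comap (mfderiv (𝓡 3) (𝓡 2) STS2.base p).toLinearMap
    (LinearMap.ker (innerₗ (EuclideanSpace ℝ (Fin 3)) (p.1.2 : EuclideanSpace ℝ (Fin 3)) ∘ₗ
      tangentInclS2 p.base))

/-- The projection `r : ST S² ≅ L(2,1) → L(2c,1)`, characterized by `r(Φ(q)) = [q]`. -/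
def lensProj (c : ℕ) (p : STS2) : LensSpace (2 * c) :=
  lensMk (2 * c) (Function.surjInv Phi_surjective p)

theorem lensProj_Phi (c : ℕ) (hc : 1 ≤ c) (z : S3) : lensProj c (Phi z) = lensMk (2 * c) z := by
  have h : Phi (Function.surjInv Phi_surjective (Phi z)) = Phi z :=
    Function.surjInv_eq Phi_surjective (Phi z)
  rcases (Phi_eq_iff _ _).1 h.symm with h | h
  · rw [lensProj, h]
  · rw [lensProj, h, lensMk_neg c hc]

end NullGeodesics

end

open NullGeodesics

/-! Inside ℝ³ × ℂ the metric g_c is the restriction of a constant bilinear form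
(`lorentzMetric_eq`). For such a metric the geodesic equation says that the ambient acceleration is
orthogonal to the tangent space (`geodesic_expression_eq`). A future null geodesic is therefore a
great circle run at constant speed while the angle of S¹ runs c times as fast
(`exists_eq_lightCurve`). Its image is recorded by a pair (x, u) in ST S², and two pairs give the
same image exactly when they differ by the geodesic flow for a multiple of the time 2π/c
(`greatCircleLift_eq_iff`). On quaternions, left multiplication by e^{iθ} becomes the flow for time
2θ (`Phi_circle_smul`), so these classes are the fibres of r, and L(2c,1) is in bijection with 𝒩_c
(`lensEquiv`).

The null geodesic tangent to a future null vector is found by reading off position and direction and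
flowing back by the angle divided by c (`vectorToLens`). This is smooth, and light vectors give
smooth local sections. Hence the structure carried over from the lens space has the required
property, and any structure with that property makes `lensEquiv` a diffeomorphism
(`isNullGeodesicManifold_of_diffeo`, `contMDiff_lensEquiv`).

For the contact structure, null geodesics near γ through its point at time τ pass there at the same
time τ. So the tangent space of that sky is the image of the line of vectors (ξ, η) with cos τ ξ +
sin τ η = 0 (`skyTangent_eq`). If W completes (x, u) to an orthonormal basis, χ consists of the
vectors (bW, dW), and the line is spanned by (-sin τ W, cos τ W). Two such lines span χ when sin(τ'
- τ) ≠ 0 (`chi_eq_sup`). When the sine vanishes, rotating the great circle joins the two points by a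
family, so points that are not joined always produce the image of χ. Times 0 and π/(2c) provide such
points (`toNullGeod_eq_of_mem`). -/

noncomputable section

namespace NullGeodesics

/-! ### Smooth maps into spheres. -/

section Sphere

variable {E : Type*} [NormedAddCommGroup E] [InnerProductSpace ℝ E] {n : ℕ}
  [Fact (Module.finrank ℝ E = n + 1)]
  {F : Type*} [NormedAddCommGroup F] [NormedSpace ℝ F]
  {H : Type*} [TopologicalSpace H] {I : ModelWithCorners ℝ F H}
  {M : Type*} [TopologicalSpace M] [ChartedSpace H M]

/-- A map into the unit sphere is smooth at a point if it is so as a map into the ambient space. -/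
theorem contMDiffAt_sphere {m : ℕ∞ω} {f : M → sphere (0 : E) 1} {x : M}
    (hf : ContMDiffAt I 𝓘(ℝ, E) m (fun y ↦ (f y : E)) x) : ContMDiffAt I (𝓡 n) m f x := by
  rw [contMDiffAt_iff_target]
  refine ⟨Topology.IsInducing.subtypeVal.continuousAt_iff.2 hf.continuousAt, ?_⟩
  let U := (OrthonormalBasis.fromOrthogonalSpanSingleton (𝕜 := ℝ) n
    (ne_zero_of_mem_unit_sphere (-f x))).repr
  -- The chart at `f x` is stereographic projection from the antipode `-f x`. It is singular only
  -- where the inner product with the pole is 1, and at `f x` this product is -1.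
  have h : ContDiffAt ℝ ω (stereoToFun ((-f x : sphere (0 : E) 1) : E)) (f x : E) := by
    refine contDiffOn_stereoToFun.contDiffAt (IsOpen.mem_nhds ?_ ?_)
    · exact isOpen_ne_fun (by fun_prop) continuous_const
    · change inner ℝ ((-f x : sphere (0 : E) 1) : E) (f x : E) ≠ (1 : ℝ)
      rw [coe_neg_sphere, inner_neg_left, real_inner_self_eq_norm_sq, norm_eq_of_mem_sphere]
      norm_num
  have h2 : ContDiffAt ℝ m (fun y ↦ U (stereoToFun ((-f x : sphere (0 : E) 1) : E) y))
      (f x : E) := (U.contDiff.contDiffAt.comp _ h).of_le le_top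
  exact ContMDiffAt.comp (I' := 𝓘(ℝ, E)) (f := fun y ↦ (f y : E)) x h2.contMDiffAt hf

end Sphere

/-! ### Local diffeomorphisms and bijections. -/

section LocalDiffeomorph

variable {E : Type*} [NormedAddCommGroup E] [NormedSpace ℝ E] {H : Type*} [TopologicalSpace H]
  {I : ModelWithCorners ℝ E H} {M : Type*} [TopologicalSpace M] [ChartedSpace H M]
  {E' : Type*} [NormedAddCommGroup E'] [NormedSpace ℝ E'] {H' : Type*} [TopologicalSpace H']
  {J : ModelWithCorners ℝ E' H'} {N : Type*} [TopologicalSpace N] [ChartedSpace H' N]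

theorem _root_.IsLocalDiffeomorphAt.congr_of_eventuallyEq {n : ℕ∞ω} {f g : M → N} {x : M}
    (hf : IsLocalDiffeomorphAt I J n f x) (h : g =ᶠ[nhds x] f) :
    IsLocalDiffeomorphAt I J n g x := by
  obtain ⟨Φ, hx, heq⟩ := hf
  obtain ⟨U, hU, hUo, hxU⟩ := eventually_nhds_iff.1 h
  refine ⟨⟨Φ.toPartialEquiv.restr U, Φ.open_source.inter hUo, ?_, ?_, ?_⟩, ⟨hx, hxU⟩, ?_⟩
  · exact Φ.toOpenPartialHomeomorph.symm.isOpen_inter_preimage hUo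
  · exact Φ.contMDiffOn.mono inter_subset_left
  · exact Φ.symm.contMDiffOn.mono inter_subset_left
  · exact fun y hy ↦ (hU y hy.2).trans (heq hy.1)

theorem contMDiff_symm_of_isLocalDiffeomorph {n : ℕ∞ω} {e : M ≃ N}
    (he : IsLocalDiffeomorph I J n e) : ContMDiff J I n e.symm := by
  intro y
  obtain ⟨x, rfl⟩ := e.surjective y
  refine (he x).localInverse_contMDiffAt.congr_of_eventuallyEq ?_
  filter_upwards [(he x).localInverse_eventuallyEq_right] with z hz
  rw [Equiv.symm_apply_eq]
  exact hz.symm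

end LocalDiffeomorph

/-! ### Covering projections for the quotient atlas. -/

section Quotient

variable {M M' : Type*} [TopologicalSpace M] [TopologicalSpace M']
    [ChartedSpace (EuclideanSpace ℝ (Fin 3)) M] [IsManifold (𝓡 3) ∞ M]

open IsLocalHomeomorph in
/-- A surjective local homeomorphism with smooth deck transformations is a local diffeomorphism
for the quotient atlas. -/
theorem isLocalDiffeomorph_of_deck {f : M → M'} (hf : IsLocalHomeomorph f)
    (hs : Function.Surjective f)
    (hd : ∀ x y, f x = f y → ∃ g : M → M, ContMDiff (𝓡 3) (𝓡 3) ∞ g ∧ (∀ z, f (g z) = f z) ∧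
      g x = y) :
    @IsLocalDiffeomorph ℝ _ _ _ _ _ _ _ _ _ _ _ (𝓡 3) (𝓡 3) M _ _ M' _ (hf.chartedSpace hs) ∞
      f := by
  have := isManifold_of_deck hf hs hd
  let _ := hf.chartedSpace (H := EuclideanSpace ℝ (Fin 3)) hs
  -- smoothness of `f`
  have hfs : ContMDiff (𝓡 3) (𝓡 3) ∞ f := by
    -- The chart at `p` is built from one chosen preimage of `p`. In it `f` is visibly smooth at
    -- that preimage; the other preimages are reached by deck transformations.
    have key (p : M') : ContMDiffAt (𝓡 3) (𝓡 3) ∞ f (hs.hasRightInverse.choose p) := by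
      set a := hs.hasRightInverse.choose p with ha
      have hap : f a = p := hs.hasRightInverse.choose_spec p
      set L := hf.localInverseAt a with hL
      set C := chartAt (EuclideanSpace ℝ (Fin 3)) a with hC
      have hchart : chartAt (EuclideanSpace ℝ (Fin 3)) p = L.trans C := rfl
      have hLp : L p = a := by rw [← hap]; exact hf.localInverseAt_apply_self
      have hLsymm : ∀ z, L.symm z = f z := fun z ↦ congrFun (hf.localInverseAt_symm a) z
      have h1 : ContMDiffAt (𝓡 3) (𝓡 3) ∞ C a :=
        (contMDiffOn_chart (I := 𝓡 3) (x := a)).contMDiffAt (chart_source_mem_nhds _ a)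
      have h2 : ContMDiffAt (𝓡 3) (𝓡 3) ∞ (L.trans C).symm (C a) := by
        refine (contMDiffOn_chart_symm (I := 𝓡 3) (x := p)).contMDiffAt
          ((chartAt (EuclideanSpace ℝ (Fin 3)) p).open_target.mem_nhds ?_)
        have := mem_chart_target (EuclideanSpace ℝ (Fin 3)) p
        rwa [show chartAt (EuclideanSpace ℝ (Fin 3)) p p = C a by
          rw [hchart, OpenPartialHomeomorph.trans_apply, hLp]] at this
      refine (h2.comp a h1).congr_of_eventuallyEq ?_
      filter_upwards [chart_source_mem_nhds (EuclideanSpace ℝ (Fin 3)) a] with y hy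
      change f y = L.symm (C.symm (C y))
      rw [C.left_inv hy, hLsymm]
    intro x
    obtain ⟨g, hg, hfg, hgx⟩ := hd x (hs.hasRightInverse.choose (f x))
      (hs.hasRightInverse.choose_spec (f x)).symm
    have h := ContMDiffAt.comp x (by rw [hgx]; exact key (f x)) (hg x)
    exact h.congr_of_eventuallyEq (.of_forall fun z ↦ (hfg z).symm)
  -- a smooth local right inverse through every point
  have hsec (x : M) : ContMDiffAt (𝓡 3) (𝓡 3) ∞ (hf.localInverseAt x) (f x) := by
    set p := f x with hp
    set a := hs.hasRightInverse.choose p with ha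
    have hap : f a = p := hs.hasRightInverse.choose_spec p
    set L := hf.localInverseAt a with hL
    set C := chartAt (EuclideanSpace ℝ (Fin 3)) a with hC
    have hchart : chartAt (EuclideanSpace ℝ (Fin 3)) p = L.trans C := rfl
    have hLp : L p = a := by rw [← hap]; exact hf.localInverseAt_apply_self
    have hpL : p ∈ L.source := by rw [← hap]; exact hf.apply_self_mem_localInverseAt_source
    have haC : a ∈ C.source := mem_chart_source _ a
    have hLs : ContMDiffAt (𝓡 3) (𝓡 3) ∞ L p := by
      have h1 : ContMDiffAt (𝓡 3) (𝓡 3) ∞ (L.trans C) p :=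
        (contMDiffOn_chart (I := 𝓡 3) (x := p)).contMDiffAt (chart_source_mem_nhds _ p)
      have h2 : ContMDiffAt (𝓡 3) (𝓡 3) ∞ C.symm ((L.trans C) p) :=
        (contMDiffOn_chart_symm (I := 𝓡 3) (x := a)).contMDiffAt
          (C.open_target.mem_nhds (by simpa [hLp] using C.map_source haC))
      refine (h2.comp p h1).congr_of_eventuallyEq ?_
      filter_upwards [chart_source_mem_nhds (EuclideanSpace ℝ (Fin 3)) p] with y hy
      rw [hchart, OpenPartialHomeomorph.trans_source] at hy
      exact (C.left_inv hy.2).symm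
    -- The chart makes the section through the chosen preimage `a` smooth. A deck transformation
    -- carrying `a` to `x` turns it into the section through `x`.
    obtain ⟨g, hg, hfg, hga⟩ := hd a x hap
    have hgL : ContMDiffAt (𝓡 3) (𝓡 3) ∞ (g ∘ L) p := (hg (L p)).comp p hLs
    refine hgL.congr_of_eventuallyEq ?_
    have hx : (g ∘ L) p = x := by rw [Function.comp_apply, hLp, hga]
    have h3 : ∀ᶠ y in nhds p, (g ∘ L) y ∈ (hf.localInverseAt x).target :=
      hgL.continuousAt.eventually_mem ((hf.localInverseAt x).open_target.mem_nhds
        (by rw [hx]; exact hf.self_mem_localInverseAt_target))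
    filter_upwards [h3, L.open_source.mem_nhds hpL,
      (hf.localInverseAt x).open_source.mem_nhds hf.apply_self_mem_localInverseAt_source]
      with y hy1 hy2 hy3
    refine hf.injOn_localInverseAt_target ((hf.localInverseAt x).map_source hy3) hy1 ?_
    rw [hf.apply_localInverseAt_of_mem hy3, Function.comp_apply, hfg,
      hf.apply_localInverseAt_of_mem hy2]
  intro x
  set L := hf.localInverseAt x with hL
  have hLsymm : ∀ z, L.symm z = f z := fun z ↦ congrFun (hf.localInverseAt_symm x) z
  refine ⟨⟨L.symm.toPartialEquiv, L.open_target, L.open_source, ?_, ?_⟩,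
    hf.self_mem_localInverseAt_target, fun z _ ↦ (hLsymm z).symm⟩
  · exact hfs.contMDiffOn.congr fun z _ ↦ hLsymm z
  · intro y hy
    change y ∈ L.source at hy
    -- `hsec` gives smoothness only at the base point of a local inverse. Near any other `y` of its
    -- source, `L` coincides with the local inverse based at `L y`.
    refine ContMDiffAt.contMDiffWithinAt (ContMDiffAt.congr_of_eventuallyEq
      (f := hf.localInverseAt (L y)) ?_ ?_)
    · have := hsec (L y)
      rwa [hf.apply_localInverseAt_of_mem hy] at this
    · have hy' : y ∈ (hf.localInverseAt (L y)).source := by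
        have := hf.apply_self_mem_localInverseAt_source (x := L y)
        rwa [hf.apply_localInverseAt_of_mem hy] at this
      have hc : ∀ᶠ q in nhds y, L q ∈ (hf.localInverseAt (L y)).target :=
        (L.continuousAt hy).eventually_mem
          ((hf.localInverseAt (L y)).open_target.mem_nhds hf.self_mem_localInverseAt_target)
      filter_upwards [hc, L.open_source.mem_nhds hy,
        (hf.localInverseAt (L y)).open_source.mem_nhds hy'] with q h1 h2 h3
      refine hf.injOn_localInverseAt_target h1 ((hf.localInverseAt (L y)).map_source h3) ?_
      rw [hf.apply_localInverseAt_of_mem h3, hf.apply_localInverseAt_of_mem h2]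

end Quotient

/-- Euclidean `3`-space. -/
local notation "E3" => EuclideanSpace ℝ (Fin 3)

/-! ### Smooth maps into `ST S²` -/

theorem contMDiff_STS2_incl : ContMDiff (𝓡 3) 𝓘(ℝ, E3 × E3) ∞ STS2.incl :=
  fun p ↦ (STS2.incl_smooth_immersion p).1

theorem STS2.incl_injective : Function.Injective STS2.incl := fun _ _ h ↦
  Subtype.ext (Prod.ext (Subtype.ext (congrArg Prod.fst h)) (Subtype.ext (congrArg Prod.snd h)))

theorem STS2.norm_fst (p : STS2) : ‖(p.1.1 : E3)‖ = 1 := norm_eq_of_mem_sphere _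

theorem STS2.norm_snd (p : STS2) : ‖(p.1.2 : E3)‖ = 1 := norm_eq_of_mem_sphere _

theorem STS2.inner_fst_fst (p : STS2) : inner ℝ (p.1.1 : E3) (p.1.1 : E3) = 1 := by
  rw [real_inner_self_eq_norm_sq, p.norm_fst, one_pow]

theorem STS2.inner_snd_snd (p : STS2) : inner ℝ (p.1.2 : E3) (p.1.2 : E3) = 1 := by
  rw [real_inner_self_eq_norm_sq, p.norm_snd, one_pow]

theorem STS2.inner_fst_snd (p : STS2) : inner ℝ (p.1.1 : E3) (p.1.2 : E3) = 0 := p.2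

theorem STS2.inner_snd_fst (p : STS2) : inner ℝ (p.1.2 : E3) (p.1.1 : E3) = 0 := by
  rw [real_inner_comm]; exact p.2

/-- The point of `ST S²` given by an orthonormal pair. -/
def STS2.mk (x u : E3) (hx : ‖x‖ = 1) (hu : ‖u‖ = 1) (hxu : inner ℝ x u = 0) : STS2 :=
  ⟨(⟨x, mem_sphere_zero_iff_norm.2 hx⟩, ⟨u, mem_sphere_zero_iff_norm.2 hu⟩), hxu⟩

/-- Averaging `a` makes it intertwine the pairs `(k, j)` and `(x, u)`. -/
def intertwiner (a : ℍ[ℝ]) (y : E3 × E3) : ℍ[ℝ] :=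
  a - quatK * a * pureQuat y.1 - quatJ * a * pureQuat y.2
    - quatK * quatJ * a * (pureQuat y.1 * pureQuat y.2)

theorem STS2.pureQuat_relations (p : STS2) :
    pureQuat p.1.1 * pureQuat p.1.1 = -1 ∧ pureQuat p.1.2 * pureQuat p.1.2 = -1 ∧
    pureQuat p.1.2 * pureQuat p.1.1 = -(pureQuat p.1.1 * pureQuat p.1.2) := by
  have h1 := p.inner_fst_fst
  have h2 := p.inner_snd_snd
  have h3 := p.inner_fst_snd
  simp only [PiLp.inner_apply, Fin.sum_univ_three, RCLike.inner_apply, conj_trivial] at h1 h2 h3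
  refine ⟨?_, ?_, ?_⟩ <;> ext <;> simp [pureQuat_comp] <;> linarith

/-- The expression is the sum of g a ρ(g)⁻¹ over g = 1, k, j, kj, where ρ is given by k ↦ x, j ↦ u.
The relations for x and u are those of the quaternion group, so multiplication by k or j permutes
the terms. -/
theorem intertwiner_spec (a : ℍ[ℝ]) (p : STS2) :
    quatK * intertwiner a p.incl = intertwiner a p.incl * pureQuat p.1.1 ∧
    quatJ * intertwiner a p.incl = intertwiner a p.incl * pureQuat p.1.2 := by
  obtain ⟨hXX, hUU, hUX⟩ := p.pureQuat_relations
  simp only [intertwiner, STS2.incl]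
  set X := pureQuat p.1.1
  set U := pureQuat p.1.2
  have hKK : quatK * quatK = -1 := by ext <;> simp [quatK_comp]
  have hJJ : quatJ * quatJ = -1 := by ext <;> simp [quatJ_comp]
  have hJK : quatJ * quatK = -(quatK * quatJ) := by ext <;> simp [quatJ_comp, quatK_comp]
  constructor
  · have e1 : quatK * (a - quatK * a * X - quatJ * a * U - quatK * quatJ * a * (X * U))
      = quatK * a - (quatK * quatK) * a * X - quatK * quatJ * a * U
      - (quatK * quatK) * quatJ * a * (X * U) := by noncomm_ring
    have e2 : (a - quatK * a * X - quatJ * a * U - quatK * quatJ * a * (X * U)) * X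
      = a * X - quatK * a * (X * X) - quatJ * a * (U * X)
      - quatK * quatJ * a * (X * (U * X)) := by noncomm_ring
    have e3 : X * (U * X) = U := by
      rw [hUX, mul_neg, ← mul_assoc, hXX]; noncomm_ring
    rw [e1, e2, e3, hKK, hXX, hUX]; noncomm_ring
  · have e1 : quatJ * (a - quatK * a * X - quatJ * a * U - quatK * quatJ * a * (X * U))
      = quatJ * a - (quatJ * quatK) * a * X - (quatJ * quatJ) * a * U
      - (quatJ * quatK * quatJ) * a * (X * U) := by noncomm_ring
    have e2 : (a - quatK * a * X - quatJ * a * U - quatK * quatJ * a * (X * U)) * U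
      = a * U - quatK * a * (X * U) - quatJ * a * (U * U)
      - quatK * quatJ * a * (X * (U * U)) := by noncomm_ring
    have e3 : quatJ * quatK * quatJ = quatK := by
      rw [hJK, neg_mul, mul_assoc, hJJ]; noncomm_ring
    rw [e1, e2, e3, hJK, hJJ, hUU]; noncomm_ring

/-- On an element that already intertwines, each of the four terms equals that element, so averaging
multiplies it by 4. -/
theorem exists_intertwiner_ne_zero (p : STS2) : ∃ a, intertwiner a p.incl ≠ 0 := by
  obtain ⟨a, ha, hk, hj⟩ := exists_intertwiner p
  obtain ⟨hXX, hUU, hUX⟩ := p.pureQuat_relations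
  refine ⟨a, ?_⟩
  have h1 : quatK * a * pureQuat p.1.1 = -a := by rw [hk, mul_assoc, hXX]; noncomm_ring
  have h2 : quatJ * a * pureQuat p.1.2 = -a := by rw [hj, mul_assoc, hUU]; noncomm_ring
  have h3 : quatK * quatJ * a * (pureQuat p.1.1 * pureQuat p.1.2) = -a := by
    rw [mul_assoc quatK, hj, ← mul_assoc quatK, hk]
    rw [show a * pureQuat p.1.1 * pureQuat p.1.2 * (pureQuat p.1.1 * pureQuat p.1.2) =
      a * (pureQuat p.1.1 * (pureQuat p.1.2 * pureQuat p.1.1) * pureQuat p.1.2) by noncomm_ring,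
      hUX, show a * (pureQuat p.1.1 * -(pureQuat p.1.1 * pureQuat p.1.2) * pureQuat p.1.2) =
      -(a * ((pureQuat p.1.1 * pureQuat p.1.1) * (pureQuat p.1.2 * pureQuat p.1.2)))
        by noncomm_ring, hXX, hUU]
    noncomm_ring
  have h4 : intertwiner a p.incl = (4 : ℝ) • a := by
    simp only [intertwiner, STS2.incl, h1, h2, h3]
    module
  rw [h4]
  exact smul_ne_zero (by norm_num) ha

/-- `pureQuat` as a continuous linear map. -/
def pureQuatL : E3 →L[ℝ] ℍ[ℝ] :=
  LinearMap.toContinuousLinearMap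
    { toFun := pureQuat
      map_add' := fun z w ↦ by ext <;> simp [pureQuat_comp]
      map_smul' := fun t z ↦ by ext <;> simp [pureQuat_comp] }

theorem contDiff_intertwiner (a : ℍ[ℝ]) : ContDiff ℝ ∞ (intertwiner a) := by
  have h1 : ContDiff ℝ ∞ fun y : E3 × E3 ↦ pureQuat y.1 := pureQuatL.contDiff.comp contDiff_fst
  have h2 : ContDiff ℝ ∞ fun y : E3 × E3 ↦ pureQuat y.2 := pureQuatL.contDiff.comp contDiff_snd
  exact ((contDiff_const.sub (contDiff_const.mul h1)).sub (contDiff_const.mul h2)).sub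
    (contDiff_const.mul (h1.mul h2))

/-- The identification `ℍ ≅ ℂ²` inverse to `toQuat`, as a continuous linear map. -/
def ofQuatL : ℍ[ℝ] →L[ℝ] EuclideanSpace ℂ (Fin 2) :=
  LinearMap.toContinuousLinearMap
    { toFun := fun q ↦ !₂[⟨q.re, q.imI⟩, ⟨q.imJ, q.imK⟩]
      map_add' := fun z w ↦ by ext i; fin_cases i <;> rfl
      map_smul' := fun t z ↦ by
        ext i; fin_cases i <;> apply Complex.ext <;> simp }

theorem toQuat_ofQuatL (q : ℍ[ℝ]) : toQuat (ofQuatL q) = q := by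
  ext <;> rfl

theorem ofQuatL_mem {q : ℍ[ℝ]} (hq : q ≠ 0) : ofQuatL (‖q‖⁻¹ • q) ∈ S3 := by
  obtain ⟨z, hz⟩ := exists_toQuat (‖q‖⁻¹ • q) (by
    rw [Quaternion.normSq_eq_norm_mul_self, norm_smul, norm_inv, norm_norm,
      inv_mul_cancel₀ (norm_ne_zero_iff.2 hq), one_mul])
  have : ofQuatL (‖q‖⁻¹ • q) = z := toQuat_injective (by rw [toQuat_ofQuatL, hz])
  rw [this]
  exact z.2

/-- Normalizing an intertwiner yields a preimage under `Phi`. As the averaged intertwiner is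
polynomial in (x, u), this gives explicit smooth local lifts. -/
theorem Phi_ofQuatL {q : ℍ[ℝ]} (hq : q ≠ 0) (p : STS2) (hk : quatK * q = q * pureQuat p.1.1)
    (hj : quatJ * q = q * pureQuat p.1.2) : Phi ⟨ofQuatL (‖q‖⁻¹ • q), ofQuatL_mem hq⟩ = p := by
  set z : S3 := ⟨ofQuatL (‖q‖⁻¹ • q), ofQuatL_mem hq⟩
  have hz : toQuat z = ‖q‖⁻¹ • q := toQuat_ofQuatL _
  have key (v : ℍ[ℝ]) (x : E3) (h : v * q = q * pureQuat x) :
      vecPart ((toQuat z)⁻¹ * v * toQuat z) = x := by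
    have h' : v * toQuat z = toQuat z * pureQuat x := by
      rw [hz, mul_smul_comm, h, smul_mul_assoc]
    rw [mul_assoc, h', inv_mul_cancel_left₀ (toQuat_ne_zero z), vecPart_pureQuat]
  exact Subtype.ext (Prod.ext (Subtype.ext (key _ _ hk)) (Subtype.ext (key _ _ hj)))

theorem isLocalDiffeomorph_Phi : IsLocalDiffeomorph (𝓡 3) (𝓡 3) ∞ Phi := by
  refine isLocalDiffeomorph_of_deck isLocalHomeomorph_Phi Phi_surjective ?_
  intro x y h
  rcases (Phi_eq_iff x y).1 h with rfl | rfl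
  · exact ⟨id, contMDiff_id, fun _ ↦ rfl, rfl⟩
  · exact ⟨fun z ↦ -z, contMDiff_neg_sphere, fun z ↦ ((Phi_eq_iff z (-z)).2 (.inr rfl)).symm, rfl⟩

theorem isLocalDiffeomorph_lensMk (p : ℕ) : IsLocalDiffeomorph (𝓡 3) (𝓡 3) ∞ (lensMk p) := by
  refine isLocalDiffeomorph_of_deck (isLocalHomeomorph_lensMk p) Quotient.mk_surjective ?_
  intro x y h
  obtain ⟨g, hg⟩ := Quotient.exact h.symm
  exact ⟨fun z ↦ (g : Circle) • z, contMDiff_const_smul_S3 g,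
    fun z ↦ Quotient.sound ⟨g, rfl⟩, hg⟩

section SmoothMaps

variable {F : Type*} [NormedAddCommGroup F] [NormedSpace ℝ F]
  {H : Type*} [TopologicalSpace H] {I : ModelWithCorners ℝ F H}
  {M : Type*} [TopologicalSpace M] [ChartedSpace H M]

/-- A map into `ST S²` is smooth at a point if it is so as a map into `ℝ³ × ℝ³`. -/
theorem contMDiffAt_STS2 {f : M → STS2} {x : M}
    (hf : ContMDiffAt I 𝓘(ℝ, E3 × E3) ∞ (fun y ↦ (f y).incl) x) :
    ContMDiffAt I (𝓡 3) ∞ f x := by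
  -- With this `a` fixed, the intertwiner stays nonzero near `x`. Normalized, it is a smooth lift of
  -- `f` to S³, and `f` is `Phi` composed with the lift.
  obtain ⟨a, ha⟩ := exists_intertwiner_ne_zero (f x)
  have hq : ContMDiffAt I 𝓘(ℝ, ℍ[ℝ]) ∞ (fun y ↦ intertwiner a (f y).incl) x :=
    (contDiff_intertwiner a).contMDiff.contMDiffAt.comp x hf
  have hne : ∀ᶠ y in nhds x, intertwiner a (f y).incl ≠ 0 := hq.continuousAt.eventually_ne ha
  have hN : ContDiffAt ℝ ∞ (fun q : ℍ[ℝ] ↦ ofQuatL (‖q‖⁻¹ • q)) (intertwiner a (f x).incl) :=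
    ofQuatL.contDiff.contDiffAt.comp _
      (((contDiffAt_norm ℝ ha).inv (norm_ne_zero_iff.2 ha)).smul contDiffAt_id)
  have hE : ContMDiffAt I 𝓘(ℝ, EuclideanSpace ℂ (Fin 2)) ∞
      (fun y ↦ ofQuatL (‖intertwiner a (f y).incl‖⁻¹ • intertwiner a (f y).incl)) x :=
    ContMDiffAt.comp (I' := 𝓘(ℝ, ℍ[ℝ])) (f := fun y ↦ intertwiner a (f y).incl) x
      hN.contMDiffAt hq
  classical
  -- The second branch only makes the lift total; smoothness at `x` sees the first one.
  let h : M → S3 := fun y ↦ if hy : intertwiner a (f y).incl ≠ 0 then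
    ⟨_, ofQuatL_mem hy⟩ else ⟨_, ofQuatL_mem ha⟩
  have hh : ContMDiffAt I (𝓡 3) ∞ h x := by
    refine contMDiffAt_sphere (hE.congr_of_eventuallyEq ?_)
    filter_upwards [hne] with y hy
    simp [h, hy]
  refine (isLocalDiffeomorph_Phi.contMDiff.contMDiffAt.comp x hh).congr_of_eventuallyEq ?_
  filter_upwards [hne] with y hy
  simp only [Function.comp_apply, h, dif_pos hy]
  exact (Phi_ofQuatL hy (f y) (intertwiner_spec a _).1 (intertwiner_spec a _).2).symm

end SmoothMaps

/-! ### The geodesic flow of `S²` -/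

/-- The geodesic flow on `ST S²`. -/
def flow (s : ℝ) (p : STS2) : STS2 :=
  STS2.mk (Real.cos s • (p.1.1 : E3) + Real.sin s • (p.1.2 : E3))
    (-Real.sin s • (p.1.1 : E3) + Real.cos s • (p.1.2 : E3))
    (by
      rw [← sq_eq_sq₀ (norm_nonneg _) zero_le_one, ← real_inner_self_eq_norm_sq]
      simp only [inner_add_left, inner_add_right, inner_smul_left, inner_smul_right,
        p.inner_fst_fst, p.inner_fst_snd, p.inner_snd_fst, p.inner_snd_snd, conj_trivial]
      linarith [Real.sin_sq_add_cos_sq s])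
    (by
      rw [← sq_eq_sq₀ (norm_nonneg _) zero_le_one, ← real_inner_self_eq_norm_sq]
      simp only [inner_add_left, inner_add_right, inner_smul_left, inner_smul_right,
        p.inner_fst_fst, p.inner_fst_snd, p.inner_snd_fst, p.inner_snd_snd, conj_trivial]
      linarith [Real.sin_sq_add_cos_sq s])
    (by
      simp only [inner_add_left, inner_add_right, inner_smul_left, inner_smul_right,
        p.inner_fst_fst, p.inner_fst_snd, p.inner_snd_fst, p.inner_snd_snd, conj_trivial]
      ring)

theorem flow_fst (s : ℝ) (p : STS2) : ((flow s p).1.1 : E3) =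
    Real.cos s • (p.1.1 : E3) + Real.sin s • (p.1.2 : E3) := rfl

theorem flow_snd (s : ℝ) (p : STS2) : ((flow s p).1.2 : E3) =
    -Real.sin s • (p.1.1 : E3) + Real.cos s • (p.1.2 : E3) := rfl

theorem STS2.ext' {p p' : STS2} (h1 : (p.1.1 : E3) = p'.1.1) (h2 : (p.1.2 : E3) = p'.1.2) :
    p = p' := Subtype.ext (Prod.ext (Subtype.ext h1) (Subtype.ext h2))

theorem flow_flow (s t : ℝ) (p : STS2) : flow s (flow t p) = flow (s + t) p := by
  apply STS2.ext'
  · simp only [flow_fst, flow_snd, Real.cos_add, Real.sin_add]; module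
  · simp only [flow_fst, flow_snd, Real.cos_add, Real.sin_add]; module

theorem flow_zero (p : STS2) : flow 0 p = p := by
  apply STS2.ext' <;> simp [flow_fst, flow_snd]

theorem flow_neg_flow (s : ℝ) (p : STS2) : flow (-s) (flow s p) = p := by
  rw [flow_flow, neg_add_cancel, flow_zero]

theorem flow_flow_neg (s : ℝ) (p : STS2) : flow s (flow (-s) p) = p := by
  rw [flow_flow, add_neg_cancel, flow_zero]

theorem flow_add_int_mul_two_pi (s : ℝ) (k : ℤ) (p : STS2) :
    flow (s + k * (2 * Real.pi)) p = flow s p := by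
  apply STS2.ext' <;> simp [flow_fst, flow_snd]

theorem contMDiffAt_flow {F : Type*} [NormedAddCommGroup F] [NormedSpace ℝ F]
    {H : Type*} [TopologicalSpace H] {I : ModelWithCorners ℝ F H}
    {M : Type*} [TopologicalSpace M] [ChartedSpace H M] {s : M → ℝ} {f : M → STS2} {x : M}
    (hs : ContMDiffAt I 𝓘(ℝ, ℝ) ∞ s x) (hf : ContMDiffAt I (𝓡 3) ∞ f x) :
    ContMDiffAt I (𝓡 3) ∞ (fun y ↦ flow (s y) (f y)) x := by
  apply contMDiffAt_STS2
  have hi : ContMDiffAt I 𝓘(ℝ, E3 × E3) ∞ (fun y ↦ (f y).incl) x :=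
    (contMDiff_STS2_incl (f x)).comp x hf
  have hg : ContDiff ℝ ∞ fun y : ℝ × (E3 × E3) ↦
      (Real.cos y.1 • y.2.1 + Real.sin y.1 • y.2.2,
        -Real.sin y.1 • y.2.1 + Real.cos y.1 • y.2.2) := by
    have h1 := Real.contDiff_cos (n := ∞)
    have h2 := Real.contDiff_sin (n := ∞)
    fun_prop
  exact ContMDiffAt.comp (I' := 𝓘(ℝ, ℝ × (E3 × E3))) (f := fun y ↦ (s y, (f y).incl)) x
    hg.contMDiff.contMDiffAt (hs.prodMk_space hi)

/-! ### The circle action on S³ and the geodesic flow. -/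

/-- The quaternion `e^{iθ}`. -/
def quatExp (θ : ℝ) : ℍ[ℝ] := ⟨Real.cos θ, Real.sin θ, 0, 0⟩

theorem quatExp_comp (θ : ℝ) : (quatExp θ).re = Real.cos θ ∧ (quatExp θ).imI = Real.sin θ ∧
    (quatExp θ).imJ = 0 ∧ (quatExp θ).imK = 0 := ⟨rfl, rfl, rfl, rfl⟩

theorem toQuat_comp (z : EuclideanSpace ℂ (Fin 2)) : (toQuat z).re = (z 0).re ∧
    (toQuat z).imI = (z 0).im ∧ (toQuat z).imJ = (z 1).re ∧ (toQuat z).imK = (z 1).im :=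
  ⟨rfl, rfl, rfl, rfl⟩

theorem toQuat_circle_smul (θ : ℝ) (z : S3) : toQuat (Circle.exp θ • z : S3) =
    quatExp θ * toQuat z := by
  rw [coe_circle_smul, Circle.coe_exp, Complex.exp_mul_I, ← Complex.ofReal_cos,
    ← Complex.ofReal_sin]
  ext <;> simp [toQuat_comp, quatExp_comp, -Complex.ofReal_cos, -Complex.ofReal_sin]

/-- Replacing q by e^{iθ}q conjugates k and j by e^{iθ} before q acts, which rotates the (k,
j)-plane by 2θ. In particular e^{πi/c} acts as the flow for time 2π/c. -/
theorem Phi_circle_smul (θ : ℝ) (z : S3) : Phi (Circle.exp θ • z) = flow (2 * θ) (Phi z) := by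
  have h (v : ℍ[ℝ]) : (toQuat (Circle.exp θ • z : S3))⁻¹ * v * toQuat (Circle.exp θ • z : S3) =
      (toQuat z)⁻¹ * (star (quatExp θ) * v * quatExp θ) * toQuat z := by
    rw [inv_toQuat, inv_toQuat, toQuat_circle_smul, star_mul]
    simp only [mul_assoc]
  have hk : star (quatExp θ) * quatK * quatExp θ =
      Real.cos (2 * θ) • quatK + Real.sin (2 * θ) • quatJ := by
    ext <;> simp [quatExp_comp, quatJ_comp, quatK_comp, Real.cos_two_mul', Real.sin_two_mul] <;>
      ring
  have hj : star (quatExp θ) * quatJ * quatExp θ =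
      -Real.sin (2 * θ) • quatK + Real.cos (2 * θ) • quatJ := by
    ext <;> simp [quatExp_comp, quatJ_comp, quatK_comp, Real.cos_two_mul', Real.sin_two_mul] <;>
      ring
  have hv (a b : ℝ) : vecPart ((toQuat z)⁻¹ * (a • quatK + b • quatJ) * toQuat z) =
      a • vecPart ((toQuat z)⁻¹ * quatK * toQuat z) +
      b • vecPart ((toQuat z)⁻¹ * quatJ * toQuat z) := by
    rw [mul_add, add_mul, mul_smul_comm, mul_smul_comm, smul_mul_assoc, smul_mul_assoc]
    change vecPartL _ = a • vecPartL _ + b • vecPartL _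
    rw [map_add, map_smul, map_smul]
  apply STS2.ext'
  · change vecPart ((toQuat (Circle.exp θ • z : S3))⁻¹ * quatK *
      toQuat (Circle.exp θ • z : S3)) = _
    rw [h, hk, hv]; rfl
  · change vecPart ((toQuat (Circle.exp θ • z : S3))⁻¹ * quatJ *
      toQuat (Circle.exp θ • z : S3)) = _
    rw [h, hj, hv]; rfl

/-! ### The projection to the lens space -/

theorem lensProj_surjective (c : ℕ) (hc : 1 ≤ c) : Function.Surjective (lensProj c) := by
  rintro ⟨z⟩
  exact ⟨Phi z, lensProj_Phi c hc z⟩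

theorem circle_exp_zpow (x : ℝ) (n : ℤ) : Circle.exp x ^ n = Circle.exp (n * x) := by
  have h := map_zsmul Circle.expHom n x
  rw [zsmul_eq_mul] at h
  exact h.symm

theorem lensMk_eq_iff (c : ℕ) (hc : 1 ≤ c) (z w : S3) : lensMk (2 * c) z = lensMk (2 * c) w ↔
    ∃ k : ℤ, Circle.exp (k * (Real.pi / c)) • w = z := by
  have hc' : (c : ℝ) ≠ 0 := by positivity
  have e : 2 * Real.pi / (2 * c : ℕ) = Real.pi / c := by push_cast; field_simp
  constructor
  · intro h
    obtain ⟨⟨g, n, rfl⟩, h⟩ := Quotient.exact h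
    refine ⟨n, ?_⟩
    rw [← h, ← circle_exp_zpow, ← e]
    rfl
  · rintro ⟨k, h⟩
    refine Quotient.sound ⟨⟨Circle.exp (2 * Real.pi / (2 * c : ℕ)) ^ k, k, rfl⟩, ?_⟩
    rw [← h, ← circle_exp_zpow, ← e]
    rfl

/-- Angle doubling turns the powers of e^{πi/c} into flows for multiples of 2π/c. The sign ambiguity
of lifts to S³ is harmless since -1 belongs to ℤ_{2c}. -/
theorem lensProj_eq_iff (c : ℕ) (hc : 1 ≤ c) (p p' : STS2) : lensProj c p = lensProj c p' ↔
    ∃ k : ℤ, flow (k * (2 * Real.pi / c)) p' = p := by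
  have hc' : (c : ℝ) ≠ 0 := by positivity
  obtain ⟨z, rfl⟩ := Phi_surjective p
  obtain ⟨w, rfl⟩ := Phi_surjective p'
  have e (k : ℤ) : flow (k * (2 * Real.pi / c)) (Phi w) =
      Phi (Circle.exp (k * (Real.pi / c)) • w) := by
    rw [Phi_circle_smul]; congr 1; ring
  rw [lensProj_Phi c hc, lensProj_Phi c hc]
  constructor
  · intro h
    obtain ⟨k, hk⟩ := (lensMk_eq_iff c hc z w).1 h
    exact ⟨k, by rw [e, hk]⟩
  · rintro ⟨k, hk⟩
    rw [e] at hk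
    have h := (lensMk_eq_iff c hc _ w).2 ⟨k, rfl⟩
    rw [← h]
    rcases (Phi_eq_iff _ _).1 hk with h | h
    · rw [h]
    · rw [h, lensMk_neg c hc]

/-- Near Φ(z) the map is a local inverse of Φ followed by the quotient map S³ → L(2c,1). -/
theorem isLocalDiffeomorph_lensProj (c : ℕ) (hc : 1 ≤ c) :
    IsLocalDiffeomorph (𝓡 3) (𝓡 3) ∞ (lensProj c) := by
  intro p
  obtain ⟨z, rfl⟩ := Phi_surjective p
  have hL := (isLocalDiffeomorph_Phi z).localInverse_isLocalDiffeomorphAt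
  have hz : (isLocalDiffeomorph_Phi z).localInverse (Phi z) = z :=
    (isLocalDiffeomorph_Phi z).localInverse_left_inv
      (isLocalDiffeomorph_Phi z).localInverse_mem_target
  refine IsLocalDiffeomorphAt.congr_of_eventuallyEq (f := lensMk (2 * c) ∘
    (isLocalDiffeomorph_Phi z).localInverse)
    (IsLocalDiffeomorphAt.comp (𝓡 3) (LensSpace (2 * c)) hL ?_) ?_
  · rw [hz]; exact isLocalDiffeomorph_lensMk _ z
  · filter_upwards [(isLocalDiffeomorph_Phi z).localInverse_eventuallyEq_right] with y hy
    rw [Function.comp_apply, ← lensProj_Phi c hc]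
    exact congrArg (lensProj c) hy.symm

/-! ### The geodesic equation of an isometrically immersed manifold -/

section Flat

variable {E A : Type*} [NormedAddCommGroup E] [NormedSpace ℝ E] [NormedAddCommGroup A]
  [NormedSpace ℝ A]

theorem fderiv_pullback_form (B : A →L[ℝ] A →L[ℝ] ℝ) {ψ : E → A} {y : E}
    (hψ : ContDiffAt ℝ ∞ ψ y) (u v w : E) :
    fderiv ℝ (fun y ↦ B (fderiv ℝ ψ y v) (fderiv ℝ ψ y w)) y u =
      B (fderiv ℝ (fderiv ℝ ψ) y u v) (fderiv ℝ ψ y w) +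
      B (fderiv ℝ ψ y v) (fderiv ℝ (fderiv ℝ ψ) y u w) := by
  have h : HasFDerivAt (fderiv ℝ ψ) (fderiv ℝ (fderiv ℝ ψ) y) y :=
    ((hψ.fderiv_right (m := 1) (WithTop.coe_le_coe.2 le_top)).differentiableAt
      (by simp)).hasFDerivAt
  have hv := h.clm_apply (hasFDerivAt_const v y)
  have hw := h.clm_apply (hasFDerivAt_const w y)
  have hB := (B.hasFDerivAt.comp y hv).clm_apply hw
  rw [show (fun y ↦ B (fderiv ℝ ψ y v) (fderiv ℝ ψ y w)) =
    fun y ↦ (B ∘ fun y ↦ fderiv ℝ ψ y v) y (fderiv ℝ ψ y w) from rfl, hB.fderiv]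
  simp [add_comm]

/-- The product rule gives six terms. By symmetry of `B` and of the second derivative, four cancel
and the remaining two agree. -/
theorem christoffel_pullback_form (B : A →L[ℝ] A →L[ℝ] ℝ) (hB : ∀ a b, B a b = B b a)
    {ψ : E → A} {y : E} (hψ : ContDiffAt ℝ ∞ ψ y) (u v w : E) :
    (fderiv ℝ (fun y ↦ B (fderiv ℝ ψ y v) (fderiv ℝ ψ y w)) y u
      + fderiv ℝ (fun y ↦ B (fderiv ℝ ψ y u) (fderiv ℝ ψ y w)) y v
      - fderiv ℝ (fun y ↦ B (fderiv ℝ ψ y u) (fderiv ℝ ψ y v)) y w) / 2 =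
      B (fderiv ℝ (fderiv ℝ ψ) y u v) (fderiv ℝ ψ y w) := by
  have hs : IsSymmSndFDerivAt ℝ ψ y := hψ.isSymmSndFDerivAt
    (by rw [minSmoothness_of_isRCLikeNormedField]; exact WithTop.coe_le_coe.2 le_top)
  rw [fderiv_pullback_form B hψ, fderiv_pullback_form B hψ, fderiv_pullback_form B hψ,
    hs.eq v u, hs.eq w u, hs.eq w v, hB (fderiv ℝ (fderiv ℝ ψ) y u w)]
  ring

theorem contDiffAt_deriv {x : ℝ → E} {s : ℝ} (hx : ContDiffAt ℝ ∞ x s) :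
    ContDiffAt ℝ ∞ (deriv x) s := by
  have h := (hx.fderiv_right (m := ∞) le_rfl).clm_apply (contDiffAt_const (c := (1 : ℝ)))
  simpa only [fderiv_apply_one_eq_deriv] using h

theorem deriv_deriv_comp {ψ : E → A} {x : ℝ → E} {s : ℝ} (hψ : ContDiffAt ℝ ∞ ψ (x s))
    (hx : ContDiffAt ℝ ∞ x s) :
    deriv (deriv fun r ↦ ψ (x r)) s =
      fderiv ℝ (fderiv ℝ ψ) (x s) (deriv x s) (deriv x s) +
        fderiv ℝ ψ (x s) (deriv (deriv x) s) := by
  have h1 : deriv (fun r ↦ ψ (x r)) =ᶠ[nhds s] fun r ↦ fderiv ℝ ψ (x r) (deriv x r) := by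
    have e1 : ∀ᶠ r in nhds s, ContDiffAt ℝ 1 x r := (hx.of_le (by simp)).eventually (by simp)
    have e2 : ∀ᶠ r in nhds s, ContDiffAt ℝ 1 ψ (x r) :=
      hx.continuousAt.eventually ((hψ.of_le (by simp)).eventually (by simp))
    filter_upwards [e1, e2] with r h1 h2
    exact ((h2.differentiableAt (by simp)).hasFDerivAt.comp_hasDerivAt r
      (h1.differentiableAt (by simp)).hasDerivAt).deriv
  rw [h1.deriv_eq]
  have h : HasFDerivAt (fderiv ℝ ψ) (fderiv ℝ (fderiv ℝ ψ) (x s)) (x s) :=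
    ((hψ.fderiv_right (m := 1) (WithTop.coe_le_coe.2 le_top)).differentiableAt
      (by simp)).hasFDerivAt
  have hx1 : HasDerivAt x (deriv x s) s := (hx.differentiableAt (by simp)).hasDerivAt
  have hx2 : HasDerivAt (deriv x) (deriv (deriv x) s) s :=
    (contDiffAt_deriv hx).differentiableAt (by simp) |>.hasDerivAt
  exact ((h.comp_hasDerivAt s hx1).clm_apply hx2).deriv

end Flat

section Immersed

variable {E : Type*} [NormedAddCommGroup E] [NormedSpace ℝ E] {H : Type*} [TopologicalSpace H]
  {I : ModelWithCorners ℝ E H} [I.Boundaryless] {M : Type*} [TopologicalSpace M]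
  [ChartedSpace H M] [IsManifold I ∞ M] {A : Type*} [NormedAddCommGroup A] [NormedSpace ℝ A]

theorem mfderiv_extChartAt_symm_comp {ι : M → A} (hι : ContMDiff I 𝓘(ℝ, A) ∞ ι) (x₀ : M) {y : E}
    (hy : y ∈ (extChartAt I x₀).target) (v : E) :
    mvfderiv I ι ((extChartAt I x₀).symm y)
      (mfderivWithin 𝓘(ℝ, E) I (extChartAt I x₀).symm (range I) y v) =
    fderiv ℝ (ι ∘ (extChartAt I x₀).symm) y v := by
  rw [I.range_eq_univ, mfderivWithin_univ, ← mfderiv_eq_fderiv]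
  have h1 : MDifferentiableAt 𝓘(ℝ, E) I (extChartAt I x₀).symm y := by
    have := (contMDiffOn_extChartAt_symm (I := I) (n := ∞) x₀).contMDiffAt
      ((isOpen_extChartAt_target x₀).mem_nhds hy)
    exact this.mdifferentiableAt (by simp)
  rw [mfderiv_comp y ((hι _).mdifferentiableAt (by simp)) h1]
  rfl

/-- In the chart ι ∘ γ is ψ ∘ x, with second derivative D²ψ(x', x') + Dψ(x''). Paired with Dψ(w),
the first summand is the Christoffel term and the second the metric term. So γ is a geodesic iff its
ambient acceleration is `B`-orthogonal to the tangent spaces. -/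
theorem geodesic_expression_eq {g : ∀ x : M, LinearMap.BilinForm ℝ (TangentSpace I x)}
    {ι : M → A} (hι : ContMDiff I 𝓘(ℝ, A) ∞ ι) (B : A →L[ℝ] A →L[ℝ] ℝ) (hB : ∀ a b, B a b = B b a)
    (hg : ∀ x (v w : TangentSpace I x), g x v w = B (mvfderiv I ι x v) (mvfderiv I ι x w))
    {γ : ℝ → M} {s : ℝ} (hγ : ContMDiffAt 𝓘(ℝ, ℝ) I ∞ γ s) (w : E) :
    metricInChart g (γ s) (extChartAt I (γ s) (γ s))
        (deriv (deriv fun r ↦ extChartAt I (γ s) (γ r)) s) w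
      + christoffel g (γ s) (extChartAt I (γ s) (γ s))
        (deriv (fun r ↦ extChartAt I (γ s) (γ r)) s)
        (deriv (fun r ↦ extChartAt I (γ s) (γ r)) s) w =
    B (deriv (deriv fun r ↦ ι (γ r)) s) (mvfderiv I ι (γ s)
      (mfderivWithin 𝓘(ℝ, E) I (extChartAt I (γ s)).symm (range I)
        (extChartAt I (γ s) (γ s)) w)) := by
  set x₀ := γ s with hx₀
  set ψ : E → A := ι ∘ (extChartAt I x₀).symm with hψdef
  set y₀ := extChartAt I x₀ x₀ with hy₀
  set x : ℝ → E := fun r ↦ extChartAt I x₀ (γ r) with hxdef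
  have hm (y : E) (hy : y ∈ (extChartAt I x₀).target) (v w : E) :
      metricInChart g x₀ y v w = B (fderiv ℝ ψ y v) (fderiv ℝ ψ y w) := by
    rw [metricInChart, hg, mfderiv_extChartAt_symm_comp hι x₀ hy,
      mfderiv_extChartAt_symm_comp hι x₀ hy]
  have hyt : y₀ ∈ (extChartAt I x₀).target := mem_extChartAt_target x₀
  have hnt : (extChartAt I x₀).target ∈ nhds y₀ := (isOpen_extChartAt_target x₀).mem_nhds hyt
  have hψ : ContDiffAt ℝ ∞ ψ y₀ := by
    rw [← contMDiffAt_iff_contDiffAt]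
    exact (hι _).comp y₀ ((contMDiffOn_extChartAt_symm (I := I) (n := ∞) x₀).contMDiffAt hnt)
  have hx : ContDiffAt ℝ ∞ x s := by
    rw [← contMDiffAt_iff_contDiffAt]
    exact ContMDiffAt.comp (I' := I) s (contMDiffAt_extChartAt' (mem_chart_source H x₀)) hγ
  have hΓ (u v w : E) : christoffel g x₀ y₀ u v w =
      B (fderiv ℝ (fderiv ℝ ψ) y₀ u v) (fderiv ℝ ψ y₀ w) := by
    rw [← christoffel_pullback_form B hB hψ, christoffel]
    have e (v w : E) : fderivWithin ℝ (fun y ↦ metricInChart g x₀ y v w) (range I) y₀ =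
        fderiv ℝ (fun y ↦ B (fderiv ℝ ψ y v) (fderiv ℝ ψ y w)) y₀ := by
      rw [I.range_eq_univ, fderivWithin_univ]
      refine Filter.EventuallyEq.fderiv_eq ?_
      filter_upwards [hnt] with y hy
      exact hm y hy v w
    rw [e, e, e]
  rw [hm y₀ hyt, hΓ, ← add_apply, ← map_add, add_comm]
  have h2 : deriv (deriv fun r ↦ ι (γ r)) s = fderiv ℝ (fderiv ℝ ψ) y₀ (deriv x s) (deriv x s) +
      fderiv ℝ ψ y₀ (deriv (deriv x) s) := by
    rw [← deriv_deriv_comp (x := x) hψ hx]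
    refine Filter.EventuallyEq.deriv_eq (Filter.EventuallyEq.deriv ?_)
    filter_upwards [hγ.continuousAt.eventually_mem (extChartAt_source_mem_nhds (I := I) (γ s))]
      with r hr
    simp only [hψdef, hxdef, Function.comp_apply]
    rw [(extChartAt I x₀).left_inv hr]
  rw [h2]
  congr 1
  have := mfderiv_extChartAt_symm_comp hι x₀ hyt w
  rw [← this, extChartAt_to_inv]

end Immersed

local notation "I21" => ModelWithCorners.prod (𝓡 2) (𝓡 1)

theorem finrank_euclidean_three : Fact (Module.finrank ℝ E3 = 2 + 1) :=
  ⟨by simp⟩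

attribute [local instance] finrank_real_complex_fact' finrank_euclidean_three

/-! ### The spacetime as a submanifold of `ℝ³ × ℂ` -/

theorem contMDiff_coe_circle {m : ℕ∞ω} :
    ContMDiff (𝓡 1) 𝓘(ℝ, ℂ) m (fun z : Circle ↦ (z : ℂ)) :=
  contMDiff_coe_sphere (E := ℂ) (n := 1)

theorem injective_mvfderiv_coe_circle (z : Circle) :
    Function.Injective (mvfderiv (𝓡 1) (fun z : Circle ↦ (z : ℂ)) z) :=
  injective_mvfderiv_subtypeVal_sphere (E := ℂ) (n := 1) z

theorem mem_range_mvfderiv_coe_circle (z : Circle) (η : ℂ) :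
    (∃ v, mvfderiv (𝓡 1) (fun z : Circle ↦ (z : ℂ)) z v = η) ↔ inner ℝ (z : ℂ) η = 0 := by
  have h := range_mvfderiv_subtypeVal (E := ℂ) (n := 1) z
  rw [← Submodule.mem_orthogonal_singleton_iff_inner_right (𝕜 := ℝ)]
  exact iff_of_eq (congrArg (fun S : Submodule ℝ ℂ ↦ η ∈ S) h)

theorem mem_range_tangentInclS2 (x : S2) (a : E3) :
    (∃ v, tangentInclS2 x v = a) ↔ inner ℝ (x : E3) a = 0 := by
  have h := range_mvfderiv_subtypeVal (E := E3) (n := 2) x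
  rw [← Submodule.mem_orthogonal_singleton_iff_inner_right (𝕜 := ℝ)]
  exact iff_of_eq (congrArg (fun S : Submodule ℝ E3 ↦ a ∈ S) h)

/-- The inclusion `S² × S¹ ⊂ ℝ³ × ℂ`. -/
def spacetimeIncl (m : S2 × Circle) : E3 × ℂ := (m.1, m.2)

theorem contMDiff_spacetimeIncl : ContMDiff I21 𝓘(ℝ, E3 × ℂ) ∞ spacetimeIncl :=
  (contMDiff_coe_sphere.comp contMDiff_fst).prodMk_space (contMDiff_coe_circle.comp contMDiff_snd)

theorem mdifferentiableAt_spacetimeIncl (m : S2 × Circle) :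
    MDifferentiableAt I21 𝓘(ℝ, E3 × ℂ) spacetimeIncl m :=
  (contMDiff_spacetimeIncl m).mdifferentiableAt (by simp)

/-- The differential of the inclusion `S² × S¹ ⊂ ℝ³ × ℂ`. -/
def tangentIncl (m : S2 × Circle) : TangentSpace I21 m →L[ℝ] E3 × ℂ :=
  mvfderiv I21 spacetimeIncl m

theorem tangentIncl_fst (m : S2 × Circle) (v : TangentSpace I21 m) :
    (tangentIncl m v).1 = tangentInclS2 m.1 (mfderiv I21 (𝓡 2) Prod.fst m v) := by
  have h1 : HasMFDerivAt I21 𝓘(ℝ, E3) (fun m : S2 × Circle ↦ (spacetimeIncl m).1) m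
      ((ContinuousLinearMap.fst ℝ E3 ℂ).comp (mfderiv I21 𝓘(ℝ, E3 × ℂ) spacetimeIncl m)) :=
    HasMFDerivAt.comp m (ContinuousLinearMap.hasMFDerivAt (ContinuousLinearMap.fst ℝ E3 ℂ))
      (mdifferentiableAt_spacetimeIncl m).hasMFDerivAt
  have h2 : HasMFDerivAt I21 𝓘(ℝ, E3) (fun m : S2 × Circle ↦ (spacetimeIncl m).1) m _ :=
    HasMFDerivAt.comp (g := ((↑) : S2 → E3)) m
      ((contMDiff_coe_sphere (m := 1) m.1).mdifferentiableAt one_ne_zero).hasMFDerivAt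
      (mdifferentiableAt_fst (I := 𝓡 2) (I' := 𝓡 1)).hasMFDerivAt
  exact DFunLike.congr_fun (hasMFDerivAt_unique h1 h2) v

theorem tangentIncl_snd (m : S2 × Circle) (v : TangentSpace I21 m) :
    (tangentIncl m v).2 = mvfderiv (𝓡 1) (fun z : Circle ↦ (z : ℂ)) m.2
      (mfderiv I21 (𝓡 1) Prod.snd m v) := by
  have h1 : HasMFDerivAt I21 𝓘(ℝ, ℂ) (fun m : S2 × Circle ↦ (spacetimeIncl m).2) m
      ((ContinuousLinearMap.snd ℝ E3 ℂ).comp (mfderiv I21 𝓘(ℝ, E3 × ℂ) spacetimeIncl m)) :=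
    HasMFDerivAt.comp m (ContinuousLinearMap.hasMFDerivAt (ContinuousLinearMap.snd ℝ E3 ℂ))
      (mdifferentiableAt_spacetimeIncl m).hasMFDerivAt
  have h2 : HasMFDerivAt I21 𝓘(ℝ, ℂ) (fun m : S2 × Circle ↦ (spacetimeIncl m).2) m _ :=
    HasMFDerivAt.comp (g := fun z : Circle ↦ (z : ℂ)) m
      ((contMDiff_coe_circle (m := 1) m.2).mdifferentiableAt one_ne_zero).hasMFDerivAt
      (mdifferentiableAt_snd (I := 𝓡 2) (I' := 𝓡 1)).hasMFDerivAt
  exact DFunLike.congr_fun (hasMFDerivAt_unique h1 h2) v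

theorem tangentIncl_injective (m : S2 × Circle) : Function.Injective (tangentIncl m) := by
  intro v w h
  have h1 := congrArg Prod.fst h
  have h2 := congrArg Prod.snd h
  rw [tangentIncl_fst, tangentIncl_fst] at h1
  rw [tangentIncl_snd, tangentIncl_snd] at h2
  have h1' := injective_mvfderiv_subtypeVal_sphere (E := E3) (n := 2) m.1 h1
  have h2' := injective_mvfderiv_coe_circle m.2 h2
  rw [mfderiv_fst] at h1'
  rw [mfderiv_snd] at h2'
  exact Prod.ext h1' h2'

theorem mem_range_tangentIncl (m : S2 × Circle) (a : E3) (η : ℂ) :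
    (∃ v, tangentIncl m v = (a, η)) ↔ inner ℝ (m.1 : E3) a = 0 ∧ inner ℝ (m.2 : ℂ) η = 0 := by
  rw [← mem_range_tangentInclS2, ← mem_range_mvfderiv_coe_circle]
  constructor
  · rintro ⟨v, hv⟩
    exact ⟨⟨_, (tangentIncl_fst m v).symm.trans (congrArg Prod.fst hv)⟩,
      ⟨_, (tangentIncl_snd m v).symm.trans (congrArg Prod.snd hv)⟩⟩
  · rintro ⟨⟨v, hv⟩, ⟨w, hw⟩⟩
    let t : TangentSpace I21 m := (v, w)
    refine ⟨t, Prod.ext ((tangentIncl_fst m t).trans ?_) ((tangentIncl_snd m t).trans ?_)⟩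
    · rw [mfderiv_fst]; exact hv
    · rw [mfderiv_snd]; exact hw

theorem inner_tangentIncl (m : S2 × Circle) (v : TangentSpace I21 m) :
    inner ℝ (m.1 : E3) (tangentIncl m v).1 = 0 ∧ inner ℝ (m.2 : ℂ) (tangentIncl m v).2 = 0 :=
  (mem_range_tangentIncl m _ _).1 ⟨v, rfl⟩

/-- The bilinear form of `ℝ³ × ℂ` that restricts to the Lorentzian metric. -/
def ambientForm (c : ℕ) : (E3 × ℂ) →L[ℝ] (E3 × ℂ) →L[ℝ] ℝ :=
  (innerSL ℝ).bilinearComp (ContinuousLinearMap.fst ℝ E3 ℂ) (ContinuousLinearMap.fst ℝ E3 ℂ) -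
    (1 / (c : ℝ) ^ 2) •
    (innerSL ℝ).bilinearComp (ContinuousLinearMap.snd ℝ E3 ℂ) (ContinuousLinearMap.snd ℝ E3 ℂ)

theorem ambientForm_apply (c : ℕ) (a b : E3 × ℂ) :
    ambientForm c a b = inner ℝ a.1 b.1 - (1 / (c : ℝ) ^ 2) * inner ℝ a.2 b.2 := rfl

/-- The imaginary part of `z̄ η`. -/
def angular (z η : ℂ) : ℝ := (starRingEnd ℂ z * η).im

theorem eq_angular_smul (z : Circle) (η : ℂ) (h : inner ℝ (z : ℂ) η = 0) :
    η = angular z η • (Complex.I * (z : ℂ)) := by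
  have hz : (z : ℂ).re ^ 2 + (z : ℂ).im ^ 2 = 1 := by
    have := Circle.normSq_coe z
    rw [Complex.normSq_apply] at this; linarith
  have h' : (z : ℂ).re * η.re + (z : ℂ).im * η.im = 0 := by
    rw [Complex.inner] at h; simpa [mul_comm] using h
  apply Complex.ext <;> simp [angular]
  · linear_combination (-η.re) * hz + (z : ℂ).re * h'
  · linear_combination (-η.im) * hz + (z : ℂ).im * h'

theorem norm_I_mul_circle (z : Circle) : ‖Complex.I * (z : ℂ)‖ = 1 := by simp [Circle.norm_coe]

/-- Tangent vectors of the circle at z are real multiples of the unit vector iz, and dt reads off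
the multiple. Hence dt² is the Euclidean inner product restricted to the circle. -/
theorem lorentzMetric_eq (c : ℕ) (m : S2 × Circle) (v w : TangentSpace I21 m) :
    lorentzMetric c m v w = ambientForm c (tangentIncl m v) (tangentIncl m w) := by
  have key (η θ : ℂ) (h1 : inner ℝ (m.2 : ℂ) η = 0) (h2 : inner ℝ (m.2 : ℂ) θ = 0) :
      angular m.2 η * angular m.2 θ = inner ℝ η θ := by
    conv_rhs => rw [eq_angular_smul m.2 η h1, eq_angular_smul m.2 θ h2]
    rw [inner_smul_left, inner_smul_right, real_inner_self_eq_norm_sq, norm_I_mul_circle]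
    simp
  have e : lorentzMetric c m v w = inner ℝ (tangentIncl m v).1 (tangentIncl m w).1 -
      (1 / (c : ℝ) ^ 2) * (angular m.2 (tangentIncl m v).2 * angular m.2 (tangentIncl m w).2) := by
    rw [tangentIncl_fst, tangentIncl_fst, tangentIncl_snd, tangentIncl_snd]
    rfl
  rw [e, ambientForm_apply, key _ _ (inner_tangentIncl m v).2 (inner_tangentIncl m w).2]

theorem ambientForm_comm (c : ℕ) (a b : E3 × ℂ) : ambientForm c a b = ambientForm c b a := by
  rw [ambientForm_apply, ambientForm_apply, real_inner_comm, real_inner_comm b.2]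

/-- The ambient velocity of a curve. -/
theorem tangentIncl_mfderiv {γ : ℝ → S2 × Circle} {s : ℝ}
    (hγ : MDifferentiableAt 𝓘(ℝ, ℝ) I21 γ s) :
    tangentIncl (γ s) (mfderiv 𝓘(ℝ, ℝ) I21 γ s (1 : ℝ)) =
      deriv (fun r ↦ spacetimeIncl (γ r)) s := by
  have h := mfderiv_comp s (mdifferentiableAt_spacetimeIncl (γ s)) hγ
  rw [mfderiv_eq_fderiv] at h
  rw [← fderiv_apply_one_eq_deriv]
  exact (DFunLike.congr_fun h (1 : ℝ)).symm

theorem tangentIncl_timeField (m : S2 × Circle) :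
    tangentIncl m (timeField m) = (0, Complex.I * (m.2 : ℂ)) := by
  have hm : ContMDiff 𝓘(ℝ, ℝ) I21 ∞ (fun θ : ℝ ↦ (m.1, m.2 * Circle.exp θ)) :=
    contMDiff_const.prodMk (contMDiff_const.mul contMDiff_circleExp)
  have h := tangentIncl_mfderiv (s := 0) (hm.mdifferentiableAt (by simp))
  have hd : HasDerivAt (fun r : ℝ ↦ spacetimeIncl (m.1, m.2 * Circle.exp r))
      (0, (m.2 : ℂ) * (Complex.exp ((0 : ℝ) * Complex.I) * (1 * Complex.I))) 0 := by
    refine (hasDerivAt_const (0 : ℝ) (m.1 : E3)).prodMk ?_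
    simp only [Circle.coe_mul, Circle.coe_exp]
    exact (((Complex.ofRealCLM.hasDerivAt (x := 0)).mul_const Complex.I).cexp).const_mul _
  rw [hd.deriv] at h
  have e : (m.1, m.2 * Circle.exp 0) = m := by simp
  have h' : tangentIncl (m.1, m.2 * Circle.exp 0) (timeField m) = (0, Complex.I * (m.2 : ℂ)) := by
    refine h.trans ?_
    simp [mul_comm]
  rwa [e] at h'

/-- Future null vectors, in the ambient space. -/
theorem mem_futureNullCone_iff (c : ℕ) (hc : 1 ≤ c) (v : TangentBundle I21 (S2 × Circle)) :
    v ∈ futureNullCone (lorentzMetric c) timeField ↔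
      ∃ r : ℝ, 0 < r ∧ ‖(tangentIncl v.1 v.2).1‖ = r ∧
        (tangentIncl v.1 v.2).2 = (c * r) • (Complex.I * (v.1.2 : ℂ)) := by
  have hc' : (0 : ℝ) < c := by positivity
  obtain ⟨m, v⟩ := v
  simp only [futureNullCone, mem_ofPred_eq]
  rw [lorentzMetric_eq, lorentzMetric_eq, tangentIncl_timeField, ambientForm_apply,
    ambientForm_apply]
  have hη := eq_angular_smul m.2 _ (inner_tangentIncl m v).2
  set a := (tangentIncl m v).1 with ha
  set η := (tangentIncl m v).2 with hη'
  generalize angular m.2 η = b at hη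
  rw [hη]
  simp only [inner_zero_right, inner_smul_left, inner_smul_right, real_inner_self_eq_norm_sq,
    norm_I_mul_circle, conj_trivial]
  have hIz : Complex.I * (m.2 : ℂ) ≠ 0 := by
    rw [← norm_ne_zero_iff, norm_I_mul_circle]; exact one_ne_zero
  constructor
  -- The angular part is `b` times the unit tangent iz. The time orientation forces `b > 0`, and
  -- nullity then gives the spatial norm `b / c`.
  · rintro ⟨-, h1, h2⟩
    have hb : 0 < b := by
      have : 0 < 1 / (c : ℝ) ^ 2 := by positivity
      nlinarith
    have h3 : ‖a‖ ^ 2 = (b / c) ^ 2 := by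
      rw [div_pow]; field_simp at h1 ⊢; linarith
    have h4 : ‖a‖ = b / c := by
      rwa [sq_eq_sq₀ (norm_nonneg _) (by positivity)] at h3
    refine ⟨b / c, by positivity, h4, ?_⟩
    rw [mul_div_cancel₀ _ hc'.ne']
  · rintro ⟨r, hr, h1, h2⟩
    have hb : b = c * r := smul_left_injective ℝ hIz h2
    refine ⟨?_, ?_, ?_⟩
    · intro h0
      rw [h0, map_zero] at ha
      rw [ha, Prod.fst_zero, norm_zero] at h1
      exact hr.ne h1
    · rw [h1, hb]; field_simp; ring
    · rw [hb]
      have : 0 < (1 / (c : ℝ) ^ 2) * (c * r * 1 ^ 2) := by positivity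
      linarith

/-! ### The null geodesics of `S² × S¹` -/

/-- The curve `s ↦ (x cos s + u sin s, e^{ics})`. -/
def lightCurve (c : ℕ) (p : STS2) (s : ℝ) : S2 × Circle := ((flow s p).1.1, Circle.exp (c * s))

theorem greatCircleLift_eq_range (c : ℕ) (p : STS2) :
    greatCircleLift c p = range (lightCurve c p) := by
  ext m
  constructor
  · rintro ⟨s, h1, h2⟩
    exact ⟨s, Prod.ext (Subtype.ext h1.symm) h2.symm⟩
  · rintro ⟨s, rfl⟩
    exact ⟨s, rfl, rfl⟩

theorem hasDerivAt_flow_fst (p : STS2) (s : ℝ) :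
    HasDerivAt (fun s ↦ ((flow s p).1.1 : E3)) ((flow s p).1.2 : E3) s := by
  simp only [flow_fst, flow_snd]
  exact ((Real.hasDerivAt_cos s).smul_const _).add ((Real.hasDerivAt_sin s).smul_const _)

theorem hasDerivAt_flow_snd (p : STS2) (s : ℝ) :
    HasDerivAt (fun s ↦ ((flow s p).1.2 : E3)) (-((flow s p).1.1 : E3)) s := by
  simp only [flow_fst, flow_snd]
  convert! ((Real.hasDerivAt_sin s).neg.smul_const (p.1.1 : E3)).add
    ((Real.hasDerivAt_cos s).smul_const (p.1.2 : E3)) using 1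
  module

theorem hasDerivAt_circleExp (c s : ℝ) :
    HasDerivAt (fun s ↦ (Circle.exp (c * s) : ℂ))
      (c • (Complex.I * (Circle.exp (c * s) : ℂ))) s := by
  simp only [Circle.coe_exp]
  have h : HasDerivAt (fun s : ℝ ↦ ((c * s : ℝ) : ℂ)) (c : ℂ) s := by
    simpa using ((hasDerivAt_id s).const_mul c).ofReal_comp
  convert! (h.mul_const Complex.I).cexp using 1
  rw [Complex.real_smul]; ring

/-- The ambient velocity of a light curve. -/
def ambientVelocity (c : ℕ) (p : STS2) (s : ℝ) : E3 × ℂ :=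
  ((flow s p).1.2, (c : ℝ) • (Complex.I * (Circle.exp (c * s) : ℂ)))

theorem hasDerivAt_lightCurve (c : ℕ) (p : STS2) (s : ℝ) :
    HasDerivAt (fun s ↦ spacetimeIncl (lightCurve c p s)) (ambientVelocity c p s) s :=
  (hasDerivAt_flow_fst p s).prodMk (hasDerivAt_circleExp c s)

theorem hasDerivAt_ambientVelocity (c : ℕ) (p : STS2) (s : ℝ) :
    HasDerivAt (ambientVelocity c p) (-((flow s p).1.1 : E3),
      (c : ℝ) • (Complex.I * ((c : ℝ) • (Complex.I * (Circle.exp (c * s) : ℂ))))) s :=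
  (hasDerivAt_flow_snd p s).prodMk
    (((hasDerivAt_circleExp c s).const_mul Complex.I).const_smul (c : ℝ))

theorem hasDerivAt_affine {A : Type*} [NormedAddCommGroup A] [NormedSpace ℝ A] {f : ℝ → A}
    {f' : A} (a b s : ℝ) (h : HasDerivAt f f' (a * s + b)) :
    HasDerivAt (fun s ↦ f (a * s + b)) (a • f') s := by
  have h1 : HasDerivAt (fun s ↦ a * s + b) a s := by
    simpa using ((hasDerivAt_id s).const_mul a).add_const b
  exact h.scomp s h1

theorem contMDiff_lightCurve (c : ℕ) (p : STS2) : ContMDiff 𝓘(ℝ, ℝ) I21 ∞ (lightCurve c p) := by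
  refine ContMDiff.prodMk (fun s ↦ contMDiffAt_sphere ?_) ?_
  · exact contDiff_fst.contMDiff.contMDiffAt.comp s <| (contMDiff_STS2_incl _).comp s
      (contMDiffAt_flow (f := fun _ ↦ p) contMDiffAt_id contMDiffAt_const)
  · exact contMDiff_circleExp.comp (contDiff_const.mul contDiff_id).contMDiff

theorem contMDiff_affine (a b : ℝ) : ContMDiff 𝓘(ℝ, ℝ) 𝓘(ℝ, ℝ) ∞ (fun s ↦ a * s + b) :=
  ((contDiff_const.mul contDiff_id).add contDiff_const).contMDiff

theorem tangentBundle_ext {v w : TangentBundle I21 (S2 × Circle)} (h : v.1 = w.1)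
    (h' : tangentIncl v.1 v.2 = tangentIncl w.1 w.2) : v = w := by
  obtain ⟨m, v⟩ := v
  obtain ⟨m', w⟩ := w
  obtain rfl : m = m' := h
  exact congrArg _ (tangentIncl_injective m h')

theorem tangentIncl_velocity_lightCurve (c : ℕ) (p : STS2) (a b s : ℝ) :
    tangentIncl (velocity I21 (fun s ↦ lightCurve c p (a * s + b)) s).1
      (velocity I21 (fun s ↦ lightCurve c p (a * s + b)) s).2 =
      a • ambientVelocity c p (a * s + b) := by
  refine (tangentIncl_mfderiv ?_).trans (hasDerivAt_affine a b s
    (hasDerivAt_lightCurve c p (a * s + b))).deriv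
  exact ((contMDiff_lightCurve c p).comp (contMDiff_affine a b)).mdifferentiableAt (by simp)

/-- In each factor the ambient acceleration is a multiple of the position vector, hence normal to
the sphere or the circle. -/
theorem isGeodesicOn_lightCurve (c : ℕ) (p : STS2) (a b : ℝ) :
    IsGeodesicOn (lorentzMetric c) (fun s ↦ lightCurve c p (a * s + b)) univ := by
  have hγ := (contMDiff_lightCurve c p).comp (contMDiff_affine a b)
  refine ⟨isOpen_univ, ordConnected_univ, univ_nonempty, hγ.contMDiffOn, fun s _ w ↦ ?_⟩
  refine (geodesic_expression_eq contMDiff_spacetimeIncl (ambientForm c) (ambientForm_comm c)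
    (lorentzMetric_eq c) (hγ s) w).trans ?_
  have h1 : (deriv fun r ↦ spacetimeIncl (lightCurve c p (a * r + b))) =
      fun r ↦ a • ambientVelocity c p (a * r + b) :=
    funext fun r ↦ (hasDerivAt_affine a b r (hasDerivAt_lightCurve c p _)).deriv
  have h2 : deriv (deriv fun r ↦ spacetimeIncl (lightCurve c p (a * r + b))) s =
      a • a • (-((flow (a * s + b) p).1.1 : E3), (c : ℝ) • (Complex.I *
        ((c : ℝ) • (Complex.I * (Circle.exp (c * (a * s + b)) : ℂ))))) := by
    rw [h1]
    exact ((hasDerivAt_affine a b s (hasDerivAt_ambientVelocity c p _)).const_smul a).deriv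
  have e3 (z : ℂ) : (c : ℝ) • (Complex.I * ((c : ℝ) • (Complex.I * z))) =
      (-(c : ℝ) ^ 2) • z := by
    simp only [Complex.real_smul]; push_cast
    linear_combination ((c : ℂ) ^ 2 * z) * Complex.I_sq
  have key (v : TangentSpace I21 (lightCurve c p (a * s + b))) :
      ambientForm c (deriv (deriv fun r ↦ spacetimeIncl (lightCurve c p (a * r + b))) s)
        (tangentIncl _ v) = 0 := by
    obtain ⟨e1, e2⟩ := inner_tangentIncl _ v
    generalize tangentIncl _ v = t at *
    change inner ℝ ((flow (a * s + b) p).1.1 : E3) t.1 = 0 at e1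
    change inner ℝ (Circle.exp (c * (a * s + b)) : ℂ) t.2 = 0 at e2
    rw [h2, ambientForm_apply]
    simp only [Prod.smul_fst, Prod.smul_snd, inner_smul_left, inner_neg_left, e3, e1, e2]
    simp
  exact key _

theorem lightCurve_future_null (c : ℕ) (hc : 1 ≤ c) (p : STS2) (a b : ℝ) (ha : 0 < a) (s : ℝ) :
    velocity I21 (fun s ↦ lightCurve c p (a * s + b)) s ∈
      futureNullCone (lorentzMetric c) timeField := by
  rw [mem_futureNullCone_iff c hc]
  refine ⟨a, ha, ?_, ?_⟩
  · rw [tangentIncl_velocity_lightCurve, Prod.smul_fst, norm_smul, ambientVelocity,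
      STS2.norm_snd, Real.norm_of_nonneg ha.le, mul_one]
  · rw [tangentIncl_velocity_lightCurve, Prod.smul_snd, ambientVelocity, smul_smul, mul_comm a]
    rfl

theorem isMaximalNullGeodesic_lightCurve (c : ℕ) (hc : 1 ≤ c) (p : STS2) (a b : ℝ) (ha : 0 < a) :
    IsMaximalNullGeodesic (lorentzMetric c) timeField (fun s ↦ lightCurve c p (a * s + b)) univ :=
  ⟨isGeodesicOn_lightCurve c p a b, fun s _ ↦ lightCurve_future_null c hc p a b ha s,
    fun _ _ _ h _ ↦ univ_subset_iff.1 h⟩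

/-! ### Solutions of the oscillator equations. -/

section ODE

variable {A : Type*} [NormedAddCommGroup A] [NormedSpace ℝ A] {J : Set ℝ}

theorem is_const_on_of_hasDerivAt_zero (hJ : J.OrdConnected) {f : ℝ → A}
    (hf : ∀ s ∈ J, HasDerivAt f 0 s) {s t : ℝ} (hs : s ∈ J) (ht : t ∈ J) : f s = f t := by
  have h := hJ.convex.norm_image_sub_le_of_norm_hasDerivWithin_le (C := 0)
    (fun r hr ↦ (hf r hr).hasDerivWithinAt) (fun r _ ↦ by simp) ht hs
  rw [zero_mul] at h
  exact sub_eq_zero.1 (norm_le_zero_iff.1 h)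

/-- Rotating (f, f'/a) back by the angle a(s - s₀) gives two quantities with zero derivative.
Solving for f from their constant values gives the formula. -/
theorem harmonic_oscillator (hJ : J.OrdConnected) {f f' : ℝ → A} {a : ℝ} (ha : a ≠ 0)
    (hf : ∀ s ∈ J, HasDerivAt f (f' s) s) (hf' : ∀ s ∈ J, HasDerivAt f' (-(a ^ 2) • f s) s)
    {s s₀ : ℝ} (hs : s ∈ J) (hs₀ : s₀ ∈ J) :
    f s = Real.cos (a * (s - s₀)) • f s₀ + Real.sin (a * (s - s₀)) • a⁻¹ • f' s₀ := by
  have hcos (s : ℝ) : HasDerivAt (fun s ↦ Real.cos (a * (s - s₀)))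
      (-Real.sin (a * (s - s₀)) * a) s := by
    simpa using (((hasDerivAt_id s).sub_const s₀).const_mul a).cos
  have hsin (s : ℝ) : HasDerivAt (fun s ↦ Real.sin (a * (s - s₀)))
      (Real.cos (a * (s - s₀)) * a) s := by
    simpa using (((hasDerivAt_id s).sub_const s₀).const_mul a).sin
  have hA : Real.cos (a * (s - s₀)) • f s - (Real.sin (a * (s - s₀)) * a⁻¹) • f' s = f s₀ := by
    have := is_const_on_of_hasDerivAt_zero (f := fun s ↦ Real.cos (a * (s - s₀)) • f s -
      (Real.sin (a * (s - s₀)) * a⁻¹) • f' s) hJ (fun r hr ↦ ?_) hs hs₀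
    · simpa using this
    · convert! ((hcos r).smul (hf r hr)).sub (((hsin r).mul_const a⁻¹).smul (hf' r hr)) using 1
      rw [mul_assoc _ a, mul_inv_cancel₀ ha, smul_smul]
      have : Real.sin (a * (r - s₀)) * a⁻¹ * -(a ^ 2) = -Real.sin (a * (r - s₀)) * a := by
        field_simp
      rw [this]
      module
  have hB : Real.sin (a * (s - s₀)) • f s + (Real.cos (a * (s - s₀)) * a⁻¹) • f' s =
      a⁻¹ • f' s₀ := by
    have := is_const_on_of_hasDerivAt_zero (f := fun s ↦ Real.sin (a * (s - s₀)) • f s +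
      (Real.cos (a * (s - s₀)) * a⁻¹) • f' s) hJ (fun r hr ↦ ?_) hs hs₀
    · simpa using this
    · convert! ((hsin r).smul (hf r hr)).add (((hcos r).mul_const a⁻¹).smul (hf' r hr)) using 1
      rw [mul_assoc _ a, mul_inv_cancel₀ ha, smul_smul]
      have : Real.cos (a * (r - s₀)) * a⁻¹ * -(a ^ 2) = -(Real.cos (a * (r - s₀)) * a) := by
        field_simp
      rw [this]
      module
  rw [← hA, ← hB]
  calc f s = (Real.sin (a * (s - s₀)) ^ 2 + Real.cos (a * (s - s₀)) ^ 2) • f s := by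
        rw [Real.sin_sq_add_cos_sq, one_smul]
    _ = _ := by module

/-- The integrating factor e^{-ik(s - s₀)} makes the product constant. -/
theorem circle_oscillator (hJ : J.OrdConnected) {f : ℝ → ℂ} {k : ℝ}
    (hf : ∀ s ∈ J, HasDerivAt f (k • (Complex.I * f s)) s) {s s₀ : ℝ} (hs : s ∈ J)
    (hs₀ : s₀ ∈ J) : f s = (Circle.exp (k * (s - s₀)) : ℂ) * f s₀ := by
  have hE (s : ℝ) : HasDerivAt (fun s : ℝ ↦ Complex.exp (-(k * (s - s₀)) * Complex.I))
      (Complex.exp (-(k * (s - s₀)) * Complex.I) * (-(k * 1) * Complex.I)) s :=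
    ((((hasDerivAt_id s).ofReal_comp.sub_const (s₀ : ℂ)).const_mul (k : ℂ)).neg.mul_const
      Complex.I).cexp
  have h := is_const_on_of_hasDerivAt_zero
    (f := fun s : ℝ ↦ Complex.exp (-(k * (s - s₀)) * Complex.I) * f s) hJ
    (fun r hr ↦ by
      convert! (hE r).mul (hf r hr) using 1
      rw [Complex.real_smul]; ring) hs hs₀
  simp only [sub_self, mul_zero, neg_zero, zero_mul, Complex.exp_zero, one_mul] at h
  rw [← h, Circle.coe_exp, ← mul_assoc, ← Complex.exp_add]
  push_cast
  rw [neg_mul, add_neg_cancel, Complex.exp_zero, one_mul]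

end ODE

/-- A future null geodesic is an affinely parametrized light curve. -/
theorem exists_eq_lightCurve (c : ℕ) (hc : 1 ≤ c) {γ : ℝ → S2 × Circle} {J : Set ℝ}
    (hγ : IsGeodesicOn (lorentzMetric c) γ J)
    (hn : ∀ s ∈ J, velocity I21 γ s ∈ futureNullCone (lorentzMetric c) timeField) :
    ∃ (p : STS2) (a b : ℝ), 0 < a ∧ ∀ s ∈ J, γ s = lightCurve c p (a * s + b) := by
  obtain ⟨hJo, hJc, ⟨s₀, hs₀⟩, hsm, hgeo⟩ := hγ
  have hc' : (0 : ℝ) < c := by positivity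
  have hγs (s : ℝ) (hs : s ∈ J) : ContMDiffAt 𝓘(ℝ, ℝ) I21 ∞ γ s :=
    hsm.contMDiffAt (hJo.mem_nhds hs)
  set X : ℝ → E3 := fun s ↦ ((γ s).1 : E3) with hX
  set Z : ℝ → ℂ := fun s ↦ ((γ s).2 : ℂ) with hZ
  have hXs (s : ℝ) (hs : s ∈ J) : ContDiffAt ℝ ∞ X s := by
    rw [← contMDiffAt_iff_contDiffAt]
    exact ContMDiffAt.comp (I' := 𝓡 2) (f := fun s ↦ (γ s).1) s
      (contMDiff_coe_sphere.contMDiffAt) (contMDiff_fst.contMDiffAt.comp s (hγs s hs))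
  have hZs (s : ℝ) (hs : s ∈ J) : ContDiffAt ℝ ∞ Z s := by
    rw [← contMDiffAt_iff_contDiffAt]
    exact ContMDiffAt.comp (I' := 𝓡 1) (f := fun s ↦ (γ s).2) s
      (contMDiff_coe_circle.contMDiffAt) (contMDiff_snd.contMDiffAt.comp s (hγs s hs))
  have dX (s : ℝ) (hs : s ∈ J) : HasDerivAt X (deriv X s) s :=
    ((hXs s hs).differentiableAt (by simp)).hasDerivAt
  have dZ (s : ℝ) (hs : s ∈ J) : HasDerivAt Z (deriv Z s) s :=
    ((hZs s hs).differentiableAt (by simp)).hasDerivAt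
  have dX2 (s : ℝ) (hs : s ∈ J) : HasDerivAt (deriv X) (deriv (deriv X) s) s :=
    ((contDiffAt_deriv (hXs s hs)).differentiableAt (by simp)).hasDerivAt
  have dZ2 (s : ℝ) (hs : s ∈ J) : HasDerivAt (deriv Z) (deriv (deriv Z) s) s :=
    ((contDiffAt_deriv (hZs s hs)).differentiableAt (by simp)).hasDerivAt
  have dσ (s : ℝ) (hs : s ∈ J) : deriv (fun r ↦ spacetimeIncl (γ r)) s = (deriv X s, deriv Z s) :=
    ((dX s hs).prodMk (dZ s hs)).deriv
  have dσ2 (s : ℝ) (hs : s ∈ J) : deriv (deriv fun r ↦ spacetimeIncl (γ r)) s =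
      (deriv (deriv X) s, deriv (deriv Z) s) := by
    rw [Filter.EventuallyEq.deriv_eq (f := fun r ↦ (deriv X r, deriv Z r)) (by
      filter_upwards [hJo.mem_nhds hs] with r hr using dσ r hr)]
    exact ((dX2 s hs).prodMk (dZ2 s hs)).deriv
  -- the velocity
  have hvel (s : ℝ) (hs : s ∈ J) : ∃ r : ℝ, 0 < r ∧ ‖deriv X s‖ = r ∧
      deriv Z s = (c * r) • (Complex.I * Z s) := by
    have h := (mem_futureNullCone_iff c hc _).1 (hn s hs)
    have e := tangentIncl_mfderiv ((hγs s hs).mdifferentiableAt (by simp))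
    rw [dσ s hs] at e
    obtain ⟨r, hr, h1, h2⟩ := h
    exact ⟨r, hr, (congrArg (fun t ↦ ‖t.1‖) e).symm.trans h1, (congrArg Prod.snd e).symm.trans h2⟩
  have hXX (s : ℝ) : inner ℝ (X s) (X s) = 1 := by
    rw [real_inner_self_eq_norm_sq, hX, norm_eq_of_mem_sphere, one_pow]
  have hXX' (s : ℝ) (hs : s ∈ J) : inner ℝ (X s) (deriv X s) = 0 := by
    have h := (dX s hs).inner ℝ (dX s hs)
    simp only [hXX] at h
    have := h.unique (hasDerivAt_const s 1)
    rw [real_inner_comm (X s)] at this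
    linarith
  -- the geodesic equation
  have hperp (s : ℝ) (hs : s ∈ J) (a : E3) (ha : inner ℝ (X s) a = 0) :
      inner ℝ (deriv (deriv X) s) a = 0 := by
    obtain ⟨v, hv⟩ := (mem_range_tangentIncl (γ s) a 0).2 ⟨ha, inner_zero_right _⟩
    obtain ⟨w, hw⟩ := (isInvertible_mfderivWithin_extChartAt_symm (I := I21) (x := γ s)
      (mem_extChartAt_target (γ s))).bijective.surjective v
    have h := hgeo s hs w
    rw [geodesic_expression_eq contMDiff_spacetimeIncl (ambientForm c) (ambientForm_comm c)
      (lorentzMetric_eq c) (hγs s hs) w, hw] at h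
    change ambientForm c _ (tangentIncl (γ s) v) = 0 at h
    rw [hv, dσ2 s hs, ambientForm_apply] at h
    simpa using h
  have hnorm (s : ℝ) (hs : s ∈ J) : ‖deriv X s‖ = ‖deriv X s₀‖ := by
    have : inner ℝ (deriv X s) (deriv X s) = inner ℝ (deriv X s₀) (deriv X s₀) := by
      refine is_const_on_of_hasDerivAt_zero (f := fun s ↦ inner ℝ (deriv X s) (deriv X s)) hJc
        (fun r hr ↦ ?_) hs hs₀
      have h := (dX2 r hr).inner ℝ (dX2 r hr)
      have e := hperp r hr _ (hXX' r hr)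
      rwa [real_inner_comm, e, add_zero] at h
    rwa [real_inner_self_eq_norm_sq, real_inner_self_eq_norm_sq,
      sq_eq_sq₀ (norm_nonneg _) (norm_nonneg _)] at this
  set a := ‖deriv X s₀‖ with ha
  have ha0 : 0 < a := by
    obtain ⟨r, hr, h, -⟩ := hvel s₀ hs₀
    rw [ha, h]; exact hr
  -- Nullity ties the angular speed to the spatial speed, which is constant. The circle component
  -- thus satisfies a first-order equation, and its acceleration is never needed.
  have hZ' (s : ℝ) (hs : s ∈ J) : deriv Z s = (c * a) • (Complex.I * Z s) := by
    obtain ⟨r, hr, h, h'⟩ := hvel s hs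
    rw [h', ← h, hnorm s hs]
  -- Differentiating ⟨X, X'⟩ = 0 gives the radial part of X''. Then X'' + a²X is tangent, so it is
  -- orthogonal both to X and to X'', hence to itself.
  have hX'' (s : ℝ) (hs : s ∈ J) : deriv (deriv X) s = -(a ^ 2) • X s := by
    have h1 : inner ℝ (X s) (deriv (deriv X) s) = -(a ^ 2) := by
      have h := (dX s hs).inner ℝ (dX2 s hs)
      have h0 : (fun r ↦ inner ℝ (X r) (deriv X r)) =ᶠ[nhds s] fun _ ↦ 0 := by
        filter_upwards [hJo.mem_nhds hs] with r hr using hXX' r hr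
      have := h.unique ((hasDerivAt_const s (0 : ℝ)).congr_of_eventuallyEq h0)
      rw [real_inner_self_eq_norm_sq, hnorm s hs] at this
      linarith
    have h2 : inner ℝ (X s) (deriv (deriv X) s + (a ^ 2) • X s) = 0 := by
      rw [inner_add_right, inner_smul_right, hXX, h1]; ring
    have h3 : inner ℝ (deriv (deriv X) s + (a ^ 2) • X s)
        (deriv (deriv X) s + (a ^ 2) • X s) = 0 := by
      rw [inner_add_left, inner_smul_left, h2, hperp s hs _ h2]; simp
    rw [neg_smul]
    exact eq_neg_of_add_eq_zero_left (inner_self_eq_zero.1 h3)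
  -- integration
  let p₀ : STS2 := STS2.mk (X s₀) (a⁻¹ • deriv X s₀) (norm_eq_of_mem_sphere _)
    (by rw [norm_smul, norm_inv, norm_norm, ← ha, inv_mul_cancel₀ ha0.ne'])
    (by rw [inner_smul_right, hXX' s₀ hs₀, mul_zero])
  have hsolX (s : ℝ) (hs : s ∈ J) : X s = ((flow (a * (s - s₀)) p₀).1.1 : E3) :=
    harmonic_oscillator hJc ha0.ne' dX (fun s hs ↦ by rw [← hX'' s hs]; exact dX2 s hs) hs hs₀
  have hsolZ (s : ℝ) (hs : s ∈ J) : Z s = (Circle.exp (c * a * (s - s₀)) : ℂ) * Z s₀ :=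
    circle_oscillator hJc (fun s hs ↦ by rw [← hZ' s hs]; exact dZ s hs) hs hs₀
  obtain ⟨θ, hθ⟩ := Circle.exp_surjective (γ s₀).2
  -- The shift makes the parameter equal to θ/c at `s₀`, so the circle component starts at e^{iθ}.
  -- Flowing `p₀` back by θ/c compensates on the sphere.
  refine ⟨flow (-(θ / c)) p₀, a, θ / c - a * s₀, ha0, fun s hs ↦ Prod.ext (Subtype.ext ?_)
    (Circle.ext ?_)⟩
  · refine (hsolX s hs).trans ?_
    rw [lightCurve, flow_flow]
    congr 4
    ring
  · refine (hsolZ s hs).trans ?_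
    rw [hZ]
    simp only [lightCurve]
    rw [← hθ, ← Circle.coe_mul, ← Circle.exp_add]
    congr 2
    field_simp
    ring

/-! ### The space of null geodesics as a set -/

theorem lightCurve_flow (c : ℕ) (p : STS2) (t s : ℝ) (k : ℤ) (ht : c * t = k * (2 * Real.pi)) :
    lightCurve c (flow t p) s = lightCurve c p (s + t) := by
  refine Prod.ext ?_ ?_
  · simp only [lightCurve, flow_flow]
  · simp only [lightCurve, mul_add, ht]
    exact (Circle.exp_eq_exp.2 ⟨k, rfl⟩).symm

/-- The positions at times s and t are linear combinations of x and u with determinant sin(t - s),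
so they determine both vectors. -/
theorem eq_of_flow_fst_eq {p p' : STS2} {s t : ℝ} (hst : Real.sin (t - s) ≠ 0)
    (hs : ((flow s p).1.1 : E3) = (flow s p').1.1) (ht : ((flow t p).1.1 : E3) = (flow t p').1.1) :
    p = p' := by
  have e1 (q : STS2) : Real.sin (t - s) • (q.1.1 : E3) =
      Real.sin t • ((flow s q).1.1 : E3) - Real.sin s • ((flow t q).1.1 : E3) := by
    rw [flow_fst, flow_fst, Real.sin_sub]; module
  have e2 (q : STS2) : Real.sin (t - s) • (q.1.2 : E3) =
      Real.cos s • ((flow t q).1.1 : E3) - Real.cos t • ((flow s q).1.1 : E3) := by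
    rw [flow_fst, flow_fst, Real.sin_sub]; module
  apply STS2.ext'
  · apply smul_right_injective E3 hst
    simp only [e1, hs, ht]
  · apply smul_right_injective E3 hst
    simp only [e2, hs, ht]

/-- If the images agree, comparing circle components shows that the position of p at time s is that
of p' at time s + 2πm(s)/c. The integer m(s) could vary with s, but only its class modulo c matters,
so the pigeonhole principle supplies two times with one class, and two non-antipodal points fix the
great circle. -/
theorem greatCircleLift_eq_iff (c : ℕ) (hc : 1 ≤ c) (p p' : STS2) :
    greatCircleLift c p = greatCircleLift c p' ↔ ∃ k : ℤ, flow (k * (2 * Real.pi / c)) p' = p := by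
  have hc' : (c : ℝ) ≠ 0 := by positivity
  rw [greatCircleLift_eq_range, greatCircleLift_eq_range]
  constructor
  · intro h
    have hm (s : ℝ) : ∃ m : ℤ,
        ((flow s p).1.1 : E3) = (flow (s + m * (2 * Real.pi / c)) p').1.1 := by
      obtain ⟨t, ht⟩ : lightCurve c p s ∈ range (lightCurve c p') := h ▸ mem_range_self s
      obtain ⟨m, hm⟩ := Circle.exp_eq_exp.1 (congrArg Prod.snd ht)
      refine ⟨m, ?_⟩
      have e : s + m * (2 * Real.pi / c) = t := by
        field_simp
        linarith
      rw [e]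
      exact (congrArg (fun q : S2 × Circle ↦ (q.1 : E3)) ht).symm
    choose m hm using hm
    -- There are finitely many residues modulo c and infinitely many times in (0, 1). Two such times
    -- differ by less than π, so the sine of their difference does not vanish.
    have : NeZero c := ⟨by omega⟩
    have : Infinite (Ioo (0 : ℝ) 1) := (Ioo_infinite one_pos).to_subtype
    obtain ⟨⟨s, hs⟩, ⟨t, ht⟩, hne, heq⟩ := Finite.exists_ne_map_eq_of_infinite
      fun s : Ioo (0 : ℝ) 1 ↦ (m s : ZMod c)
    obtain ⟨l, hl⟩ := (ZMod.intCast_eq_intCast_iff_dvd_sub _ _ _).1 heq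
    simp only at hl hne
    have hst : Real.sin (t - s) ≠ 0 := by
      have h1 : t - s ≠ 0 := fun h ↦ hne (Subtype.ext (by simp only; linarith))
      have hpi := Real.pi_gt_three
      intro h0
      apply h1
      exact (Real.sin_eq_zero_iff_of_lt_of_lt (by linarith [hs.1, hs.2, ht.1, ht.2])
        (by linarith [hs.1, hs.2, ht.1, ht.2])).1 h0
    refine ⟨m s, (eq_of_flow_fst_eq hst ?_ ?_).symm⟩
    · rw [hm s, flow_flow]
    -- Changing the shift count by a multiple of c changes the time by full periods 2π of the flow.
    · have e : (m t : ℝ) = m s + c * l := by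
        have : m t = m s + c * l := by linarith
        exact_mod_cast this
      rw [hm t, flow_flow, e, show t + ((m s : ℝ) + c * l) * (2 * Real.pi / c) =
        t + m s * (2 * Real.pi / c) + l * (2 * Real.pi) by field_simp; ring,
        flow_add_int_mul_two_pi]
  · rintro ⟨k, rfl⟩
    have e (s : ℝ) : lightCurve c (flow (k * (2 * Real.pi / c)) p') s =
        lightCurve c p' (s + k * (2 * Real.pi / c)) := by
      refine lightCurve_flow c p' _ s k ?_
      field_simp
    ext q
    constructor
    · rintro ⟨s, rfl⟩
      exact ⟨_, (e s).symm⟩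
    · rintro ⟨s, rfl⟩
      exact ⟨s - k * (2 * Real.pi / c), by rw [e, sub_add_cancel]⟩

theorem range_lightCurve_affine (c : ℕ) (p : STS2) (a b : ℝ) (ha : 0 < a) :
    (fun s ↦ lightCurve c p (a * s + b)) '' univ = greatCircleLift c p := by
  rw [greatCircleLift_eq_range, image_univ]
  ext q
  constructor
  · rintro ⟨s, rfl⟩
    exact ⟨_, rfl⟩
  · rintro ⟨s, rfl⟩
    exact ⟨(s - b) / a, by simp only; rw [mul_div_cancel₀ _ ha.ne', sub_add_cancel]⟩

/-- The null geodesic `γ_{(x,u)}`. -/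
def lightRay (c : ℕ) (hc : 1 ≤ c) (p : STS2) : NullGeod c :=
  ⟨greatCircleLift c p, _, univ, isMaximalNullGeodesic_lightCurve c hc p 1 0 one_pos,
    (range_lightCurve_affine c p 1 0 one_pos).symm⟩

/-- A maximal future null geodesic is a light curve. -/
theorem exists_eq_lightCurve_of_maximal (c : ℕ) (hc : 1 ≤ c) {γ : ℝ → S2 × Circle} {J : Set ℝ}
    (h : IsMaximalNullGeodesic (lorentzMetric c) timeField γ J) :
    ∃ (p : STS2) (a b : ℝ), 0 < a ∧ J = univ ∧ γ = fun s ↦ lightCurve c p (a * s + b) := by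
  obtain ⟨p, a, b, ha, hγ⟩ := exists_eq_lightCurve c hc h.geodesic h.future_null
  -- The light curve is a geodesic on all of ℝ extending γ, so maximality forces the domain to be ℝ.
  have hJ := h.maximal _ univ (isGeodesicOn_lightCurve c p a b) (subset_univ _) hγ
  refine ⟨p, a, b, ha, hJ.symm, ?_⟩
  ext1 s
  exact hγ s (hJ ▸ mem_univ s)

theorem lightRay_surjective (c : ℕ) (hc : 1 ≤ c) : Function.Surjective (lightRay c hc) := by
  rintro ⟨S, γ, J, h, hS⟩
  obtain ⟨p, a, b, ha, rfl, rfl⟩ := exists_eq_lightCurve_of_maximal c hc h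
  exact ⟨p, Subtype.ext ((range_lightCurve_affine c p a b ha).symm.trans hS.symm)⟩

theorem lightRay_eq_iff (c : ℕ) (hc : 1 ≤ c) (p p' : STS2) :
    lightRay c hc p = lightRay c hc p' ↔ lensProj c p = lensProj c p' := by
  rw [lensProj_eq_iff c hc, ← greatCircleLift_eq_iff c hc]
  exact Subtype.ext_iff

/-- The bijection `L(2c,1) ≅ 𝒩_c`. -/
def lensEquiv (c : ℕ) (hc : 1 ≤ c) : LensSpace (2 * c) ≃ NullGeod c :=
  Equiv.ofBijective (fun l ↦ lightRay c hc (Function.surjInv (lensProj_surjective c hc) l)) (by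
    constructor
    · intro l l' h
      have := (lightRay_eq_iff c hc _ _).1 h
      rwa [Function.surjInv_eq (lensProj_surjective c hc),
        Function.surjInv_eq (lensProj_surjective c hc)] at this
    · intro n
      obtain ⟨p, rfl⟩ := lightRay_surjective c hc n
      exact ⟨lensProj c p, (lightRay_eq_iff c hc _ _).2
        (Function.surjInv_eq (lensProj_surjective c hc) _)⟩)

theorem lensEquiv_lensProj (c : ℕ) (hc : 1 ≤ c) (p : STS2) :
    lensEquiv c hc (lensProj c p) = lightRay c hc p :=
  (lightRay_eq_iff c hc _ _).2 (Function.surjInv_eq (lensProj_surjective c hc) _)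

/-! ### Future null vectors and the null geodesics tangent to them -/

/-- The vector `v` is `a` times the velocity at time `s` of the light curve of `p`. -/
structure IsLightVector (c : ℕ) (v : TangentBundle I21 (S2 × Circle)) (p : STS2) (a s : ℝ) :
    Prop where
  pos : 0 < a
  base : v.1 = lightCurve c p s
  vector : tangentIncl v.1 v.2 = a • ambientVelocity c p s

theorem isLightVector_velocity (c : ℕ) (p : STS2) (a b s : ℝ) (ha : 0 < a) :
    IsLightVector c (velocity I21 (fun s ↦ lightCurve c p (a * s + b)) s) p a (a * s + b) :=
  ⟨ha, rfl, tangentIncl_velocity_lightCurve c p a b s⟩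

theorem IsLightVector.eq_velocity {c : ℕ} {v : TangentBundle I21 (S2 × Circle)} {p : STS2}
    {a s : ℝ} (h : IsLightVector c v p a s) :
    v = velocity I21 (fun τ ↦ lightCurve c p (a * τ + s)) 0 := by
  have h' := isLightVector_velocity c p a s 0 h.pos
  rw [mul_zero, zero_add] at h'
  exact tangentBundle_ext (h.base.trans h'.base.symm) (h.vector.trans h'.vector.symm)

theorem IsLightVector.mem_futureNullCone {c : ℕ} (hc : 1 ≤ c)
    {v : TangentBundle I21 (S2 × Circle)} {p : STS2} {a s : ℝ} (h : IsLightVector c v p a s) :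
    v ∈ futureNullCone (lorentzMetric c) timeField := by
  rw [h.eq_velocity]
  exact lightCurve_future_null c hc p a s h.pos 0

theorem IsLightVector.isTangentTo {c : ℕ} (hc : 1 ≤ c) {v : TangentBundle I21 (S2 × Circle)}
    {p : STS2} {a s : ℝ} (h : IsLightVector c v p a s) : IsTangentTo v (lightRay c hc p) :=
  ⟨_, univ, isMaximalNullGeodesic_lightCurve c hc p a s h.pos,
    (range_lightCurve_affine c p a s h.pos).symm, 0, mem_univ _, h.eq_velocity.symm⟩

theorem exists_isLightVector_of_isTangentTo (c : ℕ) (hc : 1 ≤ c)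
    {v : TangentBundle I21 (S2 × Circle)} {n : NullGeod c} (h : IsTangentTo v n) :
    ∃ p a s, IsLightVector c v p a s ∧ n = lightRay c hc p := by
  obtain ⟨γ, J, hγ, hn, s, -, rfl⟩ := h
  obtain ⟨p, a, b, ha, rfl, rfl⟩ := exists_eq_lightCurve_of_maximal c hc hγ
  exact ⟨p, a, _, isLightVector_velocity c p a b s ha,
    Subtype.ext (hn.trans (range_lightCurve_affine c p a b ha))⟩

/-- The point `(x, ẋ/|ẋ|)` of `ST S²` defined by a tangent vector of `S² × S¹` with spatial part
`ẋ ≠ 0`. -/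
def direction (p₀ : STS2) (v : TangentBundle I21 (S2 × Circle)) : STS2 :=
  open Classical in
  if h : (tangentIncl v.1 v.2).1 ≠ 0 then
    STS2.mk v.1.1 (‖(tangentIncl v.1 v.2).1‖⁻¹ • (tangentIncl v.1 v.2).1)
      (norm_eq_of_mem_sphere _)
      (by rw [norm_smul, norm_inv, norm_norm, inv_mul_cancel₀ (norm_ne_zero_iff.2 h)])
      (by rw [inner_smul_right, (inner_tangentIncl v.1 v.2).1, mul_zero])
  else p₀

theorem incl_direction (p₀ : STS2) {v : TangentBundle I21 (S2 × Circle)}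
    (h : (tangentIncl v.1 v.2).1 ≠ 0) : (direction p₀ v).incl =
      ((v.1.1 : E3), ‖(tangentIncl v.1 v.2).1‖⁻¹ • (tangentIncl v.1 v.2).1) := by
  rw [direction, dif_pos h]; rfl

theorem IsLightVector.fst_ne_zero {c : ℕ} {v : TangentBundle I21 (S2 × Circle)} {p : STS2}
    {a s : ℝ} (h : IsLightVector c v p a s) : (tangentIncl v.1 v.2).1 ≠ 0 := by
  rw [h.vector, ← norm_ne_zero_iff, Prod.smul_fst, norm_smul, ambientVelocity, STS2.norm_snd,
    mul_one, norm_ne_zero_iff]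
  exact h.pos.ne'

theorem IsLightVector.direction_eq {c : ℕ} {v : TangentBundle I21 (S2 × Circle)} {p p₀ : STS2}
    {a s : ℝ} (h : IsLightVector c v p a s) : direction p₀ v = flow s p := by
  apply STS2.incl_injective
  rw [incl_direction p₀ h.fst_ne_zero, h.vector, h.base, Prod.smul_fst, norm_smul, ambientVelocity,
    STS2.norm_snd, mul_one, Real.norm_of_nonneg h.pos.le, smul_smul, inv_mul_cancel₀ h.pos.ne',
    one_smul]
  rfl

/-- Every future null vector is tangent to a light curve. -/
theorem exists_isLightVector (c : ℕ) (hc : 1 ≤ c) {v : TangentBundle I21 (S2 × Circle)}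
    (p₀ : STS2) (hv : v ∈ futureNullCone (lorentzMetric c) timeField) {θ : ℝ}
    (hθ : Circle.exp θ = v.1.2) :
    ∃ a, IsLightVector c v (flow (-(θ / c)) (direction p₀ v)) a (θ / c) := by
  have hc' : (c : ℝ) ≠ 0 := by positivity
  obtain ⟨r, hr, h1, h2⟩ := (mem_futureNullCone_iff c hc v).1 hv
  have hne : (tangentIncl v.1 v.2).1 ≠ 0 := by rw [← norm_ne_zero_iff, h1]; exact hr.ne'
  have hd := incl_direction p₀ hne
  have e : c * (θ / c) = θ := by field_simp
  refine ⟨r, hr, Prod.ext (Subtype.ext ?_) ?_, Prod.ext ?_ ?_⟩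
  · rw [lightCurve, flow_flow_neg]
    exact (congrArg Prod.fst hd).symm
  · rw [lightCurve, e, hθ]
  · have h3 : ((direction p₀ v).1.2 : E3) = _ := congrArg Prod.snd hd
    rw [Prod.smul_fst, ambientVelocity, flow_flow_neg, h3, h1, smul_smul, mul_inv_cancel₀ hr.ne',
      one_smul]
  · rw [Prod.smul_snd, ambientVelocity, e, h2, hθ, smul_smul, mul_comm r]

/-- The point of the lens space defined by a tangent vector of `S² × S¹`. -/
def vectorToLens (c : ℕ) (p₀ : STS2) (v : TangentBundle I21 (S2 × Circle)) : LensSpace (2 * c) :=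
  lensProj c (flow (-(Complex.arg v.1.2 / c)) (direction p₀ v))

/-- Changing the angle by 2π changes the flow time by 2π/c, which the lens space does not see. So
the jump of `Complex.arg` is invisible and any branch may be used. -/
theorem vectorToLens_eq (c : ℕ) (hc : 1 ≤ c) (p₀ : STS2) (v : TangentBundle I21 (S2 × Circle))
    {θ : ℝ} (hθ : Circle.exp θ = v.1.2) :
    vectorToLens c p₀ v = lensProj c (flow (-(θ / c)) (direction p₀ v)) := by
  have hc' : (c : ℝ) ≠ 0 := by positivity
  obtain ⟨k, hk⟩ := Circle.exp_eq_exp.1 (hθ.trans (Circle.exp_arg v.1.2).symm)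
  refine (lensProj_eq_iff c hc _ _).2 ⟨k, ?_⟩
  rw [flow_flow]
  congr 1
  field_simp
  linarith

theorem IsLightVector.vectorToLens_eq {c : ℕ} (hc : 1 ≤ c) {v : TangentBundle I21 (S2 × Circle)}
    {p p₀ : STS2} {a s : ℝ} (h : IsLightVector c v p a s) :
    vectorToLens c p₀ v = lensProj c p := by
  have hc' : (c : ℝ) ≠ 0 := by positivity
  rw [NullGeodesics.vectorToLens_eq c hc p₀ v (θ := c * s) (by rw [h.base]; rfl), h.direction_eq,
    mul_div_cancel_left₀ _ hc', flow_neg_flow]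

theorem isTangentTo_lensEquiv (c : ℕ) (hc : 1 ≤ c) (p₀ : STS2)
    {v : TangentBundle I21 (S2 × Circle)}
    (hv : v ∈ futureNullCone (lorentzMetric c) timeField) :
    IsTangentTo v (lensEquiv c hc (vectorToLens c p₀ v)) := by
  obtain ⟨a, h⟩ := exists_isLightVector c hc p₀ hv (Circle.exp_arg v.1.2)
  rw [h.vectorToLens_eq hc, lensEquiv_lensProj]
  exact h.isTangentTo hc

/-- Only one null geodesic is tangent to a given vector. Every admissible projection C⁺ → 𝒩_c
therefore has this formula, which is what makes the smooth structure unique. -/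
theorem eq_lensEquiv_of_isTangentTo (c : ℕ) (hc : 1 ≤ c) (p₀ : STS2)
    {v : TangentBundle I21 (S2 × Circle)} {n : NullGeod c} (h : IsTangentTo v n) :
    n = lensEquiv c hc (vectorToLens c p₀ v) := by
  obtain ⟨p, a, s, hv, rfl⟩ := exists_isLightVector_of_isTangentTo c hc h
  rw [hv.vectorToLens_eq hc, lensEquiv_lensProj]

/-! ### The smooth structure of the space of null geodesics -/

theorem contMDiff_tangentBundle_base : ContMDiff (I21).tangent I21 ∞
    (fun v : TangentBundle I21 (S2 × Circle) ↦ v.1) :=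
  Bundle.contMDiff_proj (TangentSpace I21)

theorem contMDiff_tangentIncl : ContMDiff (I21).tangent 𝓘(ℝ, E3 × ℂ) ∞
    (fun v : TangentBundle I21 (S2 × Circle) ↦ tangentIncl v.1 v.2) := by
  have h1 : ContMDiff (I21).tangent 𝓘(ℝ, E3 × ℂ).tangent ∞
      (tangentMap I21 𝓘(ℝ, E3 × ℂ) spacetimeIncl) :=
    contMDiff_spacetimeIncl.contMDiff_tangentMap le_rfl
  exact (contMDiff_snd_tangentBundle_modelSpace (E3 × ℂ) 𝓘(ℝ, E3 × ℂ)).comp h1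

theorem contMDiffAt_direction (p₀ : STS2) {v : TangentBundle I21 (S2 × Circle)}
    (hv : (tangentIncl v.1 v.2).1 ≠ 0) :
    ContMDiffAt (I21).tangent (𝓡 3) ∞ (direction p₀) v := by
  have h1 : ContMDiffAt (I21).tangent 𝓘(ℝ, E3) ∞
      (fun v : TangentBundle I21 (S2 × Circle) ↦ (tangentIncl v.1 v.2).1) v :=
    contDiff_fst.contMDiff.contMDiffAt.comp v (contMDiff_tangentIncl v)
  have h2 : ContDiffAt ℝ ∞ (fun a : E3 ↦ ‖a‖⁻¹ • a) (tangentIncl v.1 v.2).1 :=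
    ((contDiffAt_norm ℝ hv).inv (norm_ne_zero_iff.2 hv)).smul contDiffAt_id
  have h3 : ContMDiffAt (I21).tangent 𝓘(ℝ, E3) ∞ (fun v : TangentBundle I21 (S2 × Circle) ↦
      ‖(tangentIncl v.1 v.2).1‖⁻¹ • (tangentIncl v.1 v.2).1) v :=
    ContMDiffAt.comp (I' := 𝓘(ℝ, E3))
      (f := fun v : TangentBundle I21 (S2 × Circle) ↦ (tangentIncl v.1 v.2).1) v h2.contMDiffAt h1
  have h4 : ContMDiffAt (I21).tangent 𝓘(ℝ, E3) ∞
      (fun v : TangentBundle I21 (S2 × Circle) ↦ (v.1.1 : E3)) v :=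
    ContMDiffAt.comp (I' := 𝓡 2) (f := fun v : TangentBundle I21 (S2 × Circle) ↦ v.1.1) v
      contMDiff_coe_sphere.contMDiffAt
      (contMDiff_fst.contMDiffAt.comp v (contMDiff_tangentBundle_base v))
  apply contMDiffAt_STS2
  refine (h4.prodMk_space h3).congr_of_eventuallyEq ?_
  filter_upwards [h1.continuousAt.eventually_ne hv] with w hw
  exact incl_direction p₀ hw

/-- A branch of the angle, smooth near `e^{iθ₀}`. -/
def angleNear (θ₀ : ℝ) (z : Circle) : ℝ := θ₀ + Complex.arg ((Circle.exp θ₀)⁻¹ * z : Circle)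

theorem exp_angleNear (θ₀ : ℝ) (z : Circle) : Circle.exp (angleNear θ₀ z) = z := by
  rw [angleNear, Circle.exp_add, Circle.exp_arg, mul_inv_cancel_left]

/-- Rotating e^{iθ₀} to 1 moves the point away from the branch cut of the logarithm. -/
theorem contMDiffAt_angleNear (θ₀ : ℝ) :
    ContMDiffAt (𝓡 1) 𝓘(ℝ, ℝ) ∞ (angleNear θ₀) (Circle.exp θ₀) := by
  have h1 : ContMDiff (𝓡 1) 𝓘(ℝ, ℂ) ∞ (fun z : Circle ↦ (((Circle.exp θ₀)⁻¹ * z : Circle) : ℂ)) :=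
    contMDiff_coe_circle.comp (contMDiff_const.mul contMDiff_id)
  have h2 : ContDiffAt ℝ ∞ (fun z : ℂ ↦ θ₀ + (Complex.log z).im)
      (((Circle.exp θ₀)⁻¹ * Circle.exp θ₀ : Circle) : ℂ) := by
    rw [inv_mul_cancel, Circle.coe_one]
    exact contDiffAt_const.add (Complex.imCLM.contDiff.contDiffAt.comp _
      ((Complex.contDiffAt_log (by simp)).restrict_scalars ℝ))
  refine (ContMDiffAt.comp (I' := 𝓘(ℝ, ℂ))
    (f := fun z : Circle ↦ (((Circle.exp θ₀)⁻¹ * z : Circle) : ℂ)) _ h2.contMDiffAt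
    (h1 _)).congr_of_eventuallyEq (.of_forall fun z ↦ ?_)
  simp only [angleNear, Function.comp_apply, Complex.log_im]

theorem contMDiffAt_vectorToLens (c : ℕ) (hc : 1 ≤ c) (p₀ : STS2)
    {v : TangentBundle I21 (S2 × Circle)} (hv : (tangentIncl v.1 v.2).1 ≠ 0) :
    ContMDiffAt (I21).tangent (𝓡 3) ∞ (vectorToLens c p₀) v := by
  obtain ⟨θ₀, hθ₀⟩ := Circle.exp_surjective v.1.2
  have h1 : ContMDiffAt (I21).tangent 𝓘(ℝ, ℝ) ∞
      (fun v : TangentBundle I21 (S2 × Circle) ↦ angleNear θ₀ v.1.2) v :=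
    ContMDiffAt.comp (I' := 𝓡 1) (f := fun v : TangentBundle I21 (S2 × Circle) ↦ v.1.2) v
      (by rw [← hθ₀]; exact contMDiffAt_angleNear θ₀)
      (contMDiff_snd.contMDiffAt.comp v (contMDiff_tangentBundle_base v))
  have h2 : ContMDiffAt (I21).tangent 𝓘(ℝ, ℝ) ∞
      (fun v : TangentBundle I21 (S2 × Circle) ↦ -(angleNear θ₀ v.1.2 / c)) v :=
    (contDiff_id.div_const (c : ℝ)).neg.contMDiff.contMDiffAt.comp v h1
  have h3 := (isLocalDiffeomorph_lensProj c hc).contMDiff.contMDiffAt.comp v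
    (contMDiffAt_flow h2 (contMDiffAt_direction p₀ hv))
  refine h3.congr_of_eventuallyEq (.of_forall fun w ↦ ?_)
  exact vectorToLens_eq c hc p₀ w (exp_angleNear θ₀ _)

/-- `a` times the velocity at time `s` of the light curve of `p`. -/
def lightVector (c : ℕ) (a s : ℝ) (p : STS2) : TangentBundle I21 (S2 × Circle) :=
  velocity I21 (fun τ ↦ lightCurve c p (a * τ + s)) 0

theorem contMDiff_STS2_base : ContMDiff (𝓡 3) (𝓡 2) ∞ STS2.base := fun p ↦
  contMDiffAt_sphere (contDiff_fst.contMDiff.contMDiffAt.comp p (contMDiff_STS2_incl p))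

/-- The vector is the image of (∂_τ, 0) at (0, p) under the tangent map of (τ, p) ↦ `lightCurve c p
(a * τ + s)`, so smoothness in p follows from joint smoothness of this map. -/
theorem contMDiff_lightVector (c : ℕ) (a s : ℝ) :
    ContMDiff (𝓡 3) (I21).tangent ∞ (lightVector c a s) := by
  let G : ℝ × STS2 → S2 × Circle := fun y ↦ lightCurve c y.2 (a * y.1 + s)
  have ha : ContMDiff (𝓘(ℝ, ℝ).prod (𝓡 3)) 𝓘(ℝ, ℝ) ∞ (fun y : ℝ × STS2 ↦ a * y.1 + s) :=
    (contMDiff_affine a s).comp contMDiff_fst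
  have hG : ContMDiff (𝓘(ℝ, ℝ).prod (𝓡 3)) I21 ∞ G := by
    refine ContMDiff.prodMk (fun y ↦ ?_) ?_
    · exact (contMDiff_STS2_base _).comp y (contMDiffAt_flow (ha y) contMDiff_snd.contMDiffAt)
    · exact contMDiff_circleExp.comp
        ((contDiff_const.mul contDiff_id : ContDiff ℝ ∞ fun r : ℝ ↦ (c : ℝ) * r).contMDiff.comp ha)
  let f0 : STS2 → TangentBundle (𝓡 3) STS2 := Bundle.zeroSection (EuclideanSpace ℝ (Fin 3)) _
  have sf0 : ContMDiff (𝓡 3) (𝓡 3).tangent ∞ f0 := Bundle.contMDiff_zeroSection _ _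
  let f1 : STS2 → TangentBundle 𝓘(ℝ, ℝ) ℝ := fun _ ↦ ⟨0, (1 : ℝ)⟩
  have sf1 : ContMDiff (𝓡 3) 𝓘(ℝ, ℝ).tangent ∞ f1 := contMDiff_const
  have h := ((hG.contMDiff_tangentMap (m := ∞) le_rfl).comp
    (contMDiff_equivTangentBundleProd_symm (I := 𝓘(ℝ, ℝ)) (M := ℝ) (I' := 𝓡 3) (M' := STS2))).comp
      (sf1.prodMk sf0)
  convert! h using 1
  ext1 p
  have e := tangentMap_comp_at (I := 𝓘(ℝ, ℝ)) (I' := 𝓘(ℝ, ℝ).prod (𝓡 3)) (I'' := I21)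
    (f := fun τ : ℝ ↦ (τ, p)) (g := G) ⟨0, (1 : ℝ)⟩
    (hG.mdifferentiableAt (by simp))
    ((contMDiff_id.prodMk contMDiff_const).mdifferentiableAt (n := ∞) (by simp))
  rw [tangentMap_prod_left] at e
  exact e

theorem lightVector_spec (c : ℕ) (a s : ℝ) (ha : 0 < a) (p : STS2) :
    IsLightVector c (lightVector c a s p) p a s := by
  have hv := isLightVector_velocity c p a s 0 ha
  rwa [mul_zero, zero_add] at hv

/-- A point of `ST S²`. -/
def basePoint : STS2 := Phi ⟨EuclideanSpace.single 0 1, by simp⟩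

/-- If the bijection with the lens space is a diffeomorphism, then the space of null geodesics is
the quotient manifold of the bundle of future null vectors. -/
theorem isNullGeodesicManifold_of_diffeo (c : ℕ) (hc : 1 ≤ c) [TopologicalSpace (NullGeod c)]
    [ChartedSpace (EuclideanSpace ℝ (Fin 3)) (NullGeod c)] [IsManifold (𝓡 3) ∞ (NullGeod c)]
    (h1 : ContMDiff (𝓡 3) (𝓡 3) ∞ (lensEquiv c hc))
    (h2 : ContMDiff (𝓡 3) (𝓡 3) ∞ (lensEquiv c hc).symm) :
    IsNullGeodesicManifold (EuclideanSpace ℝ (Fin 3)) (lorentzMetric c) timeField := by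
  let e : LensSpace (2 * c) ≃ₜ NullGeod c := ⟨lensEquiv c hc, h1.continuous, h2.continuous⟩
  have hsc : SecondCountableTopology (LensSpace (2 * c)) :=
    ContinuousConstSMul.secondCountableTopology
  refine ⟨inferInstance, e.symm.isEmbedding.t2Space, e.symm.secondCountableTopology,
    fun v ↦ lensEquiv c hc (vectorToLens c basePoint v), ?_, ?_, ?_⟩
  · exact fun v hv ↦ isTangentTo_lensEquiv c hc basePoint hv
  · intro v hv
    obtain ⟨a, h⟩ := exists_isLightVector c hc basePoint hv (Circle.exp_arg v.1.2)
    exact ((h1 _).comp v (contMDiffAt_vectorToLens c hc basePoint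
      h.fst_ne_zero)).contMDiffWithinAt
  · intro v hv
    obtain ⟨a, h⟩ := exists_isLightVector c hc basePoint hv (Circle.exp_arg v.1.2)
    generalize flow (-(Complex.arg v.1.2 / c)) (direction basePoint v) = p at h
    generalize Complex.arg v.1.2 / c = s at h
    have hL := isLocalDiffeomorph_lensProj c hc p
    simp only [h.vectorToLens_eq hc]
    have hLp : hL.localInverse (lensProj c p) = p :=
      hL.localInverse_left_inv hL.localInverse_mem_target
    -- The section keeps the scale `a` and the time `s` of the given vector and varies only the
    -- point of ST S², through a local inverse of `lensProj c`. It therefore passes through `v`.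
    refine ⟨fun n ↦ lightVector c a s (hL.localInverse ((lensEquiv c hc).symm n)), ?_, ?_, ?_⟩
    · refine (contMDiff_lightVector c a s _).comp _ (ContMDiffAt.comp (I' := 𝓡 3) _ ?_ (h2 _))
      rw [Equiv.symm_apply_apply]
      exact hL.localInverse_contMDiffAt
    · simp only [Equiv.symm_apply_apply, hLp]
      exact h.eq_velocity.symm
    · have hev : ∀ᶠ n in nhds (lensEquiv c hc (lensProj c p)),
          lensProj c (hL.localInverse ((lensEquiv c hc).symm n)) = (lensEquiv c hc).symm n := by
        refine h2.continuous.continuousAt.eventually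
          (p := fun l ↦ lensProj c (hL.localInverse l) = l) ?_
        rw [Equiv.symm_apply_apply]
        exact hL.localInverse_eventuallyEq_right
      filter_upwards [hev] with n hn
      have hs := lightVector_spec c a s h.pos (hL.localInverse ((lensEquiv c hc).symm n))
      refine ⟨hs.mem_futureNullCone hc, ?_⟩
      rw [hs.vectorToLens_eq hc, hn, Equiv.apply_symm_apply]

/-- Topology and atlas are transported from the lens space along the bijection, regarded as a
covering whose only deck transformation is the identity. -/
theorem exists_isNullGeodesicManifold (c : ℕ) (hc : 1 ≤ c) :
    ∃ (_ : TopologicalSpace (NullGeod c))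
      (_ : ChartedSpace (EuclideanSpace ℝ (Fin 3)) (NullGeod c)),
      IsNullGeodesicManifold (EuclideanSpace ℝ (Fin 3)) (lorentzMetric c) timeField := by
  let _ : TopologicalSpace (NullGeod c) := .coinduced (lensEquiv c hc) inferInstance
  let e : LensSpace (2 * c) ≃ₜ NullGeod c :=
    (lensEquiv c hc).toHomeomorph fun _ ↦ isOpen_coinduced.symm
  have hd : ∀ x y, e x = e y → ∃ g : LensSpace (2 * c) → LensSpace (2 * c),
      ContMDiff (𝓡 3) (𝓡 3) ∞ g ∧ (∀ z, e (g z) = e z) ∧ g x = y := fun x y h ↦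
    ⟨id, contMDiff_id, fun _ ↦ rfl, e.injective h⟩
  let _ : ChartedSpace (EuclideanSpace ℝ (Fin 3)) (NullGeod c) :=
    e.isLocalHomeomorph.chartedSpace e.surjective
  have hM : IsManifold (𝓡 3) ∞ (NullGeod c) :=
    isManifold_of_deck e.isLocalHomeomorph e.surjective hd
  have hD := isLocalDiffeomorph_of_deck e.isLocalHomeomorph e.surjective hd
  exact ⟨_, _, isNullGeodesicManifold_of_diffeo c hc hD.contMDiff
    (contMDiff_symm_of_isLocalDiffeomorph (e := lensEquiv c hc) hD)⟩

/-- The smooth structure of the space of null geodesics is that of the lens space. -/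
theorem contMDiff_lensEquiv (c : ℕ) (hc : 1 ≤ c) [TopologicalSpace (NullGeod c)]
    [ChartedSpace (EuclideanSpace ℝ (Fin 3)) (NullGeod c)]
    (h : IsNullGeodesicManifold (EuclideanSpace ℝ (Fin 3)) (lorentzMetric c) timeField) :
    ContMDiff (𝓡 3) (𝓡 3) ∞ (lensEquiv c hc) ∧
      ContMDiff (𝓡 3) (𝓡 3) ∞ (lensEquiv c hc).symm := by
  obtain ⟨q, hq, hqs, hsec⟩ := h.submersion
  have hqe (v) (hv : v ∈ futureNullCone (lorentzMetric c) timeField) :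
      q v = lensEquiv c hc (vectorToLens c basePoint v) :=
    eq_lensEquiv_of_isTangentTo c hc basePoint (hq v hv)
  constructor
  · intro l
    obtain ⟨p, rfl⟩ := lensProj_surjective c hc l
    have hL := isLocalDiffeomorph_lensProj c hc p
    have hs (p : STS2) := lightVector_spec c 1 0 one_pos p
    -- Taking the light vector at time 0 and projecting it realizes `lensEquiv` after `lensProj` as
    -- a composition of smooth maps; `lensProj` is then removed by a local inverse.
    have h1 : ContMDiff (𝓡 3) (𝓡 3) ∞ (fun p ↦ q (lightVector c 1 0 p)) :=
      contMDiffOn_univ.1 (hqs.comp (contMDiff_lightVector c 1 0).contMDiffOn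
        fun p _ ↦ (hs p).mem_futureNullCone hc)
    refine (ContMDiffAt.comp (I' := 𝓡 3) (lensProj c p) (h1 _)
      hL.localInverse_contMDiffAt).congr_of_eventuallyEq ?_
    filter_upwards [hL.localInverse_eventuallyEq_right] with l hl
    have hl' : lensProj c (hL.localInverse l) = l := hl
    simp only [Function.comp_apply]
    rw [hqe _ ((hs _).mem_futureNullCone hc), (hs _).vectorToLens_eq hc, hl']
  · intro n
    obtain ⟨l, rfl⟩ := (lensEquiv c hc).surjective n
    obtain ⟨p, rfl⟩ := lensProj_surjective c hc l
    have hs := lightVector_spec c 1 0 one_pos p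
    have hv := hs.mem_futureNullCone hc
    -- The inverse bijection is locally `vectorToLens` composed with a section of the submersion.
    obtain ⟨σ, h1, h2, h3⟩ := hsec _ hv
    rw [hqe _ hv, hs.vectorToLens_eq hc] at h1 h2 h3
    have h4 : ContMDiffAt (I21).tangent (𝓡 3) ∞ (vectorToLens c basePoint)
        (σ (lensEquiv c hc (lensProj c p))) := by
      rw [h2]; exact contMDiffAt_vectorToLens c hc basePoint hs.fst_ne_zero
    refine (h4.comp _ h1).congr_of_eventuallyEq ?_
    filter_upwards [h3] with n hn
    rw [Function.comp_apply, Equiv.symm_apply_eq, ← hqe _ hn.1, hn.2]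

/-! ### Tangent vectors of `ST S²` -/

/-- `T_p ST S² → ℝ³ × ℝ³`, the differential of the inclusion. -/
def tangentInclSTS2 (p : STS2) : TangentSpace (𝓡 3) p →L[ℝ] E3 × E3 :=
  mvfderiv (𝓡 3) STS2.incl p

theorem tangentInclSTS2_injective (p : STS2) : Function.Injective (tangentInclSTS2 p) :=
  (STS2.incl_smooth_immersion p).2

theorem hasMFDerivAt_incl (p : STS2) : HasMFDerivAt (𝓡 3) 𝓘(ℝ, E3 × E3) STS2.incl p
    (tangentInclSTS2 p) :=
  ((contMDiff_STS2_incl p).mdifferentiableAt (by simp)).hasMFDerivAt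

/-- These are the derivatives of the equations |x|² = 1, |u|² = 1 and ⟨x, u⟩ = 0. -/
theorem tangentInclSTS2_constraints (p : STS2) (v : TangentSpace (𝓡 3) p) :
    inner ℝ (p.1.1 : E3) (tangentInclSTS2 p v).1 = 0 ∧
    inner ℝ (p.1.2 : E3) (tangentInclSTS2 p v).2 = 0 ∧
    inner ℝ (p.1.1 : E3) (tangentInclSTS2 p v).2 +
      inner ℝ (p.1.2 : E3) (tangentInclSTS2 p v).1 = 0 := by
  have key (f : E3 × E3 → ℝ) (f' : E3 × E3 →L[ℝ] ℝ) (r : ℝ) (hf : HasFDerivAt f f' p.incl)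
      (hr : ∀ q : STS2, f q.incl = r) : f' (tangentInclSTS2 p v) = 0 := by
    have h1 := HasMFDerivAt.comp p hf.hasMFDerivAt (hasMFDerivAt_incl p)
    have h2 : f ∘ STS2.incl = fun _ ↦ r := funext hr
    rw [h2] at h1
    exact DFunLike.congr_fun (hasMFDerivAt_unique h1 (hasMFDerivAt_const r p)) v
  have hf : HasFDerivAt (Prod.fst : E3 × E3 → E3) (ContinuousLinearMap.fst ℝ E3 E3) p.incl :=
    hasFDerivAt_fst
  have hs : HasFDerivAt (Prod.snd : E3 × E3 → E3) (ContinuousLinearMap.snd ℝ E3 E3) p.incl :=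
    hasFDerivAt_snd
  have h1 := key _ _ 1 (hf.inner ℝ hf) fun q ↦ q.inner_fst_fst
  have h2 := key _ _ 1 (hs.inner ℝ hs) fun q ↦ q.inner_snd_snd
  have h3 := key _ _ 0 (hf.inner ℝ hs) fun q ↦ q.inner_fst_snd
  generalize tangentInclSTS2 p v = t at *
  change inner ℝ (p.1.1 : E3) t.1 + inner ℝ t.1 (p.1.1 : E3) = 0 at h1
  change inner ℝ (p.1.2 : E3) t.2 + inner ℝ t.2 (p.1.2 : E3) = 0 at h2
  change inner ℝ (p.1.1 : E3) t.2 + inner ℝ t.1 (p.1.2 : E3) = 0 at h3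
  rw [real_inner_comm (p.1.1 : E3)] at h1
  rw [real_inner_comm (p.1.2 : E3)] at h2
  rw [real_inner_comm (p.1.2 : E3)] at h3
  exact ⟨by linarith, by linarith, h3⟩

theorem exists_tangent_of_curve {α : ℝ → STS2} {p : STS2} {d : E3 × E3}
    (hα : ContMDiffAt 𝓘(ℝ, ℝ) (𝓡 3) ∞ α 0) (h0 : α 0 = p)
    (hd : HasDerivAt (fun s ↦ (α s).incl) d 0) :
    ∃ e : TangentSpace (𝓡 3) p, tangentInclSTS2 p e = d ∧ velocity (𝓡 3) α 0 = ⟨p, e⟩ := by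
  subst h0
  refine ⟨mfderiv 𝓘(ℝ, ℝ) (𝓡 3) α 0 (1 : ℝ), ?_, rfl⟩
  have h1 := HasMFDerivAt.comp 0 (hasMFDerivAt_incl (α 0))
    (hα.mdifferentiableAt (by simp)).hasMFDerivAt
  have h2 := hasMFDerivAt_unique h1 hd.hasFDerivAt.hasMFDerivAt
  refine (DFunLike.congr_fun h2 (1 : ℝ)).trans ?_
  exact one_smul ℝ d

theorem mem_chi_iff (p : STS2) (v : TangentSpace (𝓡 3) p) :
    v ∈ chi p ↔ inner ℝ (p.1.2 : E3) (tangentInclSTS2 p v).1 = 0 := by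
  have h1 : HasMFDerivAt (𝓡 3) 𝓘(ℝ, E3) (fun p : STS2 ↦ (p.base : E3)) p
      ((ContinuousLinearMap.fst ℝ E3 E3).comp (tangentInclSTS2 p)) :=
    HasMFDerivAt.comp (f := STS2.incl) (g := Prod.fst) p
      (ContinuousLinearMap.hasMFDerivAt (ContinuousLinearMap.fst ℝ E3 E3)) (hasMFDerivAt_incl p)
  have h2 : HasMFDerivAt (𝓡 3) 𝓘(ℝ, E3) (fun p : STS2 ↦ (p.base : E3)) p _ :=
    HasMFDerivAt.comp (g := ((↑) : S2 → E3)) p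
      ((contMDiff_coe_sphere (m := 1) p.base).mdifferentiableAt one_ne_zero).hasMFDerivAt
      ((contMDiff_STS2_base p).mdifferentiableAt (by simp)).hasMFDerivAt
  have h3 : (tangentInclSTS2 p v).1 = tangentInclS2 p.base (mfderiv (𝓡 3) (𝓡 2) STS2.base p v) :=
    DFunLike.congr_fun (hasMFDerivAt_unique h1 h2) v
  rw [h3]
  rfl

/-! ### Rotations about a point of a great circle -/

/-- `W` completes `(x, u)` to an orthonormal basis. -/
structure IsNormal (p : STS2) (W : E3) : Prop where
  norm : ‖W‖ = 1
  fst : inner ℝ (p.1.1 : E3) W = 0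
  snd : inner ℝ (p.1.2 : E3) W = 0

theorem exists_isNormal (p : STS2) : ∃ W, IsNormal p W ∧ ∀ v : E3,
    v = inner ℝ (p.1.1 : E3) v • (p.1.1 : E3) + inner ℝ (p.1.2 : E3) v • (p.1.2 : E3) +
      inner ℝ W v • W := by
  obtain ⟨b, hb⟩ := Orthonormal.exists_orthonormalBasis_extension_of_card_eq (𝕜 := ℝ) (E := E3)
    (ι := Fin 3) (by simp) (v := ![(p.1.1 : E3), p.1.2, 0]) (s := {0, 1}) (by
      rw [orthonormal_iff_ite]
      rintro ⟨i, hi⟩ ⟨j, hj⟩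
      rcases hi with rfl | rfl <;> rcases hj with rfl | rfl <;>
        simp [p.inner_fst_snd, p.inner_snd_fst, p.norm_fst, p.norm_snd, Subtype.ext_iff])
  have h0 : b 0 = p.1.1 := hb 0 (by simp)
  have h1 : b 1 = p.1.2 := hb 1 (by simp)
  refine ⟨b 2, ⟨b.norm_eq_one 2, ?_, ?_⟩, fun v ↦ ?_⟩
  · rw [← h0]; exact b.inner_eq_zero (by decide)
  · rw [← h1]; exact b.inner_eq_zero (by decide)
  · have := b.sum_repr' v
    rw [Fin.sum_univ_three, h0, h1] at this
    exact this.symm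

theorem IsNormal.flow {p : STS2} {W : E3} (h : IsNormal p W) (τ : ℝ) :
    IsNormal (NullGeodesics.flow τ p) W :=
  ⟨h.norm, by rw [flow_fst, inner_add_left, inner_smul_left, inner_smul_left, h.fst, h.snd]; simp,
    by rw [flow_snd, inner_add_left, inner_smul_left, inner_smul_left, h.fst, h.snd]; simp⟩

/-- Rotation of the direction `u` about `x`. -/
def turn {p : STS2} {W : E3} (h : IsNormal p W) (s : ℝ) : STS2 :=
  STS2.mk p.1.1 (Real.cos s • (p.1.2 : E3) + Real.sin s • W) p.norm_fst
    (by
      rw [← sq_eq_sq₀ (norm_nonneg _) zero_le_one, ← real_inner_self_eq_norm_sq]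
      simp only [inner_add_left, inner_add_right, inner_smul_left, inner_smul_right,
        p.inner_snd_snd, h.snd, real_inner_comm (p.1.2 : E3) W, real_inner_self_eq_norm_sq W,
        h.norm, conj_trivial]
      linarith [Real.sin_sq_add_cos_sq s])
    (by rw [inner_add_right, inner_smul_right, inner_smul_right, h.fst, p.inner_fst_snd]; simp)

/-- Rotation of the great circle `(x, u)` about its point at time `τ`. -/
def rotation {p : STS2} {W : E3} (h : IsNormal p W) (τ s : ℝ) : STS2 :=
  flow (-τ) (turn (h.flow τ) s)

theorem rotation_zero {p : STS2} {W : E3} (h : IsNormal p W) (τ : ℝ) : rotation h τ 0 = p := by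
  have : turn (h.flow τ) 0 = flow τ p := by apply STS2.ext' <;> simp [turn, STS2.mk]
  rw [rotation, this, flow_neg_flow]

theorem flow_rotation {p : STS2} {W : E3} (h : IsNormal p W) (τ s : ℝ) :
    flow τ (rotation h τ s) = turn (h.flow τ) s := flow_flow_neg _ _

theorem contMDiff_rotation {p : STS2} {W : E3} (h : IsNormal p W) (τ : ℝ) :
    ContMDiff 𝓘(ℝ, ℝ) (𝓡 3) ∞ (rotation h τ) := by
  intro s
  refine contMDiffAt_flow contMDiffAt_const (contMDiffAt_STS2 ?_)
  rw [contMDiffAt_iff_contDiffAt]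
  exact contDiffAt_const.prodMk ((Real.contDiff_cos.smul contDiff_const).add
    (Real.contDiff_sin.smul contDiff_const)).contDiffAt

/-- Turning the direction at time τ has derivative (0, W). Flowing back by τ, which is linear in the
ambient space, gives the stated pair. -/
theorem hasDerivAt_rotation {p : STS2} {W : E3} (h : IsNormal p W) (τ : ℝ) :
    HasDerivAt (fun s ↦ (rotation h τ s).incl) (-Real.sin τ • W, Real.cos τ • W) 0 := by
  have h1 : HasDerivAt (fun s ↦ Real.cos s • ((flow τ p).1.2 : E3) + Real.sin s • W) W 0 := by
    have := ((Real.hasDerivAt_cos 0).smul_const ((flow τ p).1.2 : E3)).add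
      ((Real.hasDerivAt_sin 0).smul_const W)
    convert! this using 1
    simp
  have h2 : HasDerivAt (fun _ : ℝ ↦ ((flow τ p).1.1 : E3)) 0 0 := hasDerivAt_const _ _
  have h3 := ((h2.const_smul (Real.cos (-τ))).add (h1.const_smul (Real.sin (-τ)))).prodMk
    ((h2.const_smul (-Real.sin (-τ))).add (h1.const_smul (Real.cos (-τ))))
  convert! h3 using 1
  simp

theorem flow_add_of_sin_eq_zero (q : STS2) {τ τ' : ℝ} (h : Real.sin (τ' - τ) = 0) :
    ((flow τ' q).1.1 : E3) = Real.cos (τ' - τ) • ((flow τ q).1.1 : E3) := by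
  have : flow τ' q = flow (τ' - τ) (flow τ q) := by rw [flow_flow, sub_add_cancel]
  rw [this, flow_fst, h, zero_smul, add_zero]

/-- At times τ' with sin(τ' - τ) = 0 the great circle is at the centre of rotation or at its
antipode, and both stay fixed. -/
theorem lightCurve_rotation (c : ℕ) {p : STS2} {W : E3} (h : IsNormal p W) {τ τ' : ℝ}
    (hs : Real.sin (τ' - τ) = 0) (s : ℝ) :
    lightCurve c (rotation h τ s) τ' = lightCurve c p τ' := by
  refine Prod.ext (Subtype.ext ?_) rfl
  simp only [lightCurve]
  rw [flow_add_of_sin_eq_zero _ hs, flow_add_of_sin_eq_zero _ hs, flow_rotation]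
  rfl

theorem inner_flow_fst (p : STS2) (s t : ℝ) :
    inner ℝ ((flow s p).1.1 : E3) ((flow t p).1.1 : E3) = Real.cos (t - s) := by
  simp only [flow_fst, inner_add_left, inner_add_right, inner_smul_left, inner_smul_right,
    p.inner_fst_fst, p.inner_fst_snd, p.inner_snd_fst, p.inner_snd_snd, conj_trivial, Real.cos_sub]
  ring

theorem flow_eq_of_fst_eq {p : STS2} {s t : ℝ} (h : ((flow s p).1.1 : E3) = (flow t p).1.1) :
    ∃ k : ℤ, t = s + k * (2 * Real.pi) := by
  have h1 := inner_flow_fst p s t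
  rw [← h, STS2.inner_fst_fst] at h1
  obtain ⟨k, hk⟩ := (Real.cos_eq_one_iff _).1 h1.symm
  exact ⟨k, by linarith⟩

/-! ### Skies and the canonical contact structure -/

/-- The map `(x, u) ↦ γ_{(x,u)}`, factored through the lens space. -/
def toNullGeod (c : ℕ) (hc : 1 ≤ c) (p : STS2) : NullGeod c := lensEquiv c hc (lensProj c p)

theorem toNullGeod_val (c : ℕ) (hc : 1 ≤ c) (p : STS2) :
    (toNullGeod c hc p).1 = greatCircleLift c p := by
  rw [toNullGeod, lensEquiv_lensProj]; rfl

theorem toNullGeod_surjective (c : ℕ) (hc : 1 ≤ c) : Function.Surjective (toNullGeod c hc) :=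
  (lensEquiv c hc).surjective.comp (lensProj_surjective c hc)

theorem toNullGeod_eq_iff (c : ℕ) (hc : 1 ≤ c) (p p' : STS2) :
    toNullGeod c hc p = toNullGeod c hc p' ↔ ∃ k : ℤ, flow (k * (2 * Real.pi / c)) p' = p := by
  rw [← lensProj_eq_iff c hc]
  exact (lensEquiv c hc).injective.eq_iff

theorem mem_toNullGeod_iff (c : ℕ) (hc : 1 ≤ c) (p : STS2) (m : S2 × Circle) :
    m ∈ (toNullGeod c hc p).1 ↔ ∃ s, lightCurve c p s = m := by
  rw [toNullGeod_val, greatCircleLift_eq_range]; rfl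

theorem exists_flow_fst_eq_of_mem (c : ℕ) (hc : 1 ≤ c) {p q : STS2} {τ : ℝ}
    (h : lightCurve c p τ ∈ (toNullGeod c hc q).1) :
    ∃ j : ℤ, ((flow (τ + j * (2 * Real.pi / c)) q).1.1 : E3) = (flow τ p).1.1 := by
  have hc' : (c : ℝ) ≠ 0 := by positivity
  obtain ⟨t, ht⟩ := (mem_toNullGeod_iff c hc q _).1 h
  obtain ⟨j, hj⟩ := Circle.exp_eq_exp.1 (congrArg Prod.snd ht)
  refine ⟨j, ?_⟩
  rw [show τ + j * (2 * Real.pi / c) = t by field_simp; linarith]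
  exact congrArg (fun q : S2 × Circle ↦ (q.1 : E3)) ht

theorem continuous_flow_fst (τ : ℝ) : Continuous fun q : STS2 ↦ ((flow τ q).1.1 : E3) := by
  have h1 : Continuous fun q : STS2 ↦ (q.1.1 : E3) := by fun_prop
  have h2 : Continuous fun q : STS2 ↦ (q.1.2 : E3) := by fun_prop
  exact (h1.const_smul (Real.cos τ)).add (h2.const_smul (Real.sin τ))

/-- Near a null geodesic through a point, the null geodesics through that point pass there at
the same time. -/
theorem eventually_flow_fst_eq (c : ℕ) (hc : 1 ≤ c) {β : ℝ → STS2} {p : STS2} {τ : ℝ}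
    (hβ : ContinuousAt β 0) (h0 : β 0 = p)
    (h : ∀ᶠ s in nhds 0, lightCurve c p τ ∈ (toNullGeod c hc (β s)).1) :
    ∀ᶠ s in nhds 0, ((flow τ (β s)).1.1 : E3) = (flow τ p).1.1 := by
  have hc' : (c : ℝ) ≠ 0 := by positivity
  -- A null geodesic through the point could pass there at a time differing from τ by 2πj/c. For 0 <
  -- j < c the original great circle is elsewhere at that time, and by continuity so are the nearby
  -- ones.
  have hne : ∀ j ∈ Finset.Ioo 0 c, ∀ᶠ s in nhds 0,
      ((flow (τ + j * (2 * Real.pi / c)) (β s)).1.1 : E3) ≠ (flow τ p).1.1 := by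
    intro j hj
    rw [Finset.mem_Ioo] at hj
    have hcont : ContinuousAt (fun s ↦ ((flow (τ + j * (2 * Real.pi / c)) (β s)).1.1 : E3)) 0 :=
      (continuous_flow_fst _).continuousAt.comp' hβ
    refine hcont.eventually_ne ?_
    rw [h0]
    intro he
    obtain ⟨k, hk⟩ := flow_eq_of_fst_eq he
    have h1 : (j : ℝ) + k * c = 0 := by
      have hpi := Real.pi_ne_zero
      have : ((j : ℝ) + k * c) * (2 * Real.pi / c) = 0 := by field_simp; field_simp at hk; linarith
      rcases mul_eq_zero.1 this with h | h
      · exact h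
      · exact absurd h (by positivity)
    have h2 : (j : ℤ) + k * c = 0 := by exact_mod_cast h1
    have h3 : (c : ℤ) ∣ j := ⟨-k, by linarith⟩
    have h4 : c ∣ j := by exact_mod_cast h3
    exact absurd (Nat.le_of_dvd hj.1 h4) (by omega)
  filter_upwards [h, (Filter.eventually_all_finset _).2 hne] with s hs hj
  obtain ⟨j, he⟩ := exists_flow_fst_eq_of_mem c hc hs
  have hcz : (0 : ℤ) < c := by exact_mod_cast hc
  have hm0 := Int.emod_nonneg j hcz.ne'
  have hmc := Int.emod_lt_of_pos j hcz
  obtain ⟨i, hi⟩ := Int.eq_ofNat_of_zero_le hm0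
  have hji : (j : ℝ) = i + c * (j / c : ℤ) := by
    have : j = i + c * (j / c) := by rw [← hi]; exact (Int.emod_add_mul_ediv j c).symm
    exact_mod_cast this
  rw [hji, show τ + ((i : ℝ) + c * (j / c : ℤ)) * (2 * Real.pi / c) =
    τ + i * (2 * Real.pi / c) + (j / c : ℤ) * (2 * Real.pi) by field_simp; ring,
    flow_add_int_mul_two_pi] at he
  rcases Nat.eq_zero_or_pos i with rfl | hpos
  · simpa using he
  · exact absurd he (hj i (Finset.mem_Ioo.2 ⟨hpos, by omega⟩))

/-- On χ the three constraints together with ⟨u, ξ⟩ = 0 remove the x- and u-components of both ξ and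
η. -/
theorem tangentInclSTS2_eq_smul {p : STS2} {W : E3}
    (hW : ∀ v : E3, v = inner ℝ (p.1.1 : E3) v • (p.1.1 : E3) +
      inner ℝ (p.1.2 : E3) v • (p.1.2 : E3) + inner ℝ W v • W) {v : TangentSpace (𝓡 3) p}
    (hv : v ∈ chi p) : ∃ b d : ℝ, tangentInclSTS2 p v = (b • W, d • W) := by
  rw [mem_chi_iff] at hv
  obtain ⟨h1, h2, h3⟩ := tangentInclSTS2_constraints p v
  rw [hv, add_zero] at h3
  generalize tangentInclSTS2 p v = t at *
  refine ⟨inner ℝ W t.1, inner ℝ W t.2, Prod.ext ?_ ?_⟩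
  · exact (hW t.1).trans (by rw [h1, hv]; simp)
  · exact (hW t.2).trans (by rw [h2, h3]; simp)

section Contact

variable {c : ℕ} {hc : 1 ≤ c} [TopologicalSpace (NullGeod c)]
  [ChartedSpace (EuclideanSpace ℝ (Fin 3)) (NullGeod c)]

theorem velocity_comp {p : STS2} {e : TangentSpace (𝓡 3) p} {α : ℝ → STS2}
    (hΨ : IsLocalDiffeomorph (𝓡 3) (𝓡 3) ∞ (toNullGeod c hc))
    (hα : ContMDiffAt 𝓘(ℝ, ℝ) (𝓡 3) ∞ α 0) (he : velocity (𝓡 3) α 0 = ⟨p, e⟩) :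
    velocity (𝓡 3) (toNullGeod c hc ∘ α) 0 =
      ⟨toNullGeod c hc p, mfderiv (𝓡 3) (𝓡 3) (toNullGeod c hc) p e⟩ := by
  have h := tangentMap_comp_at (I := 𝓘(ℝ, ℝ)) (I' := 𝓡 3) (I'' := 𝓡 3) (f := α)
    (g := toNullGeod c hc) ⟨0, (1 : ℝ)⟩ ((hΨ (α 0)).mdifferentiableAt (by simp))
    (hα.mdifferentiableAt (by simp))
  refine h.trans ?_
  change tangentMap (𝓡 3) (𝓡 3) (toNullGeod c hc) (velocity (𝓡 3) α 0) = _
  rw [he]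
  rfl

end Contact

/-! ### Lines tangent to skies -/

/-- The derivative of `q ↦ flow τ q` followed by the projection to `S² ⊂ ℝ³`. -/
def flowBaseDeriv (p : STS2) (τ : ℝ) : TangentSpace (𝓡 3) p →ₗ[ℝ] E3 :=
  (Real.cos τ • LinearMap.fst ℝ E3 E3 + Real.sin τ • LinearMap.snd ℝ E3 E3) ∘ₗ
    (tangentInclSTS2 p).toLinearMap

/-- The tangent vectors along which the point of the great circle at time `τ` stays fixed. -/
def skyLine (p : STS2) (τ : ℝ) : Submodule ℝ (TangentSpace (𝓡 3) p) :=
  LinearMap.ker (flowBaseDeriv p τ)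

/-- Pairing cos τ ξ + sin τ η = 0 with x and with u gives sin τ ⟨x, η⟩ = 0 and cos τ ⟨u, ξ⟩ = 0. As
⟨x, η⟩ = -⟨u, ξ⟩ and sine and cosine do not both vanish, ⟨u, ξ⟩ = 0. -/
theorem skyLine_le_chi (p : STS2) (τ : ℝ) : skyLine p τ ≤ chi p := by
  intro v hv
  have hv : Real.cos τ • (tangentInclSTS2 p v).1 + Real.sin τ • (tangentInclSTS2 p v).2 = 0 := hv
  obtain ⟨h1, h2, h3⟩ := tangentInclSTS2_constraints p v
  rw [mem_chi_iff]
  generalize tangentInclSTS2 p v = t at *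
  have e1 := congrArg (inner ℝ (p.1.1 : E3)) hv
  have e2 := congrArg (inner ℝ (p.1.2 : E3)) hv
  rw [inner_add_right, inner_smul_right, inner_smul_right, inner_zero_right] at e1 e2
  rw [h1] at e1
  rw [h2] at e2
  linear_combination Real.cos τ * e2 - Real.sin τ * e1 + Real.sin τ ^ 2 * h3 -
    inner ℝ (p.1.2 : E3) t.1 * Real.sin_sq_add_cos_sq τ

theorem skyLine_eq_span {p : STS2} {W : E3} (hW : IsNormal p W)
    (hW' : ∀ v : E3, v = inner ℝ (p.1.1 : E3) v • (p.1.1 : E3) +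
      inner ℝ (p.1.2 : E3) v • (p.1.2 : E3) + inner ℝ W v • W) {τ : ℝ} {e : TangentSpace (𝓡 3) p}
    (he : tangentInclSTS2 p e = (-Real.sin τ • W, Real.cos τ • W)) :
    skyLine p τ = Submodule.span ℝ {e} := by
  have hW0 : W ≠ 0 := norm_ne_zero_iff.1 (by rw [hW.norm]; exact one_ne_zero)
  apply le_antisymm
  · intro v hv
    obtain ⟨b, d, hbd⟩ := tangentInclSTS2_eq_smul hW' (skyLine_le_chi p τ hv)
    have hv : Real.cos τ • (tangentInclSTS2 p v).1 + Real.sin τ • (tangentInclSTS2 p v).2 = 0 := hv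
    rw [hbd] at hv
    have h0 : Real.cos τ * b + Real.sin τ * d = 0 := by
      have : (Real.cos τ * b + Real.sin τ * d) • W = 0 := by rw [← hv]; module
      exact (smul_eq_zero.1 this).resolve_right hW0
    -- The pair (b, d) is orthogonal to (cos τ, sin τ), so its coefficient is its inner product with
    -- the unit vector (-sin τ, cos τ).
    refine Submodule.mem_span_singleton.2 ⟨-b * Real.sin τ + d * Real.cos τ, ?_⟩
    apply tangentInclSTS2_injective p
    rw [map_smul, he, hbd]
    have hsc := Real.sin_sq_add_cos_sq τ
    refine Prod.ext ?_ ?_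
    · change (-b * Real.sin τ + d * Real.cos τ) • -Real.sin τ • W = b • W
      rw [smul_smul]
      congr 1
      linear_combination b * hsc - Real.cos τ * h0
    · change (-b * Real.sin τ + d * Real.cos τ) • Real.cos τ • W = d • W
      rw [smul_smul]
      congr 1
      linear_combination d * hsc - Real.sin τ * h0
  · rw [Submodule.span_singleton_le_iff_mem]
    change Real.cos τ • (tangentInclSTS2 p e).1 + Real.sin τ • (tangentInclSTS2 p e).2 = 0
    rw [he]
    module

theorem exists_rotation_velocity {p : STS2} {W : E3} (h : IsNormal p W) (τ : ℝ) :
    ∃ e : TangentSpace (𝓡 3) p, tangentInclSTS2 p e = (-Real.sin τ • W, Real.cos τ • W) ∧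
      velocity (𝓡 3) (rotation h τ) 0 = ⟨p, e⟩ :=
  exists_tangent_of_curve (contMDiff_rotation h τ 0) (rotation_zero h τ) (hasDerivAt_rotation h τ)

theorem finrank_skyLine (p : STS2) (τ : ℝ) : Module.finrank ℝ (skyLine p τ) = 1 := by
  obtain ⟨W, hW, hW'⟩ := exists_isNormal p
  obtain ⟨e, he, -⟩ := exists_rotation_velocity hW τ
  rw [skyLine_eq_span hW hW' he]
  apply finrank_span_singleton
  rintro rfl
  rw [map_zero] at he
  have hW0 : W ≠ 0 := norm_ne_zero_iff.1 (by rw [hW.norm]; exact one_ne_zero)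
  have h1 := (smul_eq_zero.1 (congrArg Prod.fst he).symm).resolve_right hW0
  have h2 := (smul_eq_zero.1 (congrArg Prod.snd he).symm).resolve_right hW0
  have := Real.sin_sq_add_cos_sq τ
  rw [h2, neg_eq_zero.1 h1] at this
  norm_num at this

theorem disjoint_skyLine (p : STS2) {τ τ' : ℝ} (h : Real.sin (τ' - τ) ≠ 0) :
    Disjoint (skyLine p τ) (skyLine p τ') := by
  rw [Submodule.disjoint_def]
  intro v h1 h2
  have h1 : Real.cos τ • (tangentInclSTS2 p v).1 + Real.sin τ • (tangentInclSTS2 p v).2 = 0 := h1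
  have h2 : Real.cos τ' • (tangentInclSTS2 p v).1 + Real.sin τ' • (tangentInclSTS2 p v).2 = 0 := h2
  apply tangentInclSTS2_injective p
  rw [map_zero]
  generalize tangentInclSTS2 p v = t at *
  rw [Real.sin_sub] at h
  refine Prod.ext ((smul_eq_zero.1 (?_ : (Real.sin τ' * Real.cos τ - Real.cos τ' * Real.sin τ) •
    t.1 = 0)).resolve_left h) ((smul_eq_zero.1 (?_ : (Real.sin τ' * Real.cos τ -
    Real.cos τ' * Real.sin τ) • t.2 = 0)).resolve_left h)
  · calc _ = Real.sin τ' • (Real.cos τ • t.1 + Real.sin τ • t.2) -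
          Real.sin τ • (Real.cos τ' • t.1 + Real.sin τ' • t.2) := by module
      _ = 0 := by rw [h1, h2, smul_zero, smul_zero, sub_zero]
  · calc _ = Real.cos τ • (Real.cos τ' • t.1 + Real.sin τ' • t.2) -
          Real.cos τ' • (Real.cos τ • t.1 + Real.sin τ • t.2) := by module
      _ = 0 := by rw [h1, h2, smul_zero, smul_zero, sub_zero]

theorem chi_eq_sup (p : STS2) {τ τ' : ℝ} (h : Real.sin (τ' - τ) ≠ 0) :
    chi p = skyLine p τ ⊔ skyLine p τ' := by
  apply le_antisymm _ (sup_le (skyLine_le_chi p τ) (skyLine_le_chi p τ'))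
  intro v hv
  obtain ⟨W, hW, hW'⟩ := exists_isNormal p
  obtain ⟨e, he, -⟩ := exists_rotation_velocity hW τ
  obtain ⟨e', he', -⟩ := exists_rotation_velocity hW τ'
  rw [skyLine_eq_span hW hW' he, skyLine_eq_span hW hW' he', ← Submodule.span_insert,
    Submodule.mem_span_pair]
  obtain ⟨b, d, hbd⟩ := tangentInclSTS2_eq_smul hW' hv
  rw [Real.sin_sub] at h
  -- Cramer's rule for the vectors (-sin τ, cos τ) and (-sin τ', cos τ'), whose determinant is
  -- sin(τ' - τ) up to sign.
  refine ⟨(b * Real.cos τ' + d * Real.sin τ') /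
      (Real.sin τ' * Real.cos τ - Real.cos τ' * Real.sin τ),
    -(b * Real.cos τ + d * Real.sin τ) / (Real.sin τ' * Real.cos τ - Real.cos τ' * Real.sin τ), ?_⟩
  apply tangentInclSTS2_injective p
  rw [map_add, map_smul, map_smul, he, he', hbd]
  refine Prod.ext ?_ ?_
  · simp only [Prod.fst_add, Prod.smul_fst, smul_smul, ← add_smul]
    congr 1
    field_simp
    ring
  · simp only [Prod.snd_add, Prod.smul_snd, smul_smul, ← add_smul]
    congr 1
    field_simp
    ring

theorem finrank_chi (p : STS2) : Module.finrank ℝ (chi p) = 2 := by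
  have h : Real.sin (Real.pi / 2 - 0) ≠ 0 := by simp
  have : FiniteDimensional ℝ (TangentSpace (𝓡 3) p) :=
    inferInstanceAs (FiniteDimensional ℝ (EuclideanSpace ℝ (Fin 3)))
  have h1 := Submodule.finrank_sup_add_finrank_inf_eq (skyLine p 0) (skyLine p (Real.pi / 2))
  rw [(disjoint_skyLine p h).eq_bot, ← chi_eq_sup p h, finrank_skyLine, finrank_skyLine] at h1
  simpa using h1

/-! ### Null geodesics through two points of a null geodesic -/

/-- A null geodesic is determined by two of its points at times which differ by `π / (2c)`. -/
theorem toNullGeod_eq_of_mem (c : ℕ) (hc : 1 ≤ c) {p q : STS2}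
    (h0 : lightCurve c p 0 ∈ (toNullGeod c hc q).1)
    (h1 : lightCurve c p (Real.pi / (2 * c)) ∈ (toNullGeod c hc q).1) :
    toNullGeod c hc q = toNullGeod c hc p := by
  have hc' : (0 : ℝ) < c := by exact_mod_cast hc
  have hpi := Real.pi_pos
  obtain ⟨i, hi⟩ := exists_flow_fst_eq_of_mem c hc h0
  obtain ⟨j, hj⟩ := exists_flow_fst_eq_of_mem c hc h1
  -- The two positions are at angle π/(2c), while q reaches them at times differing by π/(2c) + 2π(j
  -- - i)/c. Equality of the cosines leaves two cases: either the shifts i and j agree modulo c, or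
  -- 1 + 2(j - i) is even.
  have hcos := inner_flow_fst q (0 + i * (2 * Real.pi / c))
    (Real.pi / (2 * c) + j * (2 * Real.pi / c))
  rw [hi, hj, inner_flow_fst, eq_comm, Real.cos_eq_cos_iff] at hcos
  obtain ⟨k, hk | hk⟩ := hcos
  · refine (toNullGeod_eq_iff c hc q p).2 ⟨-i, ?_⟩
    have hp : flow (i * (2 * Real.pi / c)) q = p := by
      refine eq_of_flow_fst_eq (s := 0) (t := Real.pi / (2 * c)) ?_ ?_ ?_
      · rw [sub_zero]
        refine (Real.sin_pos_of_pos_of_lt_pi (by positivity) ?_).ne'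
        rw [div_lt_iff₀ (by positivity)]
        have : (1 : ℝ) ≤ c := by exact_mod_cast hc
        nlinarith
      · rw [flow_flow, hi]
      · rw [flow_flow, ← hj, show Real.pi / (2 * c) + j * (2 * Real.pi / c) =
          Real.pi / (2 * c) + i * (2 * Real.pi / c) + (-k : ℤ) * (2 * Real.pi) by
            push_cast; linarith, flow_add_int_mul_two_pi]
    rw [← hp, flow_flow]
    simp [flow_zero]
  · exfalso
    have h2 : (1 : ℝ) + 2 * (j - i) = 2 * (k * c) := by
      field_simp at hk
      apply mul_left_cancel₀ hpi.ne'
      linarith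
    have h3 : (1 : ℤ) + 2 * (j - i) = 2 * (k * c) := by exact_mod_cast h2
    omega

/-! ### Tangent spaces of skies and the contact distribution. -/

section Contact

variable {c : ℕ} {hc : 1 ≤ c} [TopologicalSpace (NullGeod c)]
  [ChartedSpace (EuclideanSpace ℝ (Fin 3)) (NullGeod c)]

/-- Rotating the great circle about its point at time τ gives a curve inside the sky whose velocity
spans the line. -/
theorem map_skyLine_le_skyTangent
    (hΨ : IsLocalDiffeomorph (𝓡 3) (𝓡 3) ∞ (toNullGeod c hc)) (p : STS2) (τ : ℝ) :
    (skyLine p τ).map (mfderiv (𝓡 3) (𝓡 3) (toNullGeod c hc) p).toLinearMap ≤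
      skyTangent E3 (toNullGeod c hc p) (lightCurve c p τ) := by
  obtain ⟨W, hW, hW'⟩ := exists_isNormal p
  obtain ⟨e, he, hv⟩ := exists_rotation_velocity hW τ
  rw [skyLine_eq_span hW hW' he, Submodule.map_span_le]
  rintro _ rfl
  refine Submodule.subset_span ⟨toNullGeod c hc ∘ rotation hW τ,
    hΨ.contMDiff.comp (contMDiff_rotation hW τ), fun s ↦ ?_,
    velocity_comp hΨ (contMDiff_rotation hW τ 0) hv⟩
  exact (mem_toNullGeod_iff c hc _ _).2 ⟨τ, lightCurve_rotation c hW (by simp) s⟩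

theorem velocity_congr {α β : ℝ → NullGeod c} {s : ℝ} (h : α =ᶠ[nhds s] β) :
    velocity (𝓡 3) α s = velocity (𝓡 3) β s :=
  Bundle.TotalSpace.ext h.eq_of_nhds (heq_of_eq (DFunLike.congr_fun h.mfderiv_eq (1 : ℝ)))

/-- A curve in the sky lifts near 0 to ST S². By `eventually_flow_fst_eq` the lifted great circles
all have the same position at time τ, and differentiating this condition puts the velocity in the
line. -/
theorem skyTangent_le (hΨ : IsLocalDiffeomorph (𝓡 3) (𝓡 3) ∞ (toNullGeod c hc)) (p : STS2)
    (τ : ℝ) : skyTangent E3 (toNullGeod c hc p) (lightCurve c p τ) ≤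
      (skyLine p τ).map (mfderiv (𝓡 3) (𝓡 3) (toNullGeod c hc) p).toLinearMap := by
  refine Submodule.span_le.2 ?_
  rintro w ⟨α, hα, hsky, hvel⟩
  have hα0 : α 0 = toNullGeod c hc p := congrArg Bundle.TotalSpace.proj hvel
  set β : ℝ → STS2 := (hΨ p).localInverse ∘ α with hβdef
  have hβ0 : β 0 = p := by
    rw [hβdef, Function.comp_apply, hα0]
    exact (hΨ p).localInverse_left_inv (hΨ p).localInverse_mem_target
  have hβ : ContMDiffAt 𝓘(ℝ, ℝ) (𝓡 3) ∞ β 0 :=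
    ContMDiffAt.comp 0 (by rw [hα0]; exact (hΨ p).localInverse_contMDiffAt) (hα 0)
  have hαβ : toNullGeod c hc ∘ β =ᶠ[nhds 0] α := by
    have h := (hΨ p).localInverse_eventuallyEq_right
    rw [← hα0] at h
    exact (hα.continuous.continuousAt (x := 0)).eventually h
  have hder := ((contMDiffAt_iff_contDiffAt.1
    ((contMDiff_STS2_incl (β 0)).comp 0 hβ)).differentiableAt (by simp)).hasDerivAt
  obtain ⟨v, hv, hvv⟩ := exists_tangent_of_curve hβ hβ0 hder
  have hcomp := velocity_comp hΨ hβ hvv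
  have hfl := eventually_flow_fst_eq c hc (τ := τ) hβ.continuousAt hβ0
    (hαβ.mono fun s hs ↦ by
      change toNullGeod c hc (β s) = α s at hs
      rw [hs]
      exact hsky s)
  rw [← hv] at hder
  refine ⟨v, ?_, ?_⟩
  · have h1 : HasDerivAt (fun s ↦ ((flow τ (β s)).1.1 : E3)) (flowBaseDeriv p τ v) 0 :=
      (Real.cos τ • ContinuousLinearMap.fst ℝ E3 E3 +
        Real.sin τ • ContinuousLinearMap.snd ℝ E3 E3).hasFDerivAt.comp_hasDerivAt 0 hder
    exact h1.unique ((hasDerivAt_const (0 : ℝ) ((flow τ p).1.1 : E3)).congr_of_eventuallyEq hfl)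
  · rw [velocity_congr hαβ, hvel] at hcomp
    exact (Bundle.TotalSpace.mk_injective _ hcomp).symm

theorem skyTangent_eq (hΨ : IsLocalDiffeomorph (𝓡 3) (𝓡 3) ∞ (toNullGeod c hc)) (p : STS2)
    (τ : ℝ) : skyTangent E3 (toNullGeod c hc p) (lightCurve c p τ) =
      (skyLine p τ).map (mfderiv (𝓡 3) (𝓡 3) (toNullGeod c hc) p).toLinearMap :=
  le_antisymm (skyTangent_le hΨ p τ) (map_skyLine_le_skyTangent hΨ p τ)

theorem joinedByFamily_of_sin_eq_zero
    (hΨ : IsLocalDiffeomorph (𝓡 3) (𝓡 3) ∞ (toNullGeod c hc)) (p : STS2) {τ τ' : ℝ}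
    (h : Real.sin (τ' - τ) = 0) :
    JoinedByFamily E3 (toNullGeod c hc p) (lightCurve c p τ) (lightCurve c p τ') := by
  obtain ⟨W, hW, hW'⟩ := exists_isNormal p
  refine ⟨toNullGeod c hc ∘ rotation hW τ, hΨ.contMDiff.comp (contMDiff_rotation hW τ), ?_,
    fun s ↦ ⟨?_, ?_⟩, Real.pi / 2, fun he ↦ ?_⟩
  · rw [Function.comp_apply, rotation_zero]
  · exact (mem_toNullGeod_iff c hc _ _).2 ⟨τ, lightCurve_rotation c hW (by simp) s⟩
  · exact (mem_toNullGeod_iff c hc _ _).2 ⟨τ', lightCurve_rotation c hW h s⟩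
  -- A quarter turn makes W the direction. If the geodesic were unchanged, W would lie in the plane
  -- of the original great circle, to which it is orthogonal.
  · obtain ⟨k, hk⟩ := (toNullGeod_eq_iff c hc _ _).1 he
    have h1 := congrArg (flow τ) hk
    rw [flow_rotation, flow_flow, add_comm, ← flow_flow] at h1
    have hN := hW.flow τ
    have h2 : ((flow (k * (2 * Real.pi / c)) (flow τ p)).1.2 : E3) = W := by
      rw [h1]
      change Real.cos (Real.pi / 2) • ((flow τ p).1.2 : E3) + Real.sin (Real.pi / 2) • W = W
      simp
    have h3 := congrArg (inner ℝ W) h2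
    rw [flow_snd, inner_add_right, inner_smul_right, inner_smul_right, real_inner_comm, hN.fst,
      real_inner_comm, hN.snd, real_inner_self_eq_norm_sq, hW.norm] at h3
    norm_num at h3

/-- Points not joined by a family have sin(τ' - τ) ≠ 0, so their lines are independent and span χ;
the differential, being injective, preserves this. -/
theorem disjoint_skyTangent_and_map_chi_eq
    (hΨ : IsLocalDiffeomorph (𝓡 3) (𝓡 3) ∞ (toNullGeod c hc)) (p : STS2)
    {x y : S2 × Circle} (hx : x ∈ (toNullGeod c hc p).1) (hy : y ∈ (toNullGeod c hc p).1)
    (hxy : ¬ JoinedByFamily E3 (toNullGeod c hc p) x y) :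
    Disjoint (skyTangent E3 (toNullGeod c hc p) x) (skyTangent E3 (toNullGeod c hc p) y) ∧
    skyTangent E3 (toNullGeod c hc p) x ⊔ skyTangent E3 (toNullGeod c hc p) y =
      (chi p).map (mfderiv (𝓡 3) (𝓡 3) (toNullGeod c hc) p).toLinearMap := by
  obtain ⟨τ, rfl⟩ := (mem_toNullGeod_iff c hc p x).1 hx
  obtain ⟨τ', rfl⟩ := (mem_toNullGeod_iff c hc p y).1 hy
  have h : Real.sin (τ' - τ) ≠ 0 := fun h ↦ hxy (joinedByFamily_of_sin_eq_zero hΨ p h)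
  rw [skyTangent_eq hΨ, skyTangent_eq hΨ, chi_eq_sup p h, Submodule.map_sup]
  exact ⟨Submodule.disjoint_map ((hΨ p).mfderivToContinuousLinearEquiv (by simp)).injective
    (disjoint_skyLine p h), rfl⟩

/-- Only one null geodesic passes through the points at times 0 and π/(2c), so every family through
both is constant, whatever the smooth structure. -/
theorem exists_not_joinedByFamily (c : ℕ) (hc : 1 ≤ c) [TopologicalSpace (NullGeod c)]
    [ChartedSpace (EuclideanSpace ℝ (Fin 3)) (NullGeod c)] (n : NullGeod c) :
    ∃ x ∈ n.1, ∃ y ∈ n.1, ¬ JoinedByFamily E3 n x y := by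
  obtain ⟨p, rfl⟩ := toNullGeod_surjective c hc n
  refine ⟨lightCurve c p 0, (mem_toNullGeod_iff c hc p _).2 ⟨_, rfl⟩,
    lightCurve c p (Real.pi / (2 * c)), (mem_toNullGeod_iff c hc p _).2 ⟨_, rfl⟩, ?_⟩
  rintro ⟨α, -, -, hα, s, hs⟩
  obtain ⟨q, hq⟩ := toNullGeod_surjective c hc (α s)
  obtain ⟨h0, h1⟩ := hα s
  rw [← hq] at h0 h1 hs
  exact hs (toNullGeod_eq_of_mem c hc h0 h1)

/-- The sum of the tangent spaces of the skies of two points of a null geodesic which are not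
joined by a family of null geodesics. -/
def contactSpace (c : ℕ) (hc : 1 ≤ c) [TopologicalSpace (NullGeod c)]
    [ChartedSpace (EuclideanSpace ℝ (Fin 3)) (NullGeod c)] (n : NullGeod c) :
    Submodule ℝ (TangentSpace (𝓡 3) n) :=
  skyTangent E3 n (exists_not_joinedByFamily c hc n).choose ⊔
    skyTangent E3 n (exists_not_joinedByFamily c hc n).choose_spec.2.choose

theorem contactSpace_toNullGeod (hΨ : IsLocalDiffeomorph (𝓡 3) (𝓡 3) ∞ (toNullGeod c hc))
    (p : STS2) :
    contactSpace c hc (toNullGeod c hc p) =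
      (chi p).map (mfderiv (𝓡 3) (𝓡 3) (toNullGeod c hc) p).toLinearMap := by
  have h := (exists_not_joinedByFamily c hc (toNullGeod c hc p)).choose_spec
  exact (disjoint_skyTangent_and_map_chi_eq hΨ p h.1 h.2.choose_spec.1 h.2.choose_spec.2).2

theorem isCanonicalContactStructure_contactSpace
    (hΨ : IsLocalDiffeomorph (𝓡 3) (𝓡 3) ∞ (toNullGeod c hc)):
    IsCanonicalContactStructure (contactSpace c hc) := by
  intro n
  obtain ⟨p, rfl⟩ := toNullGeod_surjective c hc n
  refine ⟨?_, exists_not_joinedByFamily c hc _, fun x hx y hy hxy ↦ ?_⟩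
  · rw [contactSpace_toNullGeod hΨ,
      show (chi p).map (mfderiv (𝓡 3) (𝓡 3) (toNullGeod c hc) p).toLinearMap = (chi p).map
        (((hΨ p).mfderivToContinuousLinearEquiv (by simp)).toLinearEquiv : _ →ₗ[ℝ] _) from rfl,
      LinearEquiv.finrank_map_eq, finrank_chi, finrank_euclideanSpace_fin]
  · rw [contactSpace_toNullGeod hΨ]
    obtain ⟨h1, h2⟩ := disjoint_skyTangent_and_map_chi_eq hΨ p hx hy hxy
    exact ⟨h1, h2.symm⟩

end Contact

end NullGeodesics

end

/-! ### The identifications with ST S² and with the lens space. -/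

theorem theorem3p10 (c : ℕ) (hc : 1 ≤ c) :
    (∃ (_ : TopologicalSpace (NullGeod c))
        (_ : ChartedSpace (EuclideanSpace ℝ (Fin 3)) (NullGeod c)),
      IsNullGeodesicManifold (EuclideanSpace ℝ (Fin 3)) (lorentzMetric c) timeField) ∧
    ∀ [TopologicalSpace (NullGeod c)] [ChartedSpace (EuclideanSpace ℝ (Fin 3)) (NullGeod c)],
      IsNullGeodesicManifold (EuclideanSpace ℝ (Fin 3)) (lorentzMetric c) timeField →
      ∃ D : ∀ n : NullGeod c, Submodule ℝ (TangentSpace (𝓡 3) n),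
        IsCanonicalContactStructure D ∧
        (c = 1 → ∃ F : STS2 ≃ₘ⟮𝓡 3, 𝓡 3⟯ NullGeod c,
          (∀ p, (F p).1 = greatCircleLift c p) ∧
          ∀ p, D (F p) = (chi p).map (mfderiv (𝓡 3) (𝓡 3) F p).toLinearMap) ∧
        (1 < c → ∃ F : LensSpace (2 * c) ≃ₘ⟮𝓡 3, 𝓡 3⟯ NullGeod c,
          (∀ p, (F (lensProj c p)).1 = greatCircleLift c p) ∧
          IsLocalDiffeomorph (𝓡 3) (𝓡 3) ∞ (lensProj c) ∧
          ∃ rchi : ∀ l : LensSpace (2 * c), Submodule ℝ (TangentSpace (𝓡 3) l),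
            (∀ p, rchi (lensProj c p) =
              (chi p).map (mfderiv (𝓡 3) (𝓡 3) (lensProj c) p).toLinearMap) ∧
            ∀ l, D (F l) = (rchi l).map (mfderiv (𝓡 3) (𝓡 3) F l).toLinearMap) := by
  refine ⟨exists_isNullGeodesicManifold c hc, fun {_ _} h ↦ ?_⟩
  obtain ⟨h1, h2⟩ := contMDiff_lensEquiv c hc h
  let F : LensSpace (2 * c) ≃ₘ⟮𝓡 3, 𝓡 3⟯ NullGeod c := ⟨lensEquiv c hc, h1, h2⟩
  have hr := isLocalDiffeomorph_lensProj c hc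
  have hΨ : IsLocalDiffeomorph (𝓡 3) (𝓡 3) ∞ (toNullGeod c hc) := fun p ↦
    IsLocalDiffeomorphAt.comp (𝓡 3) (NullGeod c) (hr p) (F.isLocalDiffeomorph (lensProj c p))
  refine ⟨contactSpace c hc, isCanonicalContactStructure_contactSpace hΨ, fun hc1 ↦ ?_, fun _ ↦ ?_⟩
  -- For c = 1 the identifying flow time is the full period 2π, so nothing is identified.
  · have hinj : Function.Injective (toNullGeod c hc) := fun p p' hp ↦ by
      obtain ⟨k, rfl⟩ := (toNullGeod_eq_iff c hc p p').1 hp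
      have := flow_add_int_mul_two_pi 0 k p'
      rwa [zero_add, flow_zero, show 2 * Real.pi = 2 * Real.pi / c by simp [hc1]] at this
    let e : STS2 ≃ NullGeod c := .ofBijective _ ⟨hinj, toNullGeod_surjective c hc⟩
    exact ⟨⟨e, hΨ.contMDiff, contMDiff_symm_of_isLocalDiffeomorph (e := e) hΨ⟩,
      toNullGeod_val c hc, contactSpace_toNullGeod hΨ⟩
  · have hchain (p : STS2) : mfderiv (𝓡 3) (𝓡 3) (toNullGeod c hc) p =
        (mfderiv (𝓡 3) (𝓡 3) F (lensProj c p)).comp (mfderiv (𝓡 3) (𝓡 3) (lensProj c) p) :=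
      mfderiv_comp p (F.mdifferentiable (by simp) _) ((hr p).mdifferentiableAt (by simp))
    have hF (l) : Function.Bijective (mfderiv (𝓡 3) (𝓡 3) F l) :=
      (F.mfderivToContinuousLinearEquiv (by simp) l).bijective
    -- Pulling the contact distribution back by `F` avoids choosing lifts to ST S². The chain rule
    -- and injectivity of the differential of `F` show that it equals the pushforward of χ at every
    -- lift, which is the well-definedness of r_*χ.
    refine ⟨F, toNullGeod_val c hc, hr, fun l ↦ (contactSpace c hc (F l)).comap
      (mfderiv (𝓡 3) (𝓡 3) F l).toLinearMap, fun p ↦ ?_, fun l ↦ ?_⟩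
    · have hD : contactSpace c hc (F (lensProj c p)) = ((chi p).map
          (mfderiv (𝓡 3) (𝓡 3) (lensProj c) p).toLinearMap).map
            (mfderiv (𝓡 3) (𝓡 3) F (lensProj c p)).toLinearMap := by
        rw [← Submodule.map_comp]
        exact (contactSpace_toNullGeod hΨ p).trans (by rw [hchain]; rfl)
      exact (congrArg (Submodule.comap _) hD).trans
        (Submodule.comap_map_eq_of_injective (hF _).1 _)
    · exact (Submodule.map_comap_eq_of_surjective (hF l).2 _).symm
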